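/- Let $p$ be an odd prime. A prop is a strict symmetric monoidal category with objects the natural numbers and tensor product $+$ on objects. **Affine Lagrangian relations.** Equip $\mathbb F_p^{n}\oplus\mathbb F_p^{n}$ ($X$-grading, $Z$-grading) with the symplectic form $\omega_n((x,z),(x',z'))=\langle x,z'\rangle-\langle z,x'\rangle$. A linear relation $W\subseteq \mathbb F_p^{2n}\oplus\mathbb F_p^{2m}$ is *Lagrangian* if it equals its own dual with respect to the form $\omega_m-\omega_n$. The prop $\mathsf{AffLagRel}_{\mathbb F_p}$ (Spekkens' $p$-dimensional qudit toy model) has as morphisms $n\to m$ the relations between $\mathbb F_p^{2n}$ and $\mathbb F_p^{2m}$ generated, under relational composition, direct sum (taken gradingwise) and permutations of wires, by the Lagrangian relations and the affine shifts $v\mapsto v+u$. The curried form $\hat f:0\to n+m$ of $f:n\to m$ is obtained by composing $1_n\oplus f$ with the cup $\{((-x,x),(z,z))\}:0\to n+n$. **Stabilizer circuits.** Let $|a\rangle$, $a\in\mathbb Z/p$, be the standard basis of $\mathbb C^p$. Put $\mathcal X=\sum_a|a+1\rangle\langle a|$, $\mathcal Z=\sum_a e^{2\pi i a/p}|a\rangle\langle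 a|$. The $n$-qudit Pauli group is generated by $e^{\pi i/p}$ and by $\mathcal X,\mathcal Z$ acting on single tensor factors of $(\mathbb C^{p})^{\otimes n}$; a Clifford operator is a unitary $U$ on $(\mathbb C^{p})^{\otimes n}$ which normalizes the Pauli group. $\mathsf{Stab}_p$ is the prop of matrices $(\mathbb C^p)^{\otimes n}\to(\mathbb C^p)^{\otimes m}$ generated under composition, tensor product and permutations of factors by all Clifford operators, $|0\rangle$ and $\langle 0|$, modulo multiplication by nonzero complex scalars. **Theorem.** 1. There is exactly one family of maps $G_n:\mathsf{AffLagRel}_{\mathbb F_p}(0,n)\to\mathsf{Stab}_p(0,n)$, $n\ge 0$, such that $G(\varnothing)=0$, $G(\{(x,z): z=0\})=|0\rangle^{\otimes n}$, and $G(g\circ A)=U\circ G(A)$ for each of the following pairs $(g,U)$, acting on wire $i$, or on wires $i\ne j$: $z_i\mapsto z_i+1$ with $U=\mathcal X$; $(x_i,z_i)\mapsto(z_i,-x_i)$ with $U=\mathcal F=\frac1{\sqrt p}\sum_{a,b}e^{2\pi i ab/p}|b\rangle\langle a|$; $x_i\mapsto x_i+z_i$ with $U=\mathcal S=\sum_{a=0}^{p-1}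 e^{\pi i a(a+p)/p}|a\rangle\langle a|$; $(x_i,z_j)\mapsto(x_i-x_j,\,z_j+z_i)$ with $U=\mathcal C=\sum_{a,b}|a,a+b\rangle\langle a,b|$. Every $G_n$ is a bijection. 2. Let $\eta_n=\sum_{a\in(\mathbb Z/p)^n}\langle a,a|$ be the cap of the compact closed structure induced by the $Z$-observable, and for $f:n\to m$ put $$H(f)=(\eta_n\otimes 1_m)\circ(1_n\otimes G(\hat f)).$$ Then $H(f)$ is a morphism $n\to m$ of $\mathsf{Stab}_p$, and $H$, together with the identity on objects, is a symmetric monoidal functor $\mathsf{AffLagRel}_{\mathbb F_p}\to\mathsf{Stab}_p$, strictly monoidal (its structure morphisms are identities), and an equivalence of categories. -/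

import Mathlib

open CategoryTheory MonoidalCategory

/-! ### Props

A prop is a strict symmetric monoidal category whose objects are the natural numbers, with
addition as tensor product.  The structural isomorphisms of a prop are its permutations of wires;
`perm e` sends the input wire `i` to the output wire `e i`. -/

/-- The block sum of two bijections of wires. -/
def blockSum {a b c d : ℕ} (e : Fin a ≃ Fin b) (f : Fin c ≃ Fin d) : Fin (a + c) ≃ Fin (b + d) :=
  finSumFinEquiv.symm.trans ((Equiv.sumCongr e f).trans finSumFinEquiv)

/-- Reassociation of wires (the identity on positions). -/
def assocWires (a b c : ℕ) : Fin (a + b + c) ≃ Fin (a + (b + c)) := finCongr (Nat.add_assoc a b c)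

/-- Removing an empty bunch of wires on the left (the identity on positions). -/
def leftWires (a : ℕ) : Fin (0 + a) ≃ Fin a := finCongr (Nat.zero_add a)

/-- Removing an empty bunch of wires on the right (the identity on positions). -/
def rightWires (a : ℕ) : Fin (a + 0) ≃ Fin a := finCongr (Nat.add_zero a)

/-- Exchanging two bunches of wires. -/
def swapWires (a b : ℕ) : Fin (a + b) ≃ Fin (b + a) := finAddFlip

@[simp] theorem blockSum_castAdd {a b c d : ℕ} (e : Fin a ≃ Fin b) (f : Fin c ≃ Fin d) (i : Fin a) :
    blockSum e f (Fin.castAdd c i) = Fin.castAdd d (e i) := by simp [blockSum]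

@[simp] theorem blockSum_natAdd {a b c d : ℕ} (e : Fin a ≃ Fin b) (f : Fin c ≃ Fin d) (i : Fin c) :
    blockSum e f (Fin.natAdd a i) = Fin.natAdd b (f i) := by simp [blockSum]

@[simp] theorem swapWires_castAdd (a b : ℕ) (i : Fin a) :
    swapWires a b (Fin.castAdd b i) = Fin.natAdd b i := by simp [swapWires]

@[simp] theorem swapWires_natAdd (a b : ℕ) (i : Fin b) :
    swapWires a b (Fin.natAdd a i) = Fin.castAdd a i := by simp [swapWires]

theorem Wires.ext {a b c : ℕ} {e f : Fin (a + b) ≃ Fin c}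
    (hl : ∀ i, (e (Fin.castAdd b i) : ℕ) = f (Fin.castAdd b i))
    (hr : ∀ i, (e (Fin.natAdd a i) : ℕ) = f (Fin.natAdd a i)) : e = f :=
  Equiv.ext fun i => Fin.ext (Fin.addCases hl hr i)

theorem assocWires_castAdd_castAdd (a b c : ℕ) (i : Fin a) :
    assocWires a b c (Fin.castAdd c (Fin.castAdd b i)) = Fin.castAdd (b + c) i := rfl

theorem assocWires_castAdd_natAdd (a b c : ℕ) (i : Fin b) :
    assocWires a b c (Fin.castAdd c (Fin.natAdd a i)) = Fin.natAdd a (Fin.castAdd c i) := rfl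

theorem assocWires_natAdd (a b c : ℕ) (i : Fin c) :
    assocWires a b c (Fin.natAdd (a + b) i) = Fin.natAdd a (Fin.natAdd b i) :=
  Fin.ext (Nat.add_assoc a b i)

theorem assocWires_symm_castAdd (a b c : ℕ) (i : Fin a) :
    (assocWires a b c).symm (Fin.castAdd (b + c) i) = Fin.castAdd c (Fin.castAdd b i) := rfl

theorem assocWires_symm_natAdd_castAdd (a b c : ℕ) (i : Fin b) :
    (assocWires a b c).symm (Fin.natAdd a (Fin.castAdd c i)) = Fin.castAdd c (Fin.natAdd a i) := rfl

theorem assocWires_symm_natAdd_natAdd (a b c : ℕ) (i : Fin c) :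
    (assocWires a b c).symm (Fin.natAdd a (Fin.natAdd b i)) = Fin.natAdd (a + b) i :=
  Fin.ext (Nat.add_assoc a b i).symm

theorem leftWires_natAdd (a : ℕ) (i : Fin a) : leftWires a (Fin.natAdd 0 i) = i :=
  Fin.ext (Nat.zero_add i)

theorem rightWires_castAdd (a : ℕ) (i : Fin a) : rightWires a (Fin.castAdd 0 i) = i := rfl

theorem blockSum_refl (a b : ℕ) :
    blockSum (Equiv.refl (Fin a)) (Equiv.refl (Fin b)) = Equiv.refl (Fin (a + b)) :=
  Wires.ext (by simp) (by simp)

theorem swapWires_swapWires (a b : ℕ) :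
    (swapWires a b).trans (swapWires b a) = Equiv.refl (Fin (a + b)) :=
  Wires.ext (by simp) (by simp)

theorem wires_pentagon (a b c d : ℕ) :
    (blockSum (assocWires a b c) (Equiv.refl (Fin d))).trans
      ((assocWires a (b + c) d).trans (blockSum (Equiv.refl (Fin a)) (assocWires b c d))) =
    (assocWires (a + b) c d).trans (assocWires a b (c + d)) := by
  refine Wires.ext (Fin.addCases (Fin.addCases ?_ ?_) ?_) ?_ <;> intro i <;>
    simp [assocWires_castAdd_castAdd, assocWires_castAdd_natAdd, assocWires_natAdd]

theorem wires_triangle (a b : ℕ) :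
    (assocWires a 0 b).trans (blockSum (Equiv.refl (Fin a)) (leftWires b)) =
      blockSum (rightWires a) (Equiv.refl (Fin b)) := by
  refine Wires.ext (fun i => ?_) (fun i => ?_)
  · change (blockSum (Equiv.refl (Fin a)) (leftWires b) (Fin.castAdd (0 + b) i) : ℕ) =
      (blockSum (rightWires a) (Equiv.refl (Fin b)) (Fin.castAdd b i) : ℕ)
    rw [blockSum_castAdd, blockSum_castAdd]
    rfl
  · rw [Equiv.trans_apply, assocWires_natAdd, blockSum_natAdd, blockSum_natAdd, leftWires_natAdd]
    rfl

theorem wires_hexagon_forward (a b c : ℕ) :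
    (assocWires a b c).trans ((swapWires a (b + c)).trans (assocWires b c a)) =
      (blockSum (swapWires a b) (Equiv.refl (Fin c))).trans
        ((assocWires b a c).trans (blockSum (Equiv.refl (Fin b)) (swapWires a c))) := by
  refine Wires.ext (Fin.addCases ?_ ?_) ?_ <;> intro i <;>
    simp [assocWires_castAdd_castAdd, assocWires_castAdd_natAdd, assocWires_natAdd]

theorem wires_hexagon_reverse (a b c : ℕ) :
    (assocWires a b c).symm.trans ((swapWires (a + b) c).trans (assocWires c a b).symm) =
      (blockSum (Equiv.refl (Fin a)) (swapWires b c)).trans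
        ((assocWires a c b).symm.trans (blockSum (swapWires a c) (Equiv.refl (Fin b)))) := by
  refine Wires.ext ?_ (Fin.addCases ?_ ?_) <;> intro i <;>
    simp [assocWires_symm_castAdd, assocWires_symm_natAdd_castAdd, assocWires_symm_natAdd_natAdd]

/-- A prop. -/
structure StrictProp where
  Hom : ℕ → ℕ → Type
  /-- Composition, in diagrammatic order. -/
  comp : ∀ {a b c : ℕ}, Hom a b → Hom b c → Hom a c
  tensor : ∀ {a b c d : ℕ}, Hom a b → Hom c d → Hom (a + c) (b + d)
  perm : ∀ {a b : ℕ}, (Fin a ≃ Fin b) → Hom a b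
  id_comp : ∀ {a b : ℕ} (f : Hom a b), comp (perm (Equiv.refl _)) f = f
  comp_id : ∀ {a b : ℕ} (f : Hom a b), comp f (perm (Equiv.refl _)) = f
  assoc : ∀ {a b c d : ℕ} (f : Hom a b) (g : Hom b c) (h : Hom c d),
    comp (comp f g) h = comp f (comp g h)
  perm_comp : ∀ {a b c : ℕ} (e : Fin a ≃ Fin b) (f : Fin b ≃ Fin c),
    comp (perm e) (perm f) = perm (e.trans f)
  tensor_perm : ∀ {a b c d : ℕ} (e : Fin a ≃ Fin b) (f : Fin c ≃ Fin d),
    tensor (perm e) (perm f) = perm (blockSum e f)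
  tensor_comp : ∀ {a b c a' b' c' : ℕ} (f : Hom a b) (g : Hom b c) (f' : Hom a' b')
    (g' : Hom b' c'), tensor (comp f g) (comp f' g') = comp (tensor f f') (tensor g g')
  assoc_nat : ∀ {a b c a' b' c' : ℕ} (f : Hom a a') (g : Hom b b') (h : Hom c c'),
    comp (tensor (tensor f g) h) (perm (assocWires a' b' c')) =
      comp (perm (assocWires a b c)) (tensor f (tensor g h))
  left_nat : ∀ {a b : ℕ} (f : Hom a b),
    comp (tensor (perm (Equiv.refl (Fin 0))) f) (perm (leftWires b)) = comp (perm (leftWires a)) f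
  right_nat : ∀ {a b : ℕ} (f : Hom a b),
    comp (tensor f (perm (Equiv.refl (Fin 0)))) (perm (rightWires b)) = comp (perm (rightWires a)) f
  swap_nat : ∀ {a b a' b' : ℕ} (f : Hom a a') (g : Hom b b'),
    comp (tensor f g) (perm (swapWires a' b')) = comp (perm (swapWires a b)) (tensor g f)

namespace StrictProp

/-- The objects of a prop: a number of wires. -/
structure Obj (P : StrictProp) : Type where
  wires : ℕ

variable (P : StrictProp)

instance : Category P.Obj where
  Hom a b := P.Hom a.wires b.wires
  id a := P.perm (Equiv.refl (Fin a.wires))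
  comp f g := P.comp f g
  id_comp := P.id_comp
  comp_id := P.comp_id
  assoc := P.assoc

/-- A bijection of wires as an isomorphism. -/
def permIso {a b : P.Obj} (e : Fin a.wires ≃ Fin b.wires) : a ≅ b where
  hom := P.perm e
  inv := P.perm e.symm
  hom_inv_id := (P.perm_comp _ _).trans (congrArg P.perm (Equiv.self_trans_symm e))
  inv_hom_id := (P.perm_comp _ _).trans (congrArg P.perm (Equiv.symm_trans_self e))

instance : MonoidalCategoryStruct P.Obj where
  tensorObj a b := ⟨a.wires + b.wires⟩
  whiskerLeft a _ _ f := P.tensor (P.perm (Equiv.refl (Fin a.wires))) f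
  whiskerRight f b := P.tensor f (P.perm (Equiv.refl (Fin b.wires)))
  tensorHom f g := P.tensor f g
  tensorUnit := ⟨0⟩
  associator a b c := P.permIso (assocWires a.wires b.wires c.wires)
  leftUnitor a := P.permIso (leftWires a.wires)
  rightUnitor a := P.permIso (rightWires a.wires)

theorem tensor_split {a b a' b' : ℕ} (f : P.Hom a b) (g : P.Hom a' b') :
    P.tensor f g = P.comp (P.tensor f (P.perm (Equiv.refl (Fin a'))))
      (P.tensor (P.perm (Equiv.refl (Fin b))) g) := by
  rw [← P.tensor_comp, P.comp_id, P.id_comp]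

theorem tensor_id (a b : ℕ) :
    P.tensor (P.perm (Equiv.refl (Fin a))) (P.perm (Equiv.refl (Fin b))) =
      P.perm (Equiv.refl (Fin (a + b))) := by
  rw [P.tensor_perm, blockSum_refl]

theorem perm_pentagon (a b c d : ℕ) :
    P.comp (P.tensor (P.perm (assocWires a b c)) (P.perm (Equiv.refl (Fin d))))
      (P.comp (P.perm (assocWires a (b + c) d))
        (P.tensor (P.perm (Equiv.refl (Fin a))) (P.perm (assocWires b c d)))) =
    P.comp (P.perm (assocWires (a + b) c d)) (P.perm (assocWires a b (c + d))) := by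
  simp only [P.tensor_perm, P.perm_comp, wires_pentagon]

theorem perm_triangle (a b : ℕ) :
    P.comp (P.perm (assocWires a 0 b)) (P.tensor (P.perm (Equiv.refl (Fin a)))
      (P.perm (leftWires b))) = P.tensor (P.perm (rightWires a)) (P.perm (Equiv.refl (Fin b))) := by
  simp only [P.tensor_perm, P.perm_comp, wires_triangle]

theorem perm_hexagon_forward (a b c : ℕ) :
    P.comp (P.perm (assocWires a b c)) (P.comp (P.perm (swapWires a (b + c)))
      (P.perm (assocWires b c a))) =
    P.comp (P.tensor (P.perm (swapWires a b)) (P.perm (Equiv.refl (Fin c))))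
      (P.comp (P.perm (assocWires b a c))
        (P.tensor (P.perm (Equiv.refl (Fin b))) (P.perm (swapWires a c)))) := by
  simp only [P.tensor_perm, P.perm_comp, wires_hexagon_forward]

theorem perm_hexagon_reverse (a b c : ℕ) :
    P.comp (P.perm (assocWires a b c).symm) (P.comp (P.perm (swapWires (a + b) c))
      (P.perm (assocWires c a b).symm)) =
    P.comp (P.tensor (P.perm (Equiv.refl (Fin a))) (P.perm (swapWires b c)))
      (P.comp (P.perm (assocWires a c b).symm)
        (P.tensor (P.perm (swapWires a c)) (P.perm (Equiv.refl (Fin b))))) := by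
  simp only [P.tensor_perm, P.perm_comp, wires_hexagon_reverse]

instance : MonoidalCategory P.Obj where
  tensorHom_def f g := P.tensor_split f g
  id_tensorHom_id a b := P.tensor_id a.wires b.wires
  tensorHom_comp_tensorHom f g h k := (P.tensor_comp f h g k).symm
  whiskerLeft_id a b := P.tensor_id a.wires b.wires
  id_whiskerRight a b := P.tensor_id a.wires b.wires
  associator_naturality f g h := P.assoc_nat f g h
  leftUnitor_naturality f := P.left_nat f
  rightUnitor_naturality f := P.right_nat f
  pentagon a b c d := P.perm_pentagon a.wires b.wires c.wires d.wires
  triangle a b := P.perm_triangle a.wires b.wires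

instance : SymmetricCategory P.Obj where
  braiding a b := P.permIso (swapWires a.wires b.wires)
  braiding_naturality_right a _ _ f := P.swap_nat (P.perm (Equiv.refl (Fin a.wires))) f
  braiding_naturality_left f a := P.swap_nat f (P.perm (Equiv.refl (Fin a.wires)))
  hexagon_forward a b c := P.perm_hexagon_forward a.wires b.wires c.wires
  hexagon_reverse a b c := P.perm_hexagon_reverse a.wires b.wires c.wires
  symmetry a b := (P.perm_comp _ _).trans (congrArg P.perm (swapWires_swapWires a.wires b.wires))

/-- The morphisms of the symmetric monoidal subcategory (on all objects) generated by `S`. -/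
inductive Generated (S : ∀ a b : ℕ, P.Hom a b → Prop) : ∀ {a b : ℕ}, P.Hom a b → Prop
  | of {a b : ℕ} {f : P.Hom a b} (h : S a b f) : Generated S f
  | perm {a b : ℕ} (e : Fin a ≃ Fin b) : Generated S (P.perm e)
  | comp {a b c : ℕ} {f : P.Hom a b} {g : P.Hom b c} (hf : Generated S f) (hg : Generated S g) :
      Generated S (P.comp f g)
  | tensor {a b c d : ℕ} {f : P.Hom a b} {g : P.Hom c d} (hf : Generated S f)
      (hg : Generated S g) : Generated S (P.tensor f g)

/-- The sub-prop generated by `S`. -/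
def sub (S : ∀ a b : ℕ, P.Hom a b → Prop) : StrictProp where
  Hom a b := {f : P.Hom a b // P.Generated S f}
  comp f g := ⟨P.comp f.1 g.1, f.2.comp g.2⟩
  tensor f g := ⟨P.tensor f.1 g.1, f.2.tensor g.2⟩
  perm e := ⟨P.perm e, .perm e⟩
  id_comp f := Subtype.ext (P.id_comp f.1)
  comp_id f := Subtype.ext (P.comp_id f.1)
  assoc f g h := Subtype.ext (P.assoc f.1 g.1 h.1)
  perm_comp e f := Subtype.ext (P.perm_comp e f)
  tensor_perm e f := Subtype.ext (P.tensor_perm e f)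
  tensor_comp f g h k := Subtype.ext (P.tensor_comp f.1 g.1 h.1 k.1)
  assoc_nat f g h := Subtype.ext (P.assoc_nat f.1 g.1 h.1)
  left_nat f := Subtype.ext (P.left_nat f.1)
  right_nat f := Subtype.ext (P.right_nat f.1)
  swap_nat f g := Subtype.ext (P.swap_nat f.1 g.1)

/-- The quotient of a prop by a congruence. -/
def quot (r : ∀ a b : ℕ, Setoid (P.Hom a b))
    (hc : ∀ {a b c : ℕ} {f f' : P.Hom a b} {g g' : P.Hom b c},
      (r a b) f f' → (r b c) g g' → (r a c) (P.comp f g) (P.comp f' g'))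
    (ht : ∀ {a b c d : ℕ} {f f' : P.Hom a b} {g g' : P.Hom c d},
      (r a b) f f' → (r c d) g g' → (r (a + c) (b + d)) (P.tensor f g) (P.tensor f' g')) :
    StrictProp where
  Hom a b := Quotient (r a b)
  comp := Quotient.map₂ P.comp fun _ _ h _ _ k => hc h k
  tensor := Quotient.map₂ P.tensor fun _ _ h _ _ k => ht h k
  perm e := Quotient.mk _ (P.perm e)
  id_comp := by rintro a b ⟨f⟩; exact congrArg (Quotient.mk _) (P.id_comp f)
  comp_id := by rintro a b ⟨f⟩; exact congrArg (Quotient.mk _) (P.comp_id f)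
  assoc := by rintro a b c d ⟨f⟩ ⟨g⟩ ⟨h⟩; exact congrArg (Quotient.mk _) (P.assoc f g h)
  perm_comp e f := congrArg (Quotient.mk _) (P.perm_comp e f)
  tensor_perm e f := congrArg (Quotient.mk _) (P.tensor_perm e f)
  tensor_comp := by
    rintro a b c a' b' c' ⟨f⟩ ⟨g⟩ ⟨h⟩ ⟨k⟩; exact congrArg (Quotient.mk _) (P.tensor_comp f g h k)
  assoc_nat := by
    rintro a b c a' b' c' ⟨f⟩ ⟨g⟩ ⟨h⟩; exact congrArg (Quotient.mk _) (P.assoc_nat f g h)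
  left_nat := by rintro a b ⟨f⟩; exact congrArg (Quotient.mk _) (P.left_nat f)
  right_nat := by rintro a b ⟨f⟩; exact congrArg (Quotient.mk _) (P.right_nat f)
  swap_nat := by rintro a b a' b' ⟨f⟩ ⟨g⟩; exact congrArg (Quotient.mk _) (P.swap_nat f g)

end StrictProp

/-! ### Affine Lagrangian relations -/

/-- The symplectic vector space `K ^ n ⊕ K ^ n`; the first component is the `X`-grading, the second
one is the `Z`-grading. -/
abbrev Phase (K : Type) (n : ℕ) : Type := (Fin n → K) × (Fin n → K)

namespace Phase

variable {K : Type}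

/-- The vector whose block of wire `i` is the block of wire `e i` of `v`. -/
def pull {m n : ℕ} (e : Fin m → Fin n) (v : Phase K n) : Phase K m := (v.1 ∘ e, v.2 ∘ e)

theorem pull_id {n : ℕ} (v : Phase K n) : v.pull id = v := rfl

theorem pull_pull {l m n : ℕ} (e : Fin m → Fin n) (f : Fin l → Fin m) (v : Phase K n) :
    (v.pull e).pull f = v.pull (e ∘ f) := rfl

theorem eq_pull_iff {m n : ℕ} (e : Fin m ≃ Fin n) (v : Phase K m) (w : Phase K n) :
    v = w.pull e ↔ v.pull e.symm = w := by
  constructor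
  · rintro rfl
    rw [pull_pull, Equiv.self_comp_symm, pull_id]
  · rintro rfl
    rw [pull_pull, Equiv.symm_comp_self, pull_id]

/-- Juxtaposition of vectors, in both gradings. -/
def append {m n : ℕ} (v : Phase K m) (w : Phase K n) : Phase K (m + n) :=
  (Fin.append v.1 w.1, Fin.append v.2 w.2)

@[simp] theorem append_pull_castAdd {m n : ℕ} (v : Phase K m) (w : Phase K n) :
    (v.append w).pull (Fin.castAdd n) = v := by
  ext i <;> simp [append, pull]

@[simp] theorem append_pull_natAdd {m n : ℕ} (v : Phase K m) (w : Phase K n) :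
    (v.append w).pull (Fin.natAdd m) = w := by
  ext i <;> simp [append, pull]

theorem ext_fin_zero (v w : Phase K 0) : v = w :=
  Prod.ext (Subsingleton.elim _ _) (Subsingleton.elim _ _)

theorem ext_pull {m n : ℕ} {v w : Phase K (m + n)}
    (hl : v.pull (Fin.castAdd n) = w.pull (Fin.castAdd n))
    (hr : v.pull (Fin.natAdd m) = w.pull (Fin.natAdd m)) : v = w := by
  have h1 := fun i => congrFun (congrArg Prod.fst hl) i
  have h2 := fun i => congrFun (congrArg Prod.fst hr) i
  have h3 := fun i => congrFun (congrArg Prod.snd hl) i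
  have h4 := fun i => congrFun (congrArg Prod.snd hr) i
  exact Prod.ext (funext fun i => Fin.addCases h1 h2 i) (funext fun i => Fin.addCases h3 h4 i)

/-- The symplectic form with matrix `[[0, 1], [-1, 0]]`. -/
def form [Field K] {n : ℕ} (v w : Phase K n) : K := v.1 ⬝ᵥ w.2 - v.2 ⬝ᵥ w.1

end Phase

theorem blockSum_comp_castAdd {a b c d : ℕ} (e : Fin a ≃ Fin b) (f : Fin c ≃ Fin d) :
    blockSum e f ∘ Fin.castAdd c = Fin.castAdd d ∘ e := funext (blockSum_castAdd e f)

theorem blockSum_comp_natAdd {a b c d : ℕ} (e : Fin a ≃ Fin b) (f : Fin c ≃ Fin d) :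
    blockSum e f ∘ Fin.natAdd a = Fin.natAdd b ∘ f := funext (blockSum_natAdd e f)

theorem swapWires_comp_castAdd (a b : ℕ) : swapWires a b ∘ Fin.castAdd b = Fin.natAdd b :=
  funext (swapWires_castAdd a b)

theorem swapWires_comp_natAdd (a b : ℕ) : swapWires a b ∘ Fin.natAdd a = Fin.castAdd a :=
  funext (swapWires_natAdd a b)

theorem swapWires_symm_comp_castAdd (a b : ℕ) :
    (swapWires a b).symm ∘ Fin.castAdd a = Fin.natAdd a :=
  funext fun i => (Equiv.symm_apply_eq _).2 (swapWires_natAdd a b i).symm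

theorem swapWires_symm_comp_natAdd (a b : ℕ) :
    (swapWires a b).symm ∘ Fin.natAdd b = Fin.castAdd b :=
  funext fun i => (Equiv.symm_apply_eq _).2 (swapWires_castAdd a b i).symm

theorem assocWires_comp_natAdd (a b c : ℕ) :
    assocWires a b c ∘ Fin.natAdd (a + b) = Fin.natAdd a ∘ Fin.natAdd b :=
  funext (assocWires_natAdd a b c)

theorem assocWires_symm_comp_natAdd (a b c : ℕ) :
    ((assocWires a b c).symm ∘ Fin.natAdd a) ∘ Fin.natAdd b = Fin.natAdd (a + b) :=
  funext (assocWires_symm_natAdd_natAdd a b c)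

theorem leftWires_comp_natAdd (a : ℕ) : leftWires a ∘ Fin.natAdd 0 = id :=
  funext (leftWires_natAdd a)

theorem leftWires_symm (a : ℕ) : ((leftWires a).symm : Fin a → Fin (0 + a)) = Fin.natAdd 0 :=
  funext fun i => (Equiv.symm_apply_eq _).2 (leftWires_natAdd a i).symm

/-- The prop of all relations between the spaces `K ^ n ⊕ K ^ n`, with relational composition and
with the direct sum, taken in both gradings, as tensor product. -/
def phaseRel (K : Type) : StrictProp where
  Hom n m := Set (Phase K n × Phase K m)
  comp R S := {vw | ∃ u, (vw.1, u) ∈ R ∧ (u, vw.2) ∈ S}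
  tensor {a b c d} R S :=
    {vw | (vw.1.pull (Fin.castAdd c), vw.2.pull (Fin.castAdd d)) ∈ R ∧
      (vw.1.pull (Fin.natAdd a), vw.2.pull (Fin.natAdd b)) ∈ S}
  perm e := {vw | vw.1 = vw.2.pull e}
  id_comp R := Set.ext fun vw => ⟨fun ⟨u, h, k⟩ => by
    obtain rfl : vw.1 = u := h
    exact k, fun h => ⟨vw.1, rfl, h⟩⟩
  comp_id R := Set.ext fun vw => ⟨fun ⟨u, h, k⟩ => by
    obtain rfl : u = vw.2 := k
    exact h, fun h => ⟨vw.2, h, rfl⟩⟩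
  assoc R S T := Set.ext fun vw =>
    ⟨fun ⟨u, ⟨t, h, k⟩, l⟩ => ⟨t, h, u, k, l⟩, fun ⟨t, h, u, k, l⟩ => ⟨u, ⟨t, h, k⟩, l⟩⟩
  perm_comp e f := Set.ext fun vw => ⟨fun ⟨u, h, k⟩ => by
    obtain rfl : u = vw.2.pull f := k
    exact h, fun h => ⟨vw.2.pull f, h, rfl⟩⟩
  tensor_perm {a b c d} e f := Set.ext fun ⟨v, w⟩ => by
    change (v.pull _ = (w.pull _).pull e ∧ v.pull _ = (w.pull _).pull f) ↔ v = w.pull (blockSum e f)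
    rw [Phase.pull_pull, Phase.pull_pull, ← blockSum_comp_castAdd, ← blockSum_comp_natAdd]
    exact ⟨fun h => Phase.ext_pull h.1 h.2, fun h => by subst h; exact ⟨rfl, rfl⟩⟩
  tensor_comp R S R' S' := Set.ext fun ⟨v, w⟩ => by
    constructor
    · rintro ⟨⟨u, h, k⟩, ⟨u', h', k'⟩⟩
      refine ⟨u.append u', ?_, ?_⟩
      · simpa using And.intro h h'
      · simpa using And.intro k k'
    · rintro ⟨u, ⟨h, h'⟩, ⟨k, k'⟩⟩
      exact ⟨⟨_, h, k⟩, ⟨_, h', k'⟩⟩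
  assoc_nat {a b c a' b' c'} R S T := Set.ext fun ⟨v, w⟩ => by
    constructor
    · rintro ⟨u, ⟨⟨h1, h2⟩, h3⟩, k⟩
      obtain rfl : u = w.pull (assocWires a' b' c') := k
      refine ⟨v.pull (assocWires a b c).symm, ?_, h1, h2, ?_⟩
      · exact (Phase.eq_pull_iff _ _ _).2 rfl
      · simp only [Phase.pull_pull, assocWires_comp_natAdd, assocWires_symm_comp_natAdd] at h3 ⊢
        exact h3
    · rintro ⟨u, k, h1, h2, h3⟩
      obtain rfl : v = u.pull (assocWires a b c) := k
      refine ⟨w.pull (assocWires a' b' c'), ⟨⟨h1, h2⟩, ?_⟩, rfl⟩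
      simp only [Phase.pull_pull, assocWires_comp_natAdd] at h3 ⊢
      exact h3
  left_nat {a b} R := Set.ext fun ⟨v, w⟩ => by
    constructor
    · rintro ⟨u, ⟨_, h⟩, k⟩
      obtain rfl : u = w.pull (leftWires b) := k
      refine ⟨v.pull (leftWires a).symm, (Phase.eq_pull_iff _ _ _).2 rfl, ?_⟩
      simp only [Phase.pull_pull, leftWires_comp_natAdd, leftWires_symm] at h ⊢
      exact h
    · rintro ⟨u, k, h⟩
      obtain rfl : v = u.pull (leftWires a) := k
      refine ⟨w.pull (leftWires b), ⟨Phase.ext_fin_zero _ _, ?_⟩, rfl⟩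
      simp only [Phase.pull_pull, leftWires_comp_natAdd] at h ⊢
      exact h
  right_nat {a b} R := Set.ext fun ⟨v, w⟩ => by
    constructor
    · rintro ⟨u, ⟨h, _⟩, k⟩
      obtain rfl : u = w.pull (rightWires b) := k
      exact ⟨v, rfl, h⟩
    · rintro ⟨u, k, h⟩
      obtain rfl : v = u.pull (rightWires a) := k
      exact ⟨w.pull (rightWires b), ⟨h, Phase.ext_fin_zero _ _⟩, rfl⟩
  swap_nat {a b a' b'} R S := Set.ext fun ⟨v, w⟩ => by
    constructor
    · rintro ⟨u, ⟨h, h'⟩, k⟩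
      obtain rfl : u = w.pull (swapWires a' b') := k
      refine ⟨v.pull (swapWires a b).symm, (Phase.eq_pull_iff _ _ _).2 rfl, ?_, ?_⟩ <;>
      simp only [Phase.pull_pull, swapWires_comp_castAdd, swapWires_comp_natAdd,
        swapWires_symm_comp_castAdd, swapWires_symm_comp_natAdd] at h h' ⊢ <;> assumption
    · rintro ⟨u, k, h, h'⟩
      obtain rfl : v = u.pull (swapWires a b) := k
      refine ⟨w.pull (swapWires a' b'), ⟨?_, ?_⟩, rfl⟩ <;>
      simp only [Phase.pull_pull, swapWires_comp_castAdd, swapWires_comp_natAdd] at h h' ⊢ <;>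
      assumption

/-- A subspace of `(K ^ n ⊕ K ^ n) ⊕ (K ^ m ⊕ K ^ m)` is a Lagrangian relation when it equals its
symplectic dual with respect to the form `ω_m - ω_n`.  (The sign on the source makes the graphs of
symplectomorphisms Lagrangian, and makes a relation Lagrangian exactly when its curried form is a
Lagrangian subspace for the standard form.) -/
def IsLagrangian {K : Type} [Field K] {n m : ℕ} (W : Submodule K (Phase K n × Phase K m)) : Prop :=
  ∀ v, v ∈ W ↔ ∀ w ∈ W, Phase.form v.2 w.2 - Phase.form v.1 w.1 = 0

/-- The Lagrangian relations and the affine shifts. -/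
inductive AffLagGen (K : Type) [Field K] : ∀ n m : ℕ, (phaseRel K).Hom n m → Prop
  | linear {n m : ℕ} (W : Submodule K (Phase K n × Phase K m)) (hW : IsLagrangian W) :
      AffLagGen K n m (W : Set (Phase K n × Phase K m))
  | shift {n : ℕ} (u : Phase K n) :
      AffLagGen K n n ({vw | vw.2 = vw.1 + u} : Set (Phase K n × Phase K n))

/-- The prop of affine Lagrangian relations over `K`; for `K = ZMod p` with `p` prime this is
Spekkens' qudit toy model of dimension `p`. -/
def affLagRel (K : Type) [Field K] : StrictProp := (phaseRel K).sub (AffLagGen K)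

/-- The category of affine Lagrangian relations; the object `n` stands for `K ^ n ⊕ K ^ n`. -/
abbrev AffLagRel (K : Type) [Field K] : Type := (affLagRel K).Obj

section Cup

variable (K : Type) [Field K]

/-- The cup of the compact closed structure: `(x, -x)` in the `X`-grading and `(z, z)` in the
`Z`-grading. -/
def cupSpace (n : ℕ) : Submodule K (Phase K 0 × Phase K (n + n)) where
  carrier := {vw | ∀ i : Fin n, vw.2.1 (Fin.castAdd n i) = -vw.2.1 (Fin.natAdd n i) ∧
    vw.2.2 (Fin.castAdd n i) = vw.2.2 (Fin.natAdd n i)}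
  add_mem' {v w} hv hw i := by
    constructor
    · simp only [Prod.fst_add, Prod.snd_add, Pi.add_apply, (hv i).1, (hw i).1]; ring
    · simp only [Prod.snd_add, Pi.add_apply, (hv i).2, (hw i).2]
  zero_mem' i := by simp
  smul_mem' c v hv i := by
    constructor
    · simp [(hv i).1]
    · simp [(hv i).2]

theorem isLagrangian_cupSpace (n : ℕ) : IsLagrangian (cupSpace K n) := by
  intro v
  have h0 : ∀ a b : Phase K 0, Phase.form a b = 0 := fun a b => by simp [Phase.form]
  have hf : ∀ a b : Phase K (n + n), Phase.form a b =
      ∑ i : Fin n, (a.1 (Fin.castAdd n i) * b.2 (Fin.castAdd n i) +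
        a.1 (Fin.natAdd n i) * b.2 (Fin.natAdd n i) - a.2 (Fin.castAdd n i) * b.1 (Fin.castAdd n i) -
        a.2 (Fin.natAdd n i) * b.1 (Fin.natAdd n i)) := fun a b => by
    simp only [Phase.form, dotProduct, Fin.sum_univ_add, Finset.sum_add_distrib,
      Finset.sum_sub_distrib]
    ring
  simp only [h0, sub_zero, hf]
  constructor
  · intro hv w hw
    refine Finset.sum_eq_zero fun i _ => ?_
    rw [(hv i).1, (hv i).2, (hw i).1, (hw i).2]
    ring
  · intro h i
    constructor
    · have := h (0, (0, Fin.append (Pi.single i 1) (Pi.single i 1))) fun j => by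
        simp [-Fin.natAdd_eq_addNat]
      simp [-Fin.natAdd_eq_addNat, Finset.sum_add_distrib, Pi.single_apply] at this
      exact eq_neg_of_add_eq_zero_left this
    · have := h (0, (Fin.append (-Pi.single i 1) (Pi.single i 1), 0)) fun j => by
        simp [-Fin.natAdd_eq_addNat]
      simp [-Fin.natAdd_eq_addNat, Finset.sum_sub_distrib, Pi.single_apply] at this
      exact sub_eq_zero.1 this

/-- The cup as an affine Lagrangian relation. -/
def cup (n : AffLagRel K) : 𝟙_ (AffLagRel K) ⟶ n ⊗ n :=
  ⟨(cupSpace K n.wires : Set (Phase K 0 × Phase K (n.wires + n.wires))),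
    .of (.linear (cupSpace K n.wires) (isLagrangian_cupSpace K n.wires))⟩

variable {K}

/-- Currying an affine Lagrangian relation into a state: the input wires are bent around. -/
def curry {n m : AffLagRel K} (f : n ⟶ m) : 𝟙_ (AffLagRel K) ⟶ n ⊗ m := cup K n ≫ (n ◁ f)

end Cup

/-! ### Matrices -/

section Matrices

variable {p : ℕ}

/-- Matrices from `n` wires to `m` wires of dimension `p`; the standard basis of `ℂ ^ (p ^ n)` is
indexed by the strings of `n` digits modulo `p`. -/
abbrev QMat (p n m : ℕ) : Type := Matrix (Fin m → ZMod p) (Fin n → ZMod p) ℂ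

/-- The matrix which permutes the tensor factors. -/
def matPerm {a b : ℕ} (e : Fin a ≃ Fin b) : QMat p a b :=
  Matrix.of fun y x => if x = y ∘ e then 1 else 0

theorem matPerm_refl (a : ℕ) : (matPerm (Equiv.refl (Fin a)) : QMat p a a) = 1 := by
  ext y x
  simp [matPerm, Matrix.one_apply, eq_comm]

variable [NeZero p]

/-- Composition in diagrammatic order, that is, the matrix product `N * M`. -/
def matComp {a b c : ℕ} (M : QMat p a b) (N : QMat p b c) : QMat p a c := N * M

/-- The Kronecker product. -/
def matTensor {a b c d : ℕ} (M : QMat p a b) (N : QMat p c d) : QMat p (a + c) (b + d) :=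
  Matrix.of fun y x => M (y ∘ Fin.castAdd d) (x ∘ Fin.castAdd c) *
    N (y ∘ Fin.natAdd b) (x ∘ Fin.natAdd a)

theorem matComp_smul {a b c : ℕ} (r s : ℂ) (M : QMat p a b) (N : QMat p b c) :
    matComp (r • M) (s • N) = (s * r) • matComp M N := by
  rw [matComp, Matrix.smul_mul, Matrix.mul_smul, smul_smul, matComp]

theorem matPerm_mul {a b c : ℕ} (e : Fin b ≃ Fin c) (M : QMat p a b) (y : Fin c → ZMod p)
    (x : Fin a → ZMod p) : (matComp M (matPerm e)) y x = M (y ∘ e) x := by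
  simp [matComp, Matrix.mul_apply, matPerm]

theorem mul_matPerm {a b c : ℕ} (e : Fin a ≃ Fin b) (M : QMat p b c) (y : Fin c → ZMod p)
    (x : Fin a → ZMod p) : (matComp (matPerm e) M) y x = M y (x ∘ e.symm) := by
  have h : ∀ j : Fin b → ZMod p, x = j ∘ e ↔ x ∘ e.symm = j := fun j =>
    ⟨fun h => by rw [h, Function.comp_assoc, Equiv.self_comp_symm, Function.comp_id],
      fun h => by rw [← h, Function.comp_assoc, Equiv.symm_comp_self, Function.comp_id]⟩
  simp [matComp, Matrix.mul_apply, matPerm, h]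

theorem matTensor_mul {a b c a' b' c' : ℕ} (M : QMat p a b) (N : QMat p b c) (M' : QMat p a' b')
    (N' : QMat p b' c') :
    matTensor (matComp M N) (matComp M' N') =
      matComp (matTensor M M') (matTensor N N') := by
  ext y x
  simp only [matComp, matTensor, Matrix.of_apply, Matrix.mul_apply]
  rw [← (Fin.appendEquiv b b').sum_comp, Fintype.sum_prod_type, Finset.sum_mul_sum]
  refine Finset.sum_congr rfl fun u _ => Finset.sum_congr rfl fun u' _ => ?_
  have h1 : Fin.append u u' ∘ Fin.castAdd b' = u := funext fun i => by simp
  have h2 : Fin.append u u' ∘ Fin.natAdd b = u' := funext fun i => by simp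
  simp only [Fin.appendEquiv, Equiv.coe_fn_mk, h1, h2]
  ring

end Matrices

/-- The prop of complex matrices between the spaces `ℂ ^ (p ^ n)`. -/
def matProp (p : ℕ) [NeZero p] : StrictProp where
  Hom n m := QMat p n m
  comp M N := matComp M N
  tensor M N := matTensor M N
  perm e := matPerm e
  id_comp M := by rw [matPerm_refl]; exact Matrix.mul_one M
  comp_id M := by rw [matPerm_refl]; exact Matrix.one_mul M
  assoc M N O := (Matrix.mul_assoc O N M).symm
  perm_comp e f := by
    ext y x
    rw [matPerm_mul]
    rfl
  tensor_perm {a b c d} e f := by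
    ext y x
    have h : x = y ∘ blockSum e f ↔ x ∘ Fin.castAdd c = (y ∘ Fin.castAdd d) ∘ e ∧
        x ∘ Fin.natAdd a = (y ∘ Fin.natAdd b) ∘ f := by
      rw [Function.comp_assoc, Function.comp_assoc, ← blockSum_comp_castAdd,
        ← blockSum_comp_natAdd]
      exact ⟨fun h => by subst h; exact ⟨rfl, rfl⟩,
        fun h => funext fun i => Fin.addCases (congrFun h.1) (congrFun h.2) i⟩
    simp only [matTensor, matPerm, Matrix.of_apply, h, ite_and, mul_ite, mul_one, mul_zero]
    split_ifs <;> rfl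
  tensor_comp M N M' N' := matTensor_mul M N M' N'
  assoc_nat {a b c a' b' c'} M N O := by
    ext y x
    rw [matPerm_mul, mul_matPerm]
    have h : (y ∘ assocWires a' b' c') ∘ Fin.natAdd (a' + b') =
        (y ∘ Fin.natAdd a') ∘ Fin.natAdd b' := by
      rw [Function.comp_assoc, assocWires_comp_natAdd, Function.comp_assoc]
    have k : ((x ∘ (assocWires a b c).symm) ∘ Fin.natAdd a) ∘ Fin.natAdd b =
        x ∘ Fin.natAdd (a + b) := by
      rw [← assocWires_symm_comp_natAdd]
      rfl
    simp only [matTensor, Matrix.of_apply, h, k]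
    exact mul_assoc _ _ _
  left_nat {a b} M := by
    ext y x
    rw [matPerm_mul, mul_matPerm, matPerm_refl, leftWires_symm]
    simp only [matTensor, Matrix.of_apply, Function.comp_assoc, leftWires_comp_natAdd,
      Function.comp_id, Matrix.one_apply]
    rw [if_pos (Subsingleton.elim _ _), one_mul]
  right_nat {a b} M := by
    ext y x
    rw [matPerm_mul, mul_matPerm, matPerm_refl]
    simp only [matTensor, Matrix.of_apply, Matrix.one_apply]
    rw [if_pos (Subsingleton.elim _ _), mul_one]
    rfl
  swap_nat {a b a' b'} M N := by
    ext y x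
    rw [matPerm_mul, mul_matPerm]
    simp only [matTensor, Matrix.of_apply, Function.comp_assoc, swapWires_comp_castAdd,
      swapWires_comp_natAdd, swapWires_symm_comp_castAdd, swapWires_symm_comp_natAdd]
    exact mul_comm _ _

/-- Equality up to an invertible scalar. -/
def scalarSetoid (p n m : ℕ) : Setoid (QMat p n m) where
  r M N := ∃ c : ℂ, c ≠ 0 ∧ N = c • M
  iseqv :=
    { refl := fun M => ⟨1, one_ne_zero, (one_smul ℂ M).symm⟩
      symm := by
        rintro M N ⟨c, hc, rfl⟩
        exact ⟨c⁻¹, inv_ne_zero hc, by rw [smul_smul, inv_mul_cancel₀ hc, one_smul]⟩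
      trans := by
        rintro M N O ⟨c, hc, rfl⟩ ⟨d, hd, rfl⟩
        exact ⟨d * c, mul_ne_zero hd hc, by rw [smul_smul]⟩ }

/-- The prop of complex matrices between the spaces `ℂ ^ (p ^ n)`, modulo invertible scalars. -/
def projMat (p : ℕ) [NeZero p] : StrictProp :=
  (matProp p).quot (scalarSetoid p)
    (by
      rintro a b c M _ N _ ⟨r, hr, rfl⟩ ⟨s, hs, rfl⟩
      exact ⟨s * r, mul_ne_zero hs hr, matComp_smul r s M N⟩)
    (by
      rintro a b c d M _ N _ ⟨r, hr, rfl⟩ ⟨s, hs, rfl⟩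
      refine ⟨r * s, mul_ne_zero hr hs, ?_⟩
      ext y x
      exact mul_mul_mul_comm _ _ _ _)

/-- The class of a matrix modulo invertible scalars. -/
def toProj {p : ℕ} [NeZero p] {n m : ℕ} (M : QMat p n m) : (projMat p).Hom n m :=
  Quotient.mk (scalarSetoid p n m) M

/-! ### Stabilizer circuits -/

section Stabilizer

variable (p : ℕ) [NeZero p]

/-- The boost operator `∑ a, |a + 1⟩⟨a|`. -/
def boostOp : Matrix (ZMod p) (ZMod p) ℂ := Matrix.of fun b a => if b = a + 1 then 1 else 0

/-- The shift operator `∑ a, e ^ (2 π i a / p) |a⟩⟨a|`. -/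
noncomputable def shiftOp : Matrix (ZMod p) (ZMod p) ℂ :=
  Matrix.diagonal fun a => Complex.exp (2 * Real.pi * Complex.I * (a.val : ℂ) / (p : ℂ))

/-- The Fourier transform `p ^ (-1 / 2) ∑ a b, e ^ (2 π i a b / p) |b⟩⟨a|`. -/
noncomputable def fourierOp : Matrix (ZMod p) (ZMod p) ℂ :=
  Matrix.of fun b a => (1 / (Real.sqrt (p : ℝ) : ℂ)) *
    Complex.exp (2 * Real.pi * Complex.I * ((a.val : ℂ) * (b.val : ℂ)) / (p : ℂ))

/-- The phase-shift operator `∑ a, e ^ (π i a (a + p) / p) |a⟩⟨a|`. -/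
noncomputable def phaseOp : Matrix (ZMod p) (ZMod p) ℂ :=
  Matrix.diagonal fun a =>
    Complex.exp (Real.pi * Complex.I * ((a.val : ℂ) * ((a.val : ℂ) + (p : ℂ))) / (p : ℂ))

/-- The controlled-boost operator `∑ a b, |a, a + b⟩⟨a, b|`. -/
def controlledBoostOp : Matrix (ZMod p × ZMod p) (ZMod p × ZMod p) ℂ :=
  Matrix.of fun d c => if d = (c.1, c.1 + c.2) then 1 else 0

variable {p}

/-- The operator `U` applied to wire `i`. -/
def onWire {n : ℕ} (i : Fin n) (U : Matrix (ZMod p) (ZMod p) ℂ) : QMat p n n :=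
  Matrix.of fun y x => if ∀ k, k ≠ i → y k = x k then U (y i) (x i) else 0

/-- The operator `U` applied to the wires `i` and `j`. -/
def onWires {n : ℕ} (i j : Fin n) (U : Matrix (ZMod p × ZMod p) (ZMod p × ZMod p) ℂ) :
    QMat p n n :=
  Matrix.of fun y x => if ∀ k, k ≠ i → k ≠ j → y k = x k then U (y i, y j) (x i, x j) else 0

variable (p) in
/-- The Pauli group on `n` qudits.  (The generators have finite order, so that the monoid which they
generate is a group.) -/
noncomputable def pauliGroup (n : ℕ) : Submonoid (QMat p n n) :=
  Submonoid.closure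
    ({Complex.exp (Real.pi * Complex.I / (p : ℂ)) • (1 : QMat p n n)} ∪
      (Set.range fun i => onWire i (boostOp p)) ∪ Set.range fun i => onWire i (shiftOp p))

/-- A Clifford operator is a unitary which normalizes the Pauli group. -/
def IsClifford {n : ℕ} (U : QMat p n n) : Prop :=
  U ∈ Matrix.unitaryGroup (Fin n → ZMod p) ℂ ∧
    (fun P : QMat p n n => U * P * U.conjTranspose) '' (pauliGroup p n) = pauliGroup p n

variable (p) in
/-- The state `|0⟩ ^ ⊗ n`. -/
def ketZero (n : ℕ) : QMat p 0 n := Matrix.of fun y _ => if y = 0 then 1 else 0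

variable (p) in
/-- The effect `⟨0| ^ ⊗ n`. -/
def braZero (n : ℕ) : QMat p n 0 := Matrix.of fun _ x => if x = 0 then 1 else 0

variable (p) in
/-- The Clifford operators, the vector `|0⟩` and the covector `⟨0|`, modulo invertible scalars. -/
inductive StabGen : ∀ n m : ℕ, (projMat p).Hom n m → Prop
  | clifford {n : ℕ} (U : QMat p n n) (hU : IsClifford U) : StabGen n n (toProj U)
  | ket : StabGen 0 1 (toProj (ketZero p 1))
  | bra : StabGen 1 0 (toProj (braZero p 1))

variable (p) in
/-- The prop of `p`-dimensional qudit stabilizer circuits modulo invertible scalars. -/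
def stab : StrictProp := (projMat p).sub (StabGen p)

variable (p) in
/-- The category of `p`-dimensional qudit stabilizer circuits modulo invertible scalars. -/
abbrev Stab : Type := (stab p).Obj

variable (p) in
/-- The cap `∑ a, ⟨a, a|` of the compact closed structure induced by the `Z`-observable. -/
def capMat (n : ℕ) : QMat p (n + n) 0 :=
  Matrix.of fun _ x => if x ∘ Fin.castAdd n = x ∘ Fin.natAdd n then 1 else 0

end Stabilizer

/-! ### From affine Lagrangian relations to stabilizer circuits -/

section Correspondence

/-- The graph of a map between phase spaces. -/
def phaseGraph {K : Type} {n m : ℕ} (g : Phase K n → Phase K m) : (phaseRel K).Hom n m :=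
  ({vw | vw.2 = g vw.1} : Set (Phase K n × Phase K m))

variable (p : ℕ) [Fact p.Prime]

/-- The affine symplectomorphisms which generate, and the operators to which they correspond. -/
inductive GatePair {n : ℕ} : (Phase (ZMod p) n → Phase (ZMod p) n) → QMat p n n → Prop
  | boost (i : Fin n) :
      GatePair (fun v => (v.1, Function.update v.2 i (v.2 i + 1))) (onWire i (boostOp p))
  | fourier (i : Fin n) :
      GatePair (fun v => (Function.update v.1 i (v.2 i), Function.update v.2 i (-v.1 i)))
        (onWire i (fourierOp p))
  | phase (i : Fin n) :
      GatePair (fun v => (Function.update v.1 i (v.1 i + v.2 i), v.2)) (onWire i (phaseOp p))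
  | control (i j : Fin n) (hij : i ≠ j) :
      GatePair (fun v => (Function.update v.1 i (v.1 i - v.1 j),
        Function.update v.2 j (v.2 j + v.2 i))) (onWires i j (controlledBoostOp p))

/-- Families of maps from affine Lagrangian states to stabilizer states modulo scalars. -/
abbrev StateMap : Type :=
  ∀ n : ℕ, (𝟙_ (AffLagRel (ZMod p)) ⟶ ⟨n⟩) → (𝟙_ (Stab p) ⟶ ⟨n⟩)

variable {p}

/-- The equations which determine the correspondence between affine Lagrangian states and
stabilizer states: the empty relation corresponds to the zero matrix, the relation in which the
`X`-grading is free and the `Z`-grading vanishes corresponds to `|0⟩ ^ ⊗ n`, and the generating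
affine symplectomorphisms correspond to the respective operators. -/
structure IsGross (G : StateMap p) : Prop where
  empty : ∀ n A, A.1 = (∅ : Set (Phase (ZMod p) 0 × Phase (ZMod p) n)) →
    (G n A).1 = toProj (0 : QMat p 0 n)
  zero : ∀ n A, A.1 = ({vw | vw.2.2 = 0} : Set (Phase (ZMod p) 0 × Phase (ZMod p) n)) →
    (G n A).1 = toProj (ketZero p n)
  gate : ∀ n A B (g : Phase (ZMod p) n → Phase (ZMod p) n) (U : QMat p n n), GatePair p g U →
    B.1 = (phaseRel (ZMod p)).comp A.1 (phaseGraph g) →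
    (G n B).1 = (projMat p).comp (G n A).1 (toProj U)

/-- Applying a state map to the curried form of a relation, and uncurrying the outcome with the
cap of the `Z`-observable: the input wires are capped off with the first wires of the state. -/
def hMap (G : StateMap p) {n m : AffLagRel (ZMod p)} (f : n ⟶ m) :
    (⟨n.wires⟩ : (projMat p).Obj) ⟶ ⟨m.wires⟩ :=
  let a : (projMat p).Obj := ⟨n.wires⟩
  let b : (projMat p).Obj := ⟨m.wires⟩
  let ψ : 𝟙_ (projMat p).Obj ⟶ a ⊗ b := (G (n.wires + m.wires) (curry f)).1
  let η : a ⊗ a ⟶ 𝟙_ (projMat p).Obj := toProj (capMat p n.wires)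
  (ρ_ a).inv ≫ (a ◁ ψ) ≫ (α_ a a b).inv ≫ (η ▷ b) ≫ (λ_ b).hom

/-- `hMap G` takes values in stabilizer circuits, and preserves identities and composition. -/
structure DefinesFunctor (G : StateMap p) : Prop where
  mem : ∀ {n m : AffLagRel (ZMod p)} (f : n ⟶ m),
    (projMat p).Generated (StabGen p) (a := n.wires) (b := m.wires) (hMap G f)
  map_id : ∀ n : AffLagRel (ZMod p), hMap G (𝟙 n) = 𝟙 _
  map_comp : ∀ {n m l : AffLagRel (ZMod p)} (f : n ⟶ m) (g : m ⟶ l),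
    hMap G (f ≫ g) = hMap G f ≫ hMap G g

/-- The functor which is the identity on the number of wires and `hMap G` on morphisms. -/
def hFunctor (G : StateMap p) (h : DefinesFunctor G) : AffLagRel (ZMod p) ⥤ Stab p where
  obj n := ⟨n.wires⟩
  map f := ⟨hMap G f, h.mem f⟩
  map_id n := Subtype.ext (h.map_id n)
  map_comp f g := Subtype.ext (h.map_comp f g)

end Correspondence

/-! For odd `p` the two sides are linked by Gross's discrete Wigner function. Each point `u` of
phase space has a phase point operator `pointOp u`, a reflection twisted by a character. Since 2 is
invertible, these operators form a trace-orthogonal basis of the matrices. Writing `A_u` for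
`pointOp u`, a matrix `M` has the kernel `wigner M v w`, the trace of `A_w M A_v M†`. `Represents M
R` says that this kernel is a nonzero constant on the relation `R` and zero elsewhere. Then `M`
determines `R` as the support of its kernel (`Represents.rel_unique`). Conversely `R` determines `M`
up to an invertible scalar (`Represents.toProj_unique`), because the kernel determines the map
sending `X` to `M X M†`.

Representation respects the operations of a prop. The kernel of a product is, up to a power of `p`,
the sum over intermediate points of the products of the kernels. For relations that are empty or
cosets, all related pairs have equally many intermediate points, so the product represents the
relational composite (`Represents.comp`). Kernels of Kronecker products factor
(`Represents.tensor`).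

Two facts match the classes of morphisms. Every stabilizer circuit represents an affine Lagrangian
relation (`IsStab.exists_generated`), since a Clifford operator conjugates `A_v` to `A_(S v + t)`
with `S` symplectic (`IsClifford.exists_intertwines`). Every affine Lagrangian state is represented
by a stabilizer state (`exists_isStab_of_state`). Indeed the four kinds of gates carry `{z = 0}` to
every nonempty affine Lagrangian subspace, by a symplectic Gaussian elimination
(`cosetsReach_of_isLagrangianSubspace`), and the empty state is represented by the zero matrix.

Hence `G` can be defined by sending a state to the unique class that represents it, and this is a
bijection. The same transitivity shows that the prescribed equations leave no other choice. Bending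
the inputs with the cup and then applying the cap is a snake equation for relations
(`relComp_curry_cap`), so `H(f)` represents `f`. Functoriality, compatibility with tensor products
and wire permutations, fullness and faithfulness all follow by comparing represented relations. -/

/-! ### Characters of `ZMod p` -/

section Wigner

variable {p : ℕ} [Fact p.Prime]

/-- The standard additive character of `ZMod p`. -/
noncomputable abbrev chi (k : ZMod p) : ℂ := ZMod.stdAddChar k

theorem chi_add (a b : ZMod p) : chi (a + b) = chi a * chi b := AddChar.map_add_eq_mul _ _ _

theorem chi_zero : chi (0 : ZMod p) = 1 := AddChar.map_zero_eq_one _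

theorem chi_ne_zero (a : ZMod p) : chi a ≠ 0 := by
  rw [chi, ZMod.stdAddChar_apply]
  exact Circle.coe_ne_zero _

theorem star_chi (a : ZMod p) : star (chi a) = chi (-a) := by
  rw [chi, chi, AddChar.map_neg_eq_inv, ZMod.stdAddChar_apply, ← Circle.coe_inv,
    Circle.coe_inv_eq_conj]
  rfl

/-- Orthogonality of characters. The standard character is injective, so testing on unit vectors
shows that the summand is the trivial character only for `c = 0`. -/
theorem sum_chi_dotProduct {n : ℕ} (c : Fin n → ZMod p) :
    ∑ x : Fin n → ZMod p, chi (x ⬝ᵥ c) = if c = 0 then (p : ℂ) ^ n else 0 := by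
  classical
  let ψ : AddChar (Fin n → ZMod p) ℂ :=
    { toFun := fun x => chi (x ⬝ᵥ c)
      map_zero_eq_one' := by rw [zero_dotProduct, chi_zero]
      map_add_eq_mul' := fun x y => by rw [add_dotProduct, chi_add] }
  have h : ψ = 0 ↔ c = 0 := by
    constructor
    · intro h
      funext i
      have h1 : ψ (Pi.single i 1) = 1 := by rw [h, AddChar.zero_apply]
      have h2 : chi (c i) = chi (0 : ZMod p) := by
        rw [chi_zero, ← h1]
        change _ = chi (Pi.single i 1 ⬝ᵥ c)
        rw [single_one_dotProduct]
      exact ZMod.injective_stdAddChar h2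
    · rintro rfl
      ext x
      change chi (x ⬝ᵥ 0) = 1
      rw [dotProduct_zero, chi_zero]
  have := AddChar.sum_eq_ite ψ
  simp only [h] at this
  change ∑ x, ψ x = _
  rw [this]
  simp [ZMod.card]

/-! ### Phase point operators -/

section Half

variable {n : ℕ}

theorem eq_add_self_iff [NeZero (2 : ZMod p)] (a b : Fin n → ZMod p) : a = b + b ↔ b = (2 : ZMod p)⁻¹ • a := by
  have h : (2 : ZMod p) ≠ 0 := NeZero.ne _
  constructor
  · rintro rfl
    rw [← two_smul (ZMod p), smul_smul, inv_mul_cancel₀ h, one_smul]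
  · rintro rfl
    rw [← two_smul (ZMod p), smul_smul, mul_inv_cancel₀ h, one_smul]

theorem add_self_inj [NeZero (2 : ZMod p)] {a b : Fin n → ZMod p} : a + a = b + b ↔ a = b := by
  refine ⟨fun h => ?_, fun h => by rw [h]⟩
  rw [(eq_add_self_iff _ b).1 h, ← (eq_add_self_iff _ a).1 rfl]

end Half

/-- The phase point operator, the reflection in the point `u` of phase space. -/
noncomputable def pointOp {n : ℕ} (u : Phase (ZMod p) n) : QMat p n n :=
  Matrix.of fun b a => if a + b = u.2 + u.2 then chi (u.1 ⬝ᵥ (b - a)) else 0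

theorem pointOp_apply {n : ℕ} (u : Phase (ZMod p) n) (b a : Fin n → ZMod p) :
    pointOp u b a = if a + b = u.2 + u.2 then chi (u.1 ⬝ᵥ (b - a)) else 0 := rfl

theorem conjTranspose_pointOp {n : ℕ} (u : Phase (ZMod p) n) : (pointOp u).conjTranspose = pointOp u := by
  ext b a
  rw [Matrix.conjTranspose_apply, pointOp_apply, pointOp_apply, add_comm b a]
  split_ifs
  · rw [star_chi, ← dotProduct_neg, neg_sub]
  · exact star_zero _

/-- A point operator is monomial: column `a` has its only nonzero entry in row `2 u.2 - a`.
Multiplication by it therefore permutes columns and inserts phases. -/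
theorem mul_pointOp_apply {m n : ℕ} (M : QMat p n m) (u : Phase (ZMod p) n) (b : Fin m → ZMod p)
    (a : Fin n → ZMod p) :
    (M * pointOp u) b a = M b (u.2 + u.2 - a) * chi (u.1 ⬝ᵥ (u.2 + u.2 - a - a)) := by
  have : ∀ c, a + c = u.2 + u.2 ↔ c = u.2 + u.2 - a := fun c => by rw [eq_sub_iff_add_eq, add_comm]
  simp [Matrix.mul_apply, pointOp_apply, this]

theorem pointOp_mul_apply {m n : ℕ} (M : QMat p m n) (u : Phase (ZMod p) n) (b : Fin n → ZMod p)
    (a : Fin m → ZMod p) :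
    (pointOp u * M) b a = chi (u.1 ⬝ᵥ (b - (u.2 + u.2 - b))) * M (u.2 + u.2 - b) a := by
  have : ∀ c, c + b = u.2 + u.2 ↔ c = u.2 + u.2 - b := fun c => by rw [eq_sub_iff_add_eq]
  simp [Matrix.mul_apply, pointOp_apply, this]

/-- Completeness of the point operators. The sum over `u.2` forces `a + b = d + c`, and the
character sum over `u.1` forces `b - a + (c - d) = 0`. As 2 is invertible, these two conditions give
`b = d` and `a = c`. -/
theorem sum_pointOp_mul_pointOp [NeZero (2 : ZMod p)] {n : ℕ} (a b c d : Fin n → ZMod p) :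
    ∑ u : Phase (ZMod p) n, pointOp u b a * pointOp u c d =
      if b = d ∧ a = c then (p : ℂ) ^ n else 0 := by
  rw [Fintype.sum_prod_type]
  simp only [pointOp_apply, eq_add_self_iff, ite_mul, zero_mul, mul_ite, mul_zero]
  rw [Finset.sum_comm]
  simp only [Finset.sum_ite_irrel, Finset.sum_const_zero, Finset.sum_ite_eq', Finset.mem_univ,
    if_true, ← chi_add, ← dotProduct_add, sum_chi_dotProduct]
  rw [← ite_and]
  refine if_congr ?_ rfl rfl
  have h : (2 : ZMod p)⁻¹ ≠ 0 := inv_ne_zero (NeZero.ne _)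
  rw [(smul_right_injective _ h).eq_iff]
  constructor
  · rintro ⟨h1, h2⟩
    have : d = b := by
      rw [← add_self_inj, ← sub_eq_zero]
      have : d + d - (b + b) = (d + c - (a + b)) - (b - a + (c - d)) := by abel
      rw [this, h1, h2, sub_self, sub_zero]
    subst this
    exact ⟨rfl, (add_right_cancel ((add_comm _ _).trans h1)).symm⟩
  · rintro ⟨rfl, rfl⟩
    exact ⟨add_comm _ _, by abel⟩

/-- The expansion of a matrix in point operators. It reduces linear statements about all matrices to
statements about point operators. -/
theorem sum_trace_smul_pointOp [NeZero (2 : ZMod p)] {n : ℕ} (X : QMat p n n) :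
    ∑ u : Phase (ZMod p) n, (pointOp u * X).trace • pointOp u = (p : ℂ) ^ n • X := by
  ext c d
  simp only [Matrix.sum_apply, Matrix.smul_apply, smul_eq_mul, Matrix.trace, Matrix.diag,
    Matrix.mul_apply, Finset.sum_mul]
  rw [Finset.sum_comm]
  simp_rw [Finset.sum_comm (s := (Finset.univ : Finset (Phase (ZMod p) n)))]
  have : ∀ b a : Fin n → ZMod p, ∑ u : Phase (ZMod p) n, pointOp u b a * X a b * pointOp u c d =
      if b = d then if a = c then (p : ℂ) ^ n * X a b else 0 else 0 := fun b a => by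
    simp_rw [mul_right_comm _ (X a b)]
    rw [← Finset.sum_mul, sum_pointOp_mul_pointOp, ite_mul, zero_mul, ite_and]
  simp [this]

theorem trace_pointOp_mul_pointOp [NeZero (2 : ZMod p)] {n : ℕ} (u v : Phase (ZMod p) n) :
    (pointOp u * pointOp v).trace = if u = v then (p : ℂ) ^ n else 0 := by
  simp only [Matrix.trace, Matrix.diag, mul_pointOp_apply, pointOp_apply]
  have h : ∀ x : Fin n → ZMod p, v.2 + v.2 - x + x = u.2 + u.2 ↔ u.2 = v.2 := fun x => by
    rw [sub_add_cancel, add_self_inj, eq_comm]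
  simp only [h]
  by_cases h2 : u.2 = v.2
  · simp only [h2, if_true, ← chi_add]
    -- Centring `x` at `v.2` turns the phase into a character whose frequency is twice `u.1 - v.1`.
    have h3 : ∀ x : Fin n → ZMod p, chi (u.1 ⬝ᵥ (x - (v.2 + v.2 - x)) +
        v.1 ⬝ᵥ (v.2 + v.2 - x - x)) = chi ((x - v.2) ⬝ᵥ (u.1 - v.1 + (u.1 - v.1))) := fun x => by
      congr 1
      rw [dotProduct_comm (x - v.2)]
      simp only [dotProduct_sub, dotProduct_add, add_dotProduct, sub_dotProduct]
      ring
    simp only [h3]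
    have h4 := (Equiv.subRight v.2).sum_comp (fun y => chi (y ⬝ᵥ (u.1 - v.1 + (u.1 - v.1))))
    simp only [Equiv.subRight_apply] at h4
    rw [h4, sum_chi_dotProduct]
    refine if_congr ?_ rfl rfl
    rw [← add_zero (0 : Fin n → ZMod p), add_self_inj, sub_eq_zero]
    exact ⟨fun h => Prod.ext h h2, fun h => congrArg _ h⟩
  · simp only [h2, if_false, zero_mul, Finset.sum_const_zero]
    rw [if_neg fun h => h2 (congrArg _ h)]

/-! ### The Wigner kernel of a matrix -/

/-- The kernel of conjugation by `M` with respect to the phase point operators. -/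
noncomputable def wigner {n m : ℕ} (M : QMat p n m) (v : Phase (ZMod p) n) (w : Phase (ZMod p) m) : ℂ :=
  (pointOp w * M * pointOp v * M.conjTranspose).trace

theorem wigner_conjTranspose {n m : ℕ} (M : QMat p n m) (v : Phase (ZMod p) n)
    (w : Phase (ZMod p) m) : wigner M.conjTranspose w v = wigner M v w := by
  rw [wigner, wigner, Matrix.conjTranspose_conjTranspose, Matrix.mul_assoc, Matrix.trace_mul_comm,
    ← Matrix.mul_assoc]

theorem wigner_zero {n m : ℕ} (v : Phase (ZMod p) n) (w : Phase (ZMod p) m) :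
    wigner (0 : QMat p n m) v w = 0 := by simp [wigner]

/-- The kernel values are, up to normalization, the coefficients of the conjugated point operator in
the basis of point operators. -/
theorem sum_wigner_smul_pointOp [NeZero (2 : ZMod p)] {n m : ℕ} (M : QMat p n m) (v : Phase (ZMod p) n) :
    ∑ w, wigner M v w • pointOp w = (p : ℂ) ^ m • (M * pointOp v * M.conjTranspose) := by
  rw [← sum_trace_smul_pointOp]
  simp only [wigner, Matrix.mul_assoc]

/-- Expanding `M A_v M†` in point operators inside the trace for `N * M` inserts a sum over
intermediate points. This is the reason why matrix multiplication mirrors relational composition. -/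
theorem sum_wigner_mul_wigner [NeZero (2 : ZMod p)] {a b c : ℕ} (M : QMat p a b) (N : QMat p b c)
    (v : Phase (ZMod p) a) (w : Phase (ZMod p) c) :
    ∑ u, wigner M v u * wigner N u w = (p : ℂ) ^ b * wigner (N * M) v w := by
  have h : (p : ℂ) ^ b * wigner (N * M) v w = (pointOp w * N *
      ((p : ℂ) ^ b • (M * pointOp v * M.conjTranspose)) * N.conjTranspose).trace := by
    simp only [wigner, Matrix.conjTranspose_mul, Matrix.mul_smul, Matrix.smul_mul,
      Matrix.trace_smul, smul_eq_mul, Matrix.mul_assoc]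
  rw [h, ← sum_wigner_smul_pointOp]
  simp only [Matrix.mul_sum, Matrix.sum_mul, Matrix.trace_sum, Matrix.mul_smul, Matrix.smul_mul,
    Matrix.trace_smul, smul_eq_mul]
  rfl

/-- Point operators span, so proportional kernels make the maps `X ↦ M X M†` and `X ↦ N X N†`
proportional. On matrix units this compares all products of an entry with a conjugate entry. Fixing
one nonzero entry of `N` as the conjugated factor then exhibits `M` as a multiple of `N`. -/
theorem exists_smul_of_wigner [NeZero (2 : ZMod p)] {n m : ℕ} {M N : QMat p n m} {k : ℂ} (hk : k ≠ 0)
    (h : ∀ v w, wigner M v w = k * wigner N v w) : ∃ c : ℂ, c ≠ 0 ∧ M = c • N := by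
  have hp : (p : ℂ) ≠ 0 := Nat.cast_ne_zero.2 (NeZero.ne p)
  have h1 : ∀ v : Phase (ZMod p) n, M * pointOp v * M.conjTranspose = k • (N * pointOp v * N.conjTranspose) := by
    intro v
    refine smul_right_injective _ (pow_ne_zero m hp) ?_
    change (p : ℂ) ^ m • _ = (p : ℂ) ^ m • _
    rw [← sum_wigner_smul_pointOp, smul_comm, ← sum_wigner_smul_pointOp]
    simp only [h, ← smul_smul, ← Finset.smul_sum]
  have h2 : ∀ X : QMat p n n, M * X * M.conjTranspose = k • (N * X * N.conjTranspose) := by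
    intro X
    refine smul_right_injective _ (pow_ne_zero n hp) ?_
    change (p : ℂ) ^ n • _ = (p : ℂ) ^ n • _
    have h0 : ∀ K : QMat p n m, (p : ℂ) ^ n • (K * X * K.conjTranspose) =
        ∑ u : Phase (ZMod p) n, (pointOp u * X).trace • (K * pointOp u * K.conjTranspose) := by
      intro K
      rw [← Matrix.smul_mul, ← Matrix.mul_smul, ← sum_trace_smul_pointOp]
      simp only [Matrix.mul_sum, Matrix.sum_mul, Matrix.mul_smul, Matrix.smul_mul]
    rw [h0, smul_comm, h0, Finset.smul_sum]
    simp only [h1]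
    exact Finset.sum_congr rfl fun _ _ => smul_comm _ _ _
  have h3 : ∀ i j k' l, M i j * star (M k' l) = k * (N i j * star (N k' l)) := by
    intro i j k' l
    -- Conjugating the matrix unit at `(j, l)` isolates the product of column `j` with the conjugate
    -- of column `l`.
    have := congrFun (congrFun (h2 (Matrix.single j l 1)) i) k'
    rw [Matrix.smul_apply, Matrix.mul_apply, Matrix.mul_apply] at this
    simpa [Matrix.mul_single_eq_updateCol_zero, Matrix.updateCol_apply] using this
  by_cases hN : N = 0
  · refine ⟨1, one_ne_zero, ?_⟩
    subst hN
    ext i j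
    have := h3 i j i j
    simpa using this
  · obtain ⟨r, s, hrs⟩ : ∃ r s, N r s ≠ 0 := by
      by_contra! H
      exact hN (Matrix.ext H)
    have hM : star (M r s) ≠ 0 := by
      intro h0
      have := h3 r s r s
      rw [h0, mul_zero] at this
      exact mul_ne_zero hk (mul_ne_zero hrs (star_ne_zero.2 hrs)) this.symm
    refine ⟨k * star (N r s) / star (M r s), div_ne_zero (mul_ne_zero hk (star_ne_zero.2 hrs)) hM,
      ?_⟩
    ext i j
    rw [Matrix.smul_apply, smul_eq_mul, div_mul_eq_mul_div, eq_div_iff hM, h3]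
    ring

end Wigner

/-! ### Matrices which represent relations -/

/-- A subset of an abelian group which is empty or a coset of a subgroup. -/
def IsTorsor {E : Type} [AddCommGroup E] (R : Set E) : Prop :=
  ∀ r ∈ R, ∀ s ∈ R, ∀ t ∈ R, r - s + t ∈ R

/-- Composition of relations. -/
def relComp {A B C : Type} (R : Set (A × B)) (S : Set (B × C)) : Set (A × C) :=
  {vw | ∃ u, (vw.1, u) ∈ R ∧ (u, vw.2) ∈ S}

/-- The direct sum of relations between phase spaces. -/
def relTensor {K : Type} {a b c d : ℕ} (R : Set (Phase K a × Phase K b))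
    (S : Set (Phase K c × Phase K d)) : Set (Phase K (a + c) × Phase K (b + d)) :=
  {vw | (vw.1.pull (Fin.castAdd c), vw.2.pull (Fin.castAdd d)) ∈ R ∧
    (vw.1.pull (Fin.natAdd a), vw.2.pull (Fin.natAdd b)) ∈ S}

/-- The relation which permutes wires. -/
def relPerm (K : Type) {a b : ℕ} (e : Fin a ≃ Fin b) : Set (Phase K a × Phase K b) :=
  {vw | vw.1 = vw.2.pull e}

/-- The graph of a map as a relation. -/
def relGraph {A B : Type} (g : A → B) : Set (A × B) := {vw | vw.2 = g vw.1}

theorem append_comp_castAdd {α : Type} {m n : ℕ} (a : Fin m → α) (b : Fin n → α) :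
    Fin.append a b ∘ Fin.castAdd n = a := funext fun i => Fin.append_left a b i

theorem append_comp_natAdd {α : Type} {m n : ℕ} (a : Fin m → α) (b : Fin n → α) :
    Fin.append a b ∘ Fin.natAdd m = b := funext fun i => Fin.append_right a b i

section Represents

variable {p : ℕ} [Fact p.Prime]

/-- The Wigner kernel of `M` is a multiple of the indicator function of `R`. -/
def Represents {n m : ℕ} (M : QMat p n m) (R : Set (Phase (ZMod p) n × Phase (ZMod p) m)) : Prop :=
  ∃ c : ℂ, c ≠ 0 ∧ ∀ v w, wigner M v w = R.indicator (fun _ => c) (v, w)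

theorem wigner_smul {n m : ℕ} (c : ℂ) (M : QMat p n m) (v : Phase (ZMod p) n)
    (w : Phase (ZMod p) m) : wigner (c • M) v w = c * star c * wigner M v w := by
  simp only [wigner, Matrix.conjTranspose_smul, Matrix.mul_smul, Matrix.smul_mul,
    Matrix.trace_smul, smul_eq_mul]
  ring

theorem toProj_eq_iff {n m : ℕ} {M N : QMat p n m} :
    toProj M = toProj N ↔ ∃ c : ℂ, c ≠ 0 ∧ N = c • M := by
  exact Quotient.eq (r := scalarSetoid p n m)

theorem exists_toProj {n m : ℕ} (f : (projMat p).Hom n m) : ∃ M : QMat p n m, toProj M = f :=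
  Quotient.exists_rep f

namespace Represents

variable {n m : ℕ} {M N : QMat p n m} {R S : Set (Phase (ZMod p) n × Phase (ZMod p) m)}

/-- The constants are nonzero, so both relations are the support of the same kernel. -/
theorem rel_unique (h : Represents M R) (k : Represents M S) : R = S := by
  obtain ⟨c, hc, h⟩ := h
  obtain ⟨d, hd, k⟩ := k
  ext ⟨v, w⟩
  have := (h v w).symm.trans (k v w)
  by_cases h1 : (v, w) ∈ R <;> by_cases h2 : (v, w) ∈ S <;> simp_all

/-- The kernels differ by the ratio of the two constants. The empty relation is no exception, since
vanishing kernels are proportional too. -/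
theorem toProj_unique [NeZero (2 : ZMod p)] (h : Represents M R) (k : Represents N R) :
    toProj M = toProj N := by
  obtain ⟨c, hc, h⟩ := h
  obtain ⟨d, hd, k⟩ := k
  refine toProj_eq_iff.2 (exists_smul_of_wigner (div_ne_zero hd hc) fun v w => ?_)
  rw [h, k]
  by_cases h1 : (v, w) ∈ R
  · rw [Set.indicator_of_mem h1, Set.indicator_of_mem h1, div_mul_cancel₀ _ hc]
  · rw [Set.indicator_of_notMem h1, Set.indicator_of_notMem h1, mul_zero]

theorem smul {c : ℂ} (hc : c ≠ 0) (h : Represents M R) : Represents (c • M) R := by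
  obtain ⟨d, hd, h⟩ := h
  refine ⟨c * star c * d, mul_ne_zero (mul_ne_zero hc (star_ne_zero.2 hc)) hd, fun v w => ?_⟩
  rw [wigner_smul, h]
  by_cases h1 : (v, w) ∈ R
  · rw [Set.indicator_of_mem h1, Set.indicator_of_mem h1]
  · rw [Set.indicator_of_notMem h1, Set.indicator_of_notMem h1, mul_zero]

theorem congr (h : Represents M R) (k : toProj M = toProj N) : Represents N R := by
  obtain ⟨c, hc, rfl⟩ := toProj_eq_iff.1 k
  exact h.smul hc

variable (n m) in
theorem zero : Represents (0 : QMat p n m) ∅ :=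
  ⟨1, one_ne_zero, fun v w => by rw [wigner_zero, Set.indicator_empty]⟩

theorem conjTranspose (h : Represents M R) :
    Represents M.conjTranspose {wv | (wv.2, wv.1) ∈ R} := by
  obtain ⟨c, hc, h⟩ := h
  refine ⟨c, hc, fun w v => ?_⟩
  rw [wigner_conjTranspose, h]
  rfl

/-- The kernel of the product at `(v, w)` is proportional to the number of points `u` linking `v` to
`w`. When both relations are torsors, the translation `t ↦ t - u' + u` injects the set of links of
any pair into any nonempty such set. All nonempty ones thus have equal size, and the kernel is
constant on the composite. -/
theorem comp [NeZero (2 : ZMod p)] {a b c : ℕ} {M : QMat p a b} {N : QMat p b c}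
    {R : Set (Phase (ZMod p) a × Phase (ZMod p) b)} {S : Set (Phase (ZMod p) b × Phase (ZMod p) c)}
    (hR : IsTorsor R) (hS : IsTorsor S) (h : Represents M R) (k : Represents N S) :
    Represents (matComp M N) (relComp R S) := by
  classical
  obtain ⟨r, hr, h⟩ := h
  obtain ⟨s, hs, k⟩ := k
  have hp : (p : ℂ) ^ b ≠ 0 := pow_ne_zero _ (Nat.cast_ne_zero.2 (NeZero.ne p))
  let T (v : Phase (ZMod p) a) (w : Phase (ZMod p) c) : Finset (Phase (ZMod p) b) :=
    Finset.univ.filter fun u => (v, u) ∈ R ∧ (u, w) ∈ S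
  have hT : ∀ v w, (p : ℂ) ^ b * wigner (matComp M N) v w = (T v w).card * (r * s) := by
    intro v w
    rw [matComp, ← sum_wigner_mul_wigner]
    simp only [h, k]
    rw [← nsmul_eq_mul, ← Finset.sum_const, Finset.sum_filter]
    refine Finset.sum_congr rfl fun u _ => ?_
    by_cases h1 : (v, u) ∈ R <;> by_cases h2 : (u, w) ∈ S <;> simp [h1, h2]
  have hle : ∀ v w v' w', (T v w).Nonempty → (T v' w').card ≤ (T v w).card := by
    rintro v w v' w' ⟨u, hu⟩
    rcases (T v' w').eq_empty_or_nonempty with h0 | ⟨u', hu'⟩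
    · simp [h0]
    · refine Finset.card_le_card_of_injOn (fun t => t - u' + u) (fun t ht => ?_)
        (fun t _ t' _ htt => by simpa using htt)
      simp only [T, Finset.mem_filter, Finset.mem_univ, true_and, Finset.coe_filter,
        Set.mem_ofPred_eq] at hu hu' ht ⊢
      constructor
      · simpa using hR _ ht.1 _ hu'.1 _ hu.1
      · simpa using hS _ ht.2 _ hu'.2 _ hu.2
  have hmem : ∀ v w, (v, w) ∈ relComp R S ↔ (T v w).Nonempty := fun v w =>
    ⟨fun ⟨u, hu⟩ => ⟨u, Finset.mem_filter.2 ⟨Finset.mem_univ _, hu⟩⟩,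
      fun ⟨u, hu⟩ => ⟨u, (Finset.mem_filter.1 hu).2⟩⟩
  by_cases hne : ∃ v w, (T v w).Nonempty
  · obtain ⟨v₀, w₀, h0⟩ := hne
    refine ⟨(T v₀ w₀).card * (r * s) / (p : ℂ) ^ b, div_ne_zero (mul_ne_zero
      (Nat.cast_ne_zero.2 h0.card_ne_zero) (mul_ne_zero hr hs)) hp, fun v w => ?_⟩
    by_cases h1 : (v, w) ∈ relComp R S
    · rw [Set.indicator_of_mem h1, eq_div_iff hp, mul_comm, hT,
        le_antisymm (hle v₀ w₀ v w h0) (hle v w v₀ w₀ ((hmem _ _).1 h1))]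
    · rw [Set.indicator_of_notMem h1]
      rw [hmem, Finset.not_nonempty_iff_eq_empty] at h1
      have := hT v w
      rw [h1, Finset.card_empty, Nat.cast_zero, zero_mul] at this
      exact (mul_eq_zero.1 this).resolve_left hp
  · push Not at hne
    -- The composite is empty and the kernel vanishes identically, so any nonzero constant serves.
    refine ⟨1, one_ne_zero, fun v w => ?_⟩
    have h1 : (v, w) ∉ relComp R S := by
      rw [hmem, hne]
      exact Finset.not_nonempty_empty
    rw [Set.indicator_of_notMem h1]
    have := hT v w
    rw [hne, Finset.card_empty, Nat.cast_zero, zero_mul] at this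
    exact (mul_eq_zero.1 this).resolve_left hp

end Represents

/-! ### Kernels of Kronecker products -/

theorem dotProduct_split {a c : ℕ} (x y : Fin (a + c) → ZMod p) :
    x ⬝ᵥ y = (x ∘ Fin.castAdd c) ⬝ᵥ (y ∘ Fin.castAdd c) +
      (x ∘ Fin.natAdd a) ⬝ᵥ (y ∘ Fin.natAdd a) := by
  simp only [dotProduct, Fin.sum_univ_add, Function.comp_apply]

theorem fun_split_iff {α : Type} {a c : ℕ} {x y : Fin (a + c) → α} :
    x = y ↔ x ∘ Fin.castAdd c = y ∘ Fin.castAdd c ∧ x ∘ Fin.natAdd a = y ∘ Fin.natAdd a :=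
  ⟨fun h => by rw [h]; exact ⟨rfl, rfl⟩,
    fun h => funext fun i => Fin.addCases (congrFun h.1) (congrFun h.2) i⟩

theorem ite_and_mul {P Q R : Prop} [Decidable P] [Decidable Q] [Decidable R] (h : P ↔ Q ∧ R)
    (a b : ℂ) : (if P then a * b else 0) = (if Q then a else 0) * (if R then b else 0) := by
  by_cases hQ : Q <;> by_cases hR : R <;> simp [h, hQ, hR]

/-- The support condition of a point operator is a conjunction over wires and its phase is a product
over wires, so both split along blocks. The factorization of kernels follows because the trace is
multiplicative. -/
theorem pointOp_eq_matTensor {a c : ℕ} (v : Phase (ZMod p) (a + c)) :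
    pointOp v = matTensor (pointOp (v.pull (Fin.castAdd c))) (pointOp (v.pull (Fin.natAdd a))) := by
  ext y x
  simp only [matTensor, Matrix.of_apply, pointOp_apply]
  rw [dotProduct_split, chi_add]
  have : x + y = v.2 + v.2 ↔
      x ∘ Fin.castAdd c + y ∘ Fin.castAdd c = v.2 ∘ Fin.castAdd c + v.2 ∘ Fin.castAdd c ∧
      x ∘ Fin.natAdd a + y ∘ Fin.natAdd a = v.2 ∘ Fin.natAdd a + v.2 ∘ Fin.natAdd a :=
    fun_split_iff
  exact ite_and_mul this _ _

theorem conjTranspose_matTensor {a b c d : ℕ} (M : QMat p a b) (N : QMat p c d) :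
    (matTensor M N).conjTranspose = matTensor M.conjTranspose N.conjTranspose := by
  ext y x
  simp [matTensor]

theorem trace_matTensor {a c : ℕ} (M : QMat p a a) (N : QMat p c c) :
    (matTensor M N).trace = M.trace * N.trace := by
  simp only [Matrix.trace, Matrix.diag, matTensor, Matrix.of_apply]
  rw [← (Fin.appendEquiv a c).sum_comp, Fintype.sum_prod_type, Finset.sum_mul_sum]
  refine Finset.sum_congr rfl fun u _ => Finset.sum_congr rfl fun u' _ => ?_
  simp only [Fin.appendEquiv, Equiv.coe_fn_mk, append_comp_castAdd, append_comp_natAdd]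

theorem wigner_matTensor {a b c d : ℕ} (M : QMat p a b) (N : QMat p c d)
    (v : Phase (ZMod p) (a + c)) (w : Phase (ZMod p) (b + d)) :
    wigner (matTensor M N) v w =
      wigner M (v.pull (Fin.castAdd c)) (w.pull (Fin.castAdd d)) *
        wigner N (v.pull (Fin.natAdd a)) (w.pull (Fin.natAdd b)) := by
  have h : ∀ {a b c a' b' c' : ℕ} (M : QMat p a b) (N : QMat p b c) (M' : QMat p a' b')
      (N' : QMat p b' c'), matTensor N N' * matTensor M M' = matTensor (N * M) (N' * M') :=
    fun M N M' N' => (matTensor_mul M N M' N').symm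
  rw [wigner, pointOp_eq_matTensor v, pointOp_eq_matTensor w, conjTranspose_matTensor, h, h, h,
    trace_matTensor]
  rfl

theorem Represents.tensor {a b c d : ℕ} {M : QMat p a b} {N : QMat p c d}
    {R : Set (Phase (ZMod p) a × Phase (ZMod p) b)} {S : Set (Phase (ZMod p) c × Phase (ZMod p) d)}
    (h : Represents M R) (k : Represents N S) :
    Represents (matTensor M N) (relTensor R S) := by
  classical
  obtain ⟨r, hr, h⟩ := h
  obtain ⟨s, hs, k⟩ := k
  refine ⟨r * s, mul_ne_zero hr hs, fun v w => ?_⟩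
  rw [wigner_matTensor, h, k]
  simp only [Set.indicator_apply]
  by_cases h1 : (v.pull (Fin.castAdd c), w.pull (Fin.castAdd d)) ∈ R
  · by_cases h2 : (v.pull (Fin.natAdd a), w.pull (Fin.natAdd b)) ∈ S
    · rw [if_pos h1, if_pos h2, if_pos (show (v, w) ∈ relTensor R S from ⟨h1, h2⟩)]
    · rw [if_neg h2, mul_zero, if_neg fun h => h2 h.2]
  · rw [if_neg h1, zero_mul, if_neg fun h => h1 h.1]

/-! ### Relations represented by graphs, wire permutations, kets and caps -/

theorem represents_relGraph [NeZero (2 : ZMod p)] {n m : ℕ} {U : QMat p n m} (hU : U * U.conjTranspose = 1)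
    {g : Phase (ZMod p) n → Phase (ZMod p) m} (h : ∀ v, U * pointOp v = pointOp (g v) * U) :
    Represents U (relGraph g) := by
  refine ⟨(p : ℂ) ^ m, pow_ne_zero _ (Nat.cast_ne_zero.2 (NeZero.ne p)), fun v w => ?_⟩
  -- The kernel becomes the trace pairing of `A_w` with `A_(g v)`, which orthogonality evaluates.
  rw [wigner, Matrix.mul_assoc (pointOp w), h, ← Matrix.mul_assoc, Matrix.mul_assoc, hU,
    Matrix.mul_one, trace_pointOp_mul_pointOp]
  classical
  rw [Set.indicator_apply]
  exact if_congr Iff.rfl rfl rfl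

theorem represents_matPerm [NeZero (2 : ZMod p)] {a b : ℕ} (e : Fin a ≃ Fin b) :
    Represents (matPerm e : QMat p a b) (relPerm (ZMod p) e) := by
  have h1 : (matPerm e : QMat p a b).conjTranspose = matPerm e.symm := by
    ext y x
    simp only [Matrix.conjTranspose_apply, matPerm, Matrix.of_apply]
    have : y = x ∘ e ↔ x = y ∘ e.symm :=
      ⟨fun h => by rw [h, Function.comp_assoc, Equiv.self_comp_symm, Function.comp_id],
        fun h => by rw [h, Function.comp_assoc, Equiv.symm_comp_self, Function.comp_id]⟩
    simp only [this]
    split_ifs <;> simp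
  have h2 : relGraph (fun v : Phase (ZMod p) a => v.pull e.symm) = relPerm (ZMod p) e :=
    Set.ext fun vw => eq_comm.trans (Phase.eq_pull_iff e vw.1 vw.2).symm
  rw [← h2]
  refine represents_relGraph ?_ fun v => ?_
  · rw [h1]
    have := (matProp p).perm_comp e.symm e
    rw [Equiv.symm_trans_self] at this
    exact this.trans (matPerm_refl b)
  · ext y x
    have k1 := matPerm_mul e (pointOp v) y x
    have k2 := mul_matPerm e (pointOp (v.pull e.symm)) y x
    rw [matComp] at k1 k2
    rw [k1, k2, pointOp_apply, pointOp_apply]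
    have h3 : ∀ s : Fin b → ZMod p, s = (s ∘ e) ∘ e.symm := fun s => by
      rw [Function.comp_assoc, Equiv.self_comp_symm, Function.comp_id]
    have h4 : ∀ s t : Fin a → ZMod p, (s ∘ e.symm) ⬝ᵥ (t ∘ e.symm) = s ⬝ᵥ t := fun s t =>
      e.symm.sum_comp fun i => s i * t i
    refine if_congr ?_ ?_ rfl
    · have h5 : ∀ s t : Fin a → ZMod p, s = t ↔ s ∘ e.symm = t ∘ e.symm := fun s t =>
        e.symm.surjective.injective_comp_right.eq_iff.symm
      conv_rhs => rw [h3 y]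
      exact h5 _ _
    · rw [← h4]
      conv_rhs => rw [h3 y]
      rfl

/-- The projector on `|0⟩` is a matrix unit, so the kernel is the corresponding diagonal entry of
`A_w`. This entry is 1 when `2 w.2 = 0` and vanishes otherwise. -/
theorem represents_ketZero [NeZero (2 : ZMod p)] (n : ℕ) :
    Represents (ketZero p n) {vw : Phase (ZMod p) 0 × Phase (ZMod p) n | vw.2.2 = 0} := by
  classical
  refine ⟨1, one_ne_zero, fun v w => ?_⟩
  have h1 : pointOp v = 1 := by
    ext y x
    rw [pointOp_apply, if_pos (Subsingleton.elim _ _), Subsingleton.elim y x, Matrix.one_apply_eq,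
      sub_self, dotProduct_zero, chi_zero]
  have h2 : (ketZero p n * (ketZero p n).conjTranspose) = Matrix.single 0 0 1 := by
    ext y x
    simp [Matrix.mul_apply, ketZero, Matrix.single_apply, ← ite_and, eq_comm, and_comm]
  rw [wigner, h1, Matrix.mul_one, Matrix.mul_assoc, h2, Matrix.trace_mul_comm,
    Matrix.trace_single_mul, pointOp_apply, one_smul, sub_self, dotProduct_zero, chi_zero,
    Set.indicator_apply]
  exact if_congr (add_self_inj.trans eq_comm) rfl rfl

theorem represents_braZero [NeZero (2 : ZMod p)] (n : ℕ) :
    Represents (braZero p n) {vw : Phase (ZMod p) n × Phase (ZMod p) 0 | vw.1.2 = 0} := by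
  have : braZero p n = (ketZero p n).conjTranspose := by
    ext y x
    simp [braZero, ketZero]
  rw [this]
  exact (represents_ketZero n).conjTranspose

/-- The cap: the converse of the cup. -/
def capRel (K : Type) [Field K] (n : ℕ) : Set (Phase K (n + n) × Phase K 0) :=
  {vw | (vw.2, vw.1) ∈ cupSpace K n}

/-- The kernel sums the entries of `A_v` between the vectors `|a, a⟩` and `|b, b⟩`. A nonzero entry
needs `b + a` to be twice each of the two `Z`-blocks, so these blocks agree. The remaining character
sum over `a` makes the two `X`-blocks opposite. This is the source of the sign in the `X`-grading of
the cup. -/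
theorem represents_capMat [NeZero (2 : ZMod p)] (n : ℕ) :
    Represents (capMat p n) (capRel (ZMod p) n) := by
  classical
  refine ⟨(p : ℂ) ^ n, pow_ne_zero _ (Nat.cast_ne_zero.2 (NeZero.ne p)), fun v w => ?_⟩
  have h1 : pointOp w = 1 := by
    ext y x
    rw [pointOp_apply, if_pos (Subsingleton.elim _ _), Subsingleton.elim y x, Matrix.one_apply_eq,
      sub_self, dotProduct_zero, chi_zero]
  have hsum : ∀ F : (Fin (n + n) → ZMod p) → ℂ,
      (∑ x, if x ∘ Fin.castAdd n = x ∘ Fin.natAdd n then F x else 0) =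
        ∑ a : Fin n → ZMod p, F (Fin.append a a) := fun F => by
    rw [← (Fin.appendEquiv n n).sum_comp, Fintype.sum_prod_type]
    refine Finset.sum_congr rfl fun a _ => ?_
    simp [Fin.appendEquiv, append_comp_castAdd, append_comp_natAdd]
  have h2 : wigner (capMat p n) v w = ∑ a : Fin n → ZMod p, ∑ b : Fin n → ZMod p,
      pointOp v (Fin.append a a) (Fin.append b b) := by
    rw [wigner, h1, Matrix.one_mul]
    simp only [Matrix.trace, Matrix.diag, Matrix.mul_apply, capMat, Matrix.of_apply,
      Matrix.conjTranspose_apply, Finset.univ_unique, Finset.sum_singleton, ite_mul, one_mul,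
      zero_mul, apply_ite star, star_one, star_zero, mul_ite, mul_one, mul_zero]
    rw [hsum]
    simp only [hsum]
    exact Finset.sum_comm
  have h3 : ∀ a b : Fin n → ZMod p, pointOp v (Fin.append a a) (Fin.append b b) =
      if b + a = (v.2 ∘ Fin.castAdd n) + (v.2 ∘ Fin.castAdd n) ∧
        b + a = (v.2 ∘ Fin.natAdd n) + (v.2 ∘ Fin.natAdd n) then
      chi ((v.1 ∘ Fin.castAdd n + v.1 ∘ Fin.natAdd n) ⬝ᵥ (a - b)) else 0 := fun a b => by
    rw [pointOp_eq_matTensor]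
    simp only [matTensor, Matrix.of_apply, pointOp_apply]
    simp only [append_comp_castAdd, append_comp_natAdd, Phase.pull]
    rw [add_dotProduct, chi_add, ite_and]
    split_ifs <;> simp
  rw [h2]
  simp only [h3]
  have hmem : (v, w) ∈ capRel (ZMod p) n ↔ (v.2 ∘ Fin.castAdd n = v.2 ∘ Fin.natAdd n ∧
      v.1 ∘ Fin.castAdd n + v.1 ∘ Fin.natAdd n = 0) := by
    change (∀ i : Fin n, v.1 (Fin.castAdd n i) = -v.1 (Fin.natAdd n i) ∧
      v.2 (Fin.castAdd n i) = v.2 (Fin.natAdd n i)) ↔ _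
    simp only [funext_iff, Function.comp_apply, Pi.add_apply, Pi.zero_apply,
      eq_neg_iff_add_eq_zero, forall_and]
    exact and_comm
  rw [Set.indicator_apply, hmem]
  by_cases hz : v.2 ∘ Fin.castAdd n = v.2 ∘ Fin.natAdd n
  · have h4 : ∀ a b : Fin n → ZMod p,
        b + a = (v.2 ∘ Fin.natAdd n) + (v.2 ∘ Fin.natAdd n) ↔
          b = (v.2 ∘ Fin.natAdd n) + (v.2 ∘ Fin.natAdd n) - a := fun a b => eq_sub_iff_add_eq.symm
    simp only [hz, and_self, h4, Finset.sum_ite_eq', Finset.mem_univ, if_true, true_and]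
    set z := v.2 ∘ Fin.natAdd n
    set c := v.1 ∘ Fin.castAdd n + v.1 ∘ Fin.natAdd n
    have h5 : ∀ a : Fin n → ZMod p, chi (c ⬝ᵥ (a - (z + z - a))) =
        chi ((a - z) ⬝ᵥ (c + c)) := fun a => by
      rw [dotProduct_comm (a - z), add_dotProduct c c, ← dotProduct_add]
      congr 2
      abel
    simp only [h5]
    have h6 := (Equiv.subRight z).sum_comp (fun y => chi (y ⬝ᵥ (c + c)))
    simp only [Equiv.subRight_apply] at h6
    rw [h6, sum_chi_dotProduct]
    refine if_congr ?_ rfl rfl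
    nth_rw 1 [← add_zero (0 : Fin n → ZMod p)]
    rw [add_self_inj]
  · rw [if_neg fun h => hz h.1]
    refine Finset.sum_eq_zero fun a _ => Finset.sum_eq_zero fun b _ => if_neg fun h => hz ?_
    exact add_self_inj.1 (h.1.symm.trans h.2)

end Represents

/-! ### The symplectic form -/

section Form

variable {K : Type} [Field K]

theorem form_swap {n : ℕ} (v w : Phase K n) : Phase.form w v = -Phase.form v w := by
  simp only [Phase.form, dotProduct_comm w.1, dotProduct_comm w.2]
  ring

theorem form_add_left {n : ℕ} (u v w : Phase K n) :
    Phase.form (u + v) w = Phase.form u w + Phase.form v w := by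
  simp only [Phase.form, Prod.fst_add, Prod.snd_add, add_dotProduct]
  ring

theorem form_add_right {n : ℕ} (u v w : Phase K n) :
    Phase.form u (v + w) = Phase.form u v + Phase.form u w := by
  simp only [Phase.form, Prod.fst_add, Prod.snd_add, dotProduct_add]
  ring

theorem form_zero_left {n : ℕ} (w : Phase K n) : Phase.form 0 w = 0 := by
  simp [Phase.form]

theorem form_single_fst {n : ℕ} (i : Fin n) (w : Phase K n) :
    Phase.form ((Pi.single i 1, 0) : Phase K n) w = w.2 i := by
  simp [Phase.form]

theorem form_single_snd {n : ℕ} (i : Fin n) (w : Phase K n) :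
    Phase.form ((0, Pi.single i 1) : Phase K n) w = -w.1 i := by
  simp [Phase.form]

/-- Nondegeneracy of the form, tested on coordinate vectors. -/
theorem eq_zero_of_form {n : ℕ} {w : Phase K n} (h : ∀ v, Phase.form v w = 0) : w = 0 := by
  refine Prod.ext (funext fun i => ?_) (funext fun i => ?_)
  · have := h (0, Pi.single i 1)
    rw [form_single_snd] at this
    exact neg_eq_zero.1 this
  · have := h (Pi.single i 1, 0)
    rwa [form_single_fst] at this

end Form

/-! ### Weyl operators and the Pauli group -/

section Weyl

variable {p : ℕ} [Fact p.Prime]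

/-- The Weyl operator, the displacement by `v`. -/
noncomputable def weyl {n : ℕ} (v : Phase (ZMod p) n) : QMat p n n :=
  Matrix.of fun b a => if b = a + v.2 then chi ((2 : ZMod p)⁻¹ * (v.1 ⬝ᵥ (a + b))) else 0

theorem weyl_apply {n : ℕ} (v : Phase (ZMod p) n) (b a : Fin n → ZMod p) :
    weyl v b a = if b = a + v.2 then chi ((2 : ZMod p)⁻¹ * (v.1 ⬝ᵥ (a + b))) else 0 := rfl

theorem weyl_zero (n : ℕ) : weyl (0 : Phase (ZMod p) n) = 1 := by
  ext b a
  rw [weyl_apply, Matrix.one_apply]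
  simp only [Prod.fst_zero, Prod.snd_zero, add_zero, zero_dotProduct, mul_zero, chi_zero]

theorem inv_two_mul_add_self [NeZero (2 : ZMod p)] (a : ZMod p) : (2 : ZMod p)⁻¹ * (a + a) = a := by
  rw [← two_mul, inv_mul_cancel_left₀ (NeZero.ne _)]

/-- The factor one half in the phase of `weyl` symmetrizes the order of shift and boost. For this
reason the cocycle is exactly half of the symplectic form. -/
theorem weyl_mul_weyl [NeZero (2 : ZMod p)] {n : ℕ} (v w : Phase (ZMod p) n) :
    weyl v * weyl w = chi ((2 : ZMod p)⁻¹ * Phase.form v w) • weyl (v + w) := by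
  ext b a
  rw [Matrix.mul_apply, Matrix.smul_apply, Finset.sum_eq_single (a + w.2)]
  · rw [weyl_apply, weyl_apply, weyl_apply, if_pos rfl, add_assoc, add_comm w.2, Prod.snd_add,
      smul_eq_mul]
    by_cases h : b = a + (v.2 + w.2)
    · subst h
      rw [if_pos rfl, if_pos rfl, ← chi_add, ← chi_add, ← mul_add, ← mul_add]
      congr 2
      simp only [Phase.form, dotProduct_add, add_dotProduct, Prod.fst_add]
      rw [dotProduct_comm v.2 w.1]
      ring
    · rw [if_neg h, if_neg h, zero_mul, mul_zero]
  · intro c _ hc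
    rw [weyl_apply w, if_neg hc, mul_zero]
  · simp

theorem trace_weyl [NeZero (2 : ZMod p)] {n : ℕ} (v : Phase (ZMod p) n) :
    (weyl v).trace = if v = 0 then (p : ℂ) ^ n else 0 := by
  simp only [Matrix.trace, Matrix.diag, weyl_apply, left_eq_add]
  by_cases h : v.2 = 0
  · have h1 : ∀ x : Fin n → ZMod p, chi ((2 : ZMod p)⁻¹ * (v.1 ⬝ᵥ (x + x))) = chi (x ⬝ᵥ v.1) :=
      fun x => by rw [dotProduct_add, inv_two_mul_add_self, dotProduct_comm]
    simp only [h, if_true, h1, sum_chi_dotProduct]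
    exact if_congr ⟨fun h' => Prod.ext_iff.2 ⟨h', h⟩, fun h' => congrArg _ h'⟩ rfl rfl
  · simp only [h, if_false, Finset.sum_const_zero]
    rw [if_neg fun h' => h (congrArg _ h')]

/-- Weyl operators are trace-orthogonal: multiplying by `weyl (-v)` and taking the trace detects
both the label and the scalar. -/
theorem smul_weyl_eq_iff [NeZero (2 : ZMod p)] {n : ℕ} {v w : Phase (ZMod p) n} {c d : ℂ}
    (hc : c ≠ 0) (h : c • weyl v = d • weyl w) : v = w ∧ c = d := by
  have hp : (p : ℂ) ^ n ≠ 0 := pow_ne_zero _ (Nat.cast_ne_zero.2 (NeZero.ne p))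
  have h1 := congrArg (fun M => (M * weyl (-v)).trace) h
  simp only [Matrix.smul_mul, weyl_mul_weyl, smul_smul, Matrix.trace_smul, trace_weyl,
    add_neg_cancel, if_true, smul_eq_mul] at h1
  have h2 : w + -v = 0 := by
    by_contra h2
    rw [if_neg h2, mul_zero] at h1
    exact mul_ne_zero (mul_ne_zero hc (chi_ne_zero _)) hp h1
  have h3 : v = w := (add_neg_eq_zero.1 h2).symm
  subst h3
  refine ⟨rfl, ?_⟩
  rw [if_pos h2] at h1
  exact mul_right_cancel₀ (chi_ne_zero _) (mul_right_cancel₀ hp h1)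

/-- Two point reflections compose to a translation by twice the difference of their centres. This
recovers the Weyl operators from the point operators. -/
theorem pointOp_mul_pointOp [NeZero (2 : ZMod p)] {n : ℕ} (u v : Phase (ZMod p) n) :
    pointOp u * pointOp v = chi (-(Phase.form u v + Phase.form u v)) • weyl (u - v + (u - v)) := by
  ext b a
  rw [mul_pointOp_apply, pointOp_apply, Matrix.smul_apply, weyl_apply, smul_eq_mul]
  have : v.2 + v.2 - a + b = u.2 + u.2 ↔ b = a + (u - v + (u - v)).2 := by
    rw [← eq_sub_iff_add_eq', iff_iff_eq]
    congr 1
    simp only [Prod.snd_add, Prod.snd_sub]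
    abel
  by_cases h : b = a + (u - v + (u - v)).2
  · rw [if_pos (this.2 h), if_pos h, ← chi_add, ← chi_add]
    subst h
    congr 1
    simp only [Phase.form, dotProduct_add, add_dotProduct, dotProduct_sub, sub_dotProduct,
      Prod.fst_add, Prod.fst_sub, Prod.snd_add, Prod.snd_sub]
    rw [dotProduct_comm u.2 v.1]
    have h2 : (2 : ZMod p) ≠ 0 := NeZero.ne _
    field_simp
    ring
  · rw [if_neg h, if_neg fun h' => h (this.1 h'), zero_mul, mul_zero]

/-- Point operators are the symplectic Fourier transforms of the Weyl operators. In the entry `(b,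
a)` only `v.2 = b - a` contributes, and the character sum over `v.1` forces `a + b = 2 u.2`. The
identity carries the action of a Clifford operator from Weyl operators to point operators. -/
theorem sum_chi_form_smul_weyl [NeZero (2 : ZMod p)] {n : ℕ} (u : Phase (ZMod p) n) :
    ∑ v, chi (Phase.form u v) • weyl v = (p : ℂ) ^ n • pointOp u := by
  ext b a
  simp only [Matrix.sum_apply, Matrix.smul_apply, smul_eq_mul, weyl_apply, pointOp_apply, mul_ite,
    mul_zero]
  rw [Fintype.sum_prod_type]
  have : ∀ z : Fin n → ZMod p, b = a + z ↔ z = b - a := fun z => by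
    rw [eq_sub_iff_add_eq', eq_comm]
  simp only [this, Finset.sum_ite_eq', Finset.mem_univ, if_true, Phase.form, ← chi_add]
  have h1 : ∀ x : Fin n → ZMod p, chi (u.1 ⬝ᵥ (b - a) - u.2 ⬝ᵥ x + (2 : ZMod p)⁻¹ * (x ⬝ᵥ (a + b))) =
      chi (x ⬝ᵥ ((2 : ZMod p)⁻¹ • (a + b) - u.2)) * chi (u.1 ⬝ᵥ (b - a)) := fun x => by
    rw [← chi_add, dotProduct_sub x, dotProduct_smul, dotProduct_comm u.2, smul_eq_mul]
    congr 1
    ring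
  simp only [h1]
  rw [← Finset.sum_mul, sum_chi_dotProduct]
  have h2 : (2 : ZMod p)⁻¹ • (a + b) - u.2 = 0 ↔ a + b = u.2 + u.2 := by
    rw [eq_add_self_iff, sub_eq_zero, eq_comm]
  by_cases h : a + b = u.2 + u.2
  · rw [if_pos h, if_pos (h2.2 h)]
  · rw [if_neg h, if_neg fun h' => h (h2.1 h'), zero_mul]

/-! ### The Pauli group as the Weyl operators times powers of a root of unity -/

/-- The scalar which generates the centre of the Pauli group. -/
noncomputable def zeta (p : ℕ) : ℂ := Complex.exp (Real.pi * Complex.I / (p : ℂ))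

theorem zeta_ne_zero (p : ℕ) : zeta p ≠ 0 := Complex.exp_ne_zero _

theorem chi_natCast (k : ℕ) : chi (k : ZMod p) = Complex.exp (2 * Real.pi * Complex.I * k / p) := by
  have := ZMod.stdAddChar_coe (N := p) (k : ℤ)
  push_cast at this
  exact this

theorem chi_eq_zeta_pow (a : ZMod p) : ∃ k : ℕ, chi a = zeta p ^ k := by
  refine ⟨2 * a.val, ?_⟩
  conv_lhs => rw [← ZMod.natCast_zmod_val a, chi_natCast]
  rw [zeta, ← Complex.exp_nat_mul]
  congr 1
  push_cast
  ring

theorem zeta_pow_mod (p k : ℕ) [NeZero p] : zeta p ^ k = zeta p ^ (k % (2 * p)) := by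
  have : zeta p ^ (2 * p) = 1 := by
    rw [zeta, ← Complex.exp_nat_mul, ← Complex.exp_two_pi_mul_I]
    congr 1
    have : (p : ℂ) ≠ 0 := Nat.cast_ne_zero.2 (NeZero.ne p)
    push_cast
    field_simp
  conv_lhs => rw [← Nat.div_add_mod k (2 * p), pow_add, pow_mul, this, one_pow, one_mul]

theorem eq_update_iff {n : ℕ} {i : Fin n} {x y : Fin n → ZMod p} {c : ZMod p} :
    y = Function.update x i c ↔ (∀ k, k ≠ i → y k = x k) ∧ y i = c := by
  rw [Function.eq_update_iff, and_comm]

theorem add_single_eq_update {n : ℕ} (i : Fin n) (x : Fin n → ZMod p) (c : ZMod p) :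
    x + Pi.single i c = Function.update x i (x i + c) := by
  ext k
  by_cases h : k = i
  · subst h
    simp
  · simp [h]

theorem onWire_boostOp [NeZero (2 : ZMod p)] {n : ℕ} (i : Fin n) :
    onWire i (boostOp p) = weyl (0, Pi.single i 1) := by
  ext y x
  rw [weyl_apply]
  simp only [onWire, boostOp, Matrix.of_apply, zero_dotProduct, mul_zero, chi_zero,
    add_single_eq_update, eq_update_iff, ite_and]

theorem shiftOp_eq : shiftOp p = Matrix.diagonal fun a => chi a := by
  rw [shiftOp]
  congr 1
  funext a
  conv_rhs => rw [← ZMod.natCast_zmod_val a, chi_natCast]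

theorem onWire_shiftOp [NeZero (2 : ZMod p)] {n : ℕ} (i : Fin n) :
    onWire i (shiftOp p) = weyl (Pi.single i 1, 0) := by
  ext y x
  rw [weyl_apply, shiftOp_eq]
  simp only [onWire, Matrix.of_apply, Matrix.diagonal_apply, add_zero, single_one_dotProduct,
    ← ite_and]
  have h : (∀ k, k ≠ i → y k = x k) ∧ y i = x i ↔ y = x := by
    rw [← eq_update_iff, Function.update_eq_self]
  by_cases hyx : y = x
  · rw [if_pos (h.2 hyx), if_pos hyx, hyx, Pi.add_apply, inv_two_mul_add_self]
  · rw [if_neg fun h' => hyx (h.1 h'), if_neg hyx]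

/-- Elements of `ZMod p` are classes of natural numbers, so sums of coordinate vectors reach every
point. Closure under negation or scalars need not be known in advance. -/
theorem addSubmonoid_eq_top {n : ℕ} {S : AddSubmonoid (Phase (ZMod p) n)}
    (h1 : ∀ i, (Pi.single i 1, 0) ∈ S) (h2 : ∀ i, (0, Pi.single i 1) ∈ S)
    (v : Phase (ZMod p) n) : v ∈ S := by
  have : v = ∑ i, (v.1 i).val • ((Pi.single i 1, 0) : Phase (ZMod p) n) +
      ∑ i, (v.2 i).val • ((0, Pi.single i 1) : Phase (ZMod p) n) := by
    refine Prod.ext ?_ ?_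
    · ext j
      simp [Prod.fst_sum, Finset.sum_apply, Pi.single_apply, -ZMod.natCast_val, ZMod.natCast_zmod_val]
    · ext j
      simp [Prod.snd_sum, Finset.sum_apply, Pi.single_apply, -ZMod.natCast_val, ZMod.natCast_zmod_val]
  rw [this]
  exact add_mem (sum_mem fun i _ => nsmul_mem (h1 i) _) (sum_mem fun i _ => nsmul_mem (h2 i) _)

theorem zeta_pow_smul_mem_pauliGroup {n : ℕ} (k : ℕ) {M : QMat p n n} (h : M ∈ pauliGroup p n) :
    zeta p ^ k • M ∈ pauliGroup p n := by
  have h1 : zeta p • (1 : QMat p n n) ∈ pauliGroup p n :=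
    Submonoid.subset_closure (Or.inl (Or.inl rfl))
  have h2 := mul_mem (pow_mem h1 k) h
  rwa [smul_pow, one_pow, Matrix.smul_mul, Matrix.one_mul] at h2

theorem weyl_mem_pauliGroup [NeZero (2 : ZMod p)] {n : ℕ} (v : Phase (ZMod p) n) :
    weyl v ∈ pauliGroup p n := by
  let S : AddSubmonoid (Phase (ZMod p) n) :=
    { carrier := {v | weyl v ∈ pauliGroup p n}
      add_mem' := by
        intro v w hv hw
        -- The inverse of the cocycle is also a power of `zeta p`, so the phase can be removed
        -- within the group.
        obtain ⟨k, hk⟩ := chi_eq_zeta_pow (-((2 : ZMod p)⁻¹ * Phase.form v w))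
        have := zeta_pow_smul_mem_pauliGroup k (mul_mem hv hw)
        rwa [← hk, weyl_mul_weyl, smul_smul, ← chi_add, neg_add_cancel, chi_zero, one_smul] at this
      zero_mem' := by
        change weyl 0 ∈ pauliGroup p n
        rw [weyl_zero]
        exact one_mem _ }
  refine addSubmonoid_eq_top (S := S) (fun i => ?_) (fun i => ?_) v
  · exact Submonoid.subset_closure (Or.inr ⟨i, onWire_shiftOp i⟩)
  · exact Submonoid.subset_closure (Or.inl (Or.inr ⟨i, onWire_boostOp i⟩))

theorem mem_pauliGroup_iff [NeZero (2 : ZMod p)] {n : ℕ} {M : QMat p n n} :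
    M ∈ pauliGroup p n ↔ ∃ (k : ℕ) (v : Phase (ZMod p) n), M = zeta p ^ k • weyl v := by
  constructor
  · intro h
    induction h using Submonoid.closure_induction with
    | mem x hx =>
      rcases hx with (rfl | ⟨i, rfl⟩) | ⟨i, rfl⟩
      · exact ⟨1, 0, by rw [weyl_zero, pow_one]; rfl⟩
      · exact ⟨0, _, by rw [pow_zero, one_smul]; exact onWire_boostOp i⟩
      · exact ⟨0, _, by rw [pow_zero, one_smul]; exact onWire_shiftOp i⟩
    | one => exact ⟨0, 0, by rw [weyl_zero, pow_zero, one_smul]⟩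
    | mul x y _ _ hx hy =>
      obtain ⟨k, v, rfl⟩ := hx
      obtain ⟨l, w, rfl⟩ := hy
      obtain ⟨j, hj⟩ := chi_eq_zeta_pow ((2 : ZMod p)⁻¹ * Phase.form v w)
      refine ⟨k + l + j, v + w, ?_⟩
      rw [Matrix.smul_mul, Matrix.mul_smul, smul_smul, weyl_mul_weyl, smul_smul, hj, pow_add,
        pow_add]
  · rintro ⟨k, v, rfl⟩
    exact zeta_pow_smul_mem_pauliGroup k (weyl_mem_pauliGroup v)

/-- Exponents of `zeta p` matter only modulo `2 * p`. Finiteness later makes a one-sided inclusion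
enough for normalizing the group. -/
theorem finite_pauliGroup [NeZero (2 : ZMod p)] (n : ℕ) :
    (pauliGroup p n : Set (QMat p n n)).Finite := by
  refine (Set.finite_range fun kv : Fin (2 * p) × Phase (ZMod p) n =>
    zeta p ^ (kv.1 : ℕ) • weyl kv.2).subset ?_
  intro M hM
  obtain ⟨k, v, rfl⟩ := mem_pauliGroup_iff.1 hM
  exact ⟨(⟨k % (2 * p), Nat.mod_lt _ (Nat.mul_pos two_pos (NeZero.pos p))⟩, v),
    congrArg (· • weyl v) (zeta_pow_mod p k).symm⟩

/-! ### Clifford operators are the affine symplectomorphisms -/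

/-- Point operators span all matrices, so `X` commutes with everything and is scalar. -/
theorem eq_smul_one_of_commute_pointOp [NeZero (2 : ZMod p)] {n : ℕ} {X : QMat p n n}
    (h : ∀ u, X * pointOp u = pointOp u * X) : X = X 0 0 • (1 : QMat p n n) := by
  have hp : (p : ℂ) ^ n ≠ 0 := pow_ne_zero _ (Nat.cast_ne_zero.2 (NeZero.ne p))
  have h1 : ∀ Y : QMat p n n, Commute Y X := by
    intro Y
    refine smul_right_injective _ hp ?_
    change (p : ℂ) ^ n • _ = (p : ℂ) ^ n • _
    rw [← Matrix.smul_mul, ← Matrix.mul_smul, ← sum_trace_smul_pointOp]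
    simp only [Matrix.mul_sum, Matrix.sum_mul, Matrix.mul_smul, Matrix.smul_mul, h]
  obtain ⟨c, rfl⟩ := Matrix.mem_range_scalar_of_commute_single fun i j _ => h1 (Matrix.single i j 1)
  rw [Matrix.scalar_apply, Matrix.diagonal_apply_eq, Matrix.smul_one_eq_diagonal]

/-- Point operators are Hermitian, so `U† U` commutes with all of them and is scalar by Schur's
argument. The norm of one column identifies the scalar, which spares a full unitarity check for each
gate. -/
theorem conjTranspose_mul_self_of_intertwines [NeZero (2 : ZMod p)] {n : ℕ} {U : QMat p n n}
    {g : Phase (ZMod p) n → Phase (ZMod p) n} (h : ∀ v, U * pointOp v = pointOp (g v) * U)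
    (h1 : ∑ y, star (U y 0) * U y 0 = 1) : U.conjTranspose * U = 1 := by
  have h2 : ∀ v, U.conjTranspose * pointOp (g v) = pointOp v * U.conjTranspose := fun v => by
    have := congrArg Matrix.conjTranspose (h v)
    rw [Matrix.conjTranspose_mul, Matrix.conjTranspose_mul, conjTranspose_pointOp,
      conjTranspose_pointOp] at this
    exact this.symm
  rw [eq_smul_one_of_commute_pointOp (X := U.conjTranspose * U) fun v => by
    rw [Matrix.mul_assoc, h, ← Matrix.mul_assoc, h2, Matrix.mul_assoc]]
  simp only [Matrix.mul_apply, Matrix.conjTranspose_apply, h1, one_smul]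

/-- Nothing about `g` is assumed: products of two point operators are Weyl operators up to phase and
every Weyl operator arises in this way. Permuting point operators therefore suffices to preserve the
Pauli group. -/
theorem isClifford_of_intertwines [NeZero (2 : ZMod p)] {n : ℕ} {U : QMat p n n}
    {g : Phase (ZMod p) n → Phase (ZMod p) n} (h : ∀ v, U * pointOp v = pointOp (g v) * U)
    (hU : U.conjTranspose * U = 1) : IsClifford U := by
  have hU' : U * U.conjTranspose = 1 := mul_eq_one_comm.1 hU
  have h1 : ∀ v, U * pointOp v * U.conjTranspose = pointOp (g v) := fun v => by
    rw [h, Matrix.mul_assoc, hU', Matrix.mul_one]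
  have h2 : ∀ P Q : QMat p n n, U * (P * Q) * U.conjTranspose =
      (U * P * U.conjTranspose) * (U * Q * U.conjTranspose) := fun P Q => by
    rw [Matrix.mul_assoc (U * P), ← Matrix.mul_assoc U.conjTranspose,
      ← Matrix.mul_assoc U.conjTranspose, hU, Matrix.one_mul]
    simp only [Matrix.mul_assoc]
  have hinj : Function.Injective fun P : QMat p n n => U * P * U.conjTranspose := by
    intro P Q hPQ
    have h3 : ∀ P : QMat p n n, U.conjTranspose * (U * P * U.conjTranspose) * U = P := fun P => by
      rw [← Matrix.mul_assoc, ← Matrix.mul_assoc, hU, Matrix.one_mul, Matrix.mul_assoc, hU,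
        Matrix.mul_one]
    rw [← h3 P, ← h3 Q]
    exact congrArg (fun P => U.conjTranspose * P * U) hPQ
  refine ⟨Matrix.mem_unitaryGroup_iff'.2 hU, ?_⟩
  -- Conjugation is injective and the Pauli group is finite, so the inclusion of the image is an
  -- equality.
  refine Set.eq_of_subset_of_ncard_le ?_ (Set.ncard_image_of_injective _ hinj).ge
    (finite_pauliGroup n)
  rintro _ ⟨P, hP, rfl⟩
  obtain ⟨k, v, rfl⟩ := mem_pauliGroup_iff.1 hP
  -- A translation by `v` is the reflection in the origin followed by the reflection in `v / 2`.
  have h4 : weyl v = pointOp ((2 : ZMod p)⁻¹ • v) * pointOp 0 := by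
    rw [pointOp_mul_pointOp, form_swap, form_zero_left, neg_zero, add_zero, neg_zero, chi_zero,
      one_smul, sub_zero, ← two_smul (ZMod p), smul_smul, mul_inv_cancel₀ (NeZero.ne _), one_smul]
  obtain ⟨j, hj⟩ := chi_eq_zeta_pow (-(Phase.form (g ((2 : ZMod p)⁻¹ • v)) (g 0) +
    Phase.form (g ((2 : ZMod p)⁻¹ • v)) (g 0)))
  refine mem_pauliGroup_iff.2 ⟨k + j,
    g ((2 : ZMod p)⁻¹ • v) - g 0 + (g ((2 : ZMod p)⁻¹ • v) - g 0), ?_⟩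
  rw [pow_add, ← smul_smul, ← hj, ← pointOp_mul_pointOp, ← h1, ← h1, ← h2, ← h4]
  simp only [Matrix.mul_smul, Matrix.smul_mul]

/-- Nondegeneracy makes the map from points to characters injective. A finite abelian group has as
many complex characters as elements, so every character is attained. -/
theorem exists_chi_form {n : ℕ} (ψ : AddChar (Phase (ZMod p) n) ℂ) :
    ∃ t : Phase (ZMod p) n, ∀ v, ψ v = chi (Phase.form t v) := by
  let f (t : Phase (ZMod p) n) : AddChar (Phase (ZMod p) n) ℂ :=
    { toFun := fun v => chi (Phase.form t v)
      map_zero_eq_one' := by rw [form_swap, form_zero_left, neg_zero, chi_zero]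
      map_add_eq_mul' := fun v w => by rw [form_add_right, chi_add] }
  have hf : Function.Injective f := by
    intro s t hst
    have h1 : ∀ v, Phase.form s v = Phase.form t v := fun v =>
      ZMod.injective_stdAddChar (DFunLike.congr_fun hst v)
    rw [← sub_eq_zero]
    refine eq_zero_of_form fun v => ?_
    have h2 := form_add_left (s - t) t v
    rw [sub_add_cancel, h1, right_eq_add] at h2
    rw [form_swap, h2, neg_zero]
  have hf' := (Fintype.bijective_iff_injective_and_card f).2 ⟨hf, AddChar.card_eq.symm⟩
  obtain ⟨t, rfl⟩ := hf'.2 ψ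
  exact ⟨t, fun v => rfl⟩

/-- Conjugation sends `weyl v` to `θ v • weyl (S v)`. Multiplicativity makes `S` additive, hence
linear over the prime field. Comparing the products in both orders makes `S` symplectic. The
cocycles then cancel, `θ` is a character, and a character is a displacement by some `t`. The Fourier
transform carries this to point operators. -/
theorem IsClifford.exists_intertwines [NeZero (2 : ZMod p)] {n : ℕ} {U : QMat p n n}
    (hU : IsClifford U) : ∃ (S : Phase (ZMod p) n →ₗ[ZMod p] Phase (ZMod p) n) (t : Phase (ZMod p) n),
      (∀ v w, Phase.form (S v) (S w) = Phase.form v w) ∧ Function.Bijective S ∧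
      ∀ v, U * pointOp v = pointOp (S v + t) * U := by
  have hUU : U.conjTranspose * U = 1 := Matrix.mem_unitaryGroup_iff'.1 hU.1
  have h2 : ∀ P Q : QMat p n n, U * (P * Q) * U.conjTranspose =
      (U * P * U.conjTranspose) * (U * Q * U.conjTranspose) := fun P Q => by
    rw [Matrix.mul_assoc (U * P), ← Matrix.mul_assoc U.conjTranspose,
      ← Matrix.mul_assoc U.conjTranspose, hUU, Matrix.one_mul]
    simp only [Matrix.mul_assoc]
  have hex : ∀ v : Phase (ZMod p) n, ∃ (c : ℂ) (w : Phase (ZMod p) n), c ≠ 0 ∧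
      U * weyl v * U.conjTranspose = c • weyl w := fun v => by
    have h3 : U * weyl v * U.conjTranspose ∈ (pauliGroup p n : Set (QMat p n n)) := by
      rw [← hU.2]
      exact ⟨weyl v, weyl_mem_pauliGroup v, rfl⟩
    obtain ⟨k, w, hw⟩ := mem_pauliGroup_iff.1 h3
    exact ⟨_, w, pow_ne_zero k (zeta_ne_zero p), hw⟩
  choose θ S hθ hS using hex
  have hmul : ∀ v w, S v + S w = S (v + w) ∧
      θ v * θ w * chi ((2 : ZMod p)⁻¹ * Phase.form (S v) (S w)) =
        chi ((2 : ZMod p)⁻¹ * Phase.form v w) * θ (v + w) := fun v w => by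
    have h3 := h2 (weyl v) (weyl w)
    rw [weyl_mul_weyl, Matrix.mul_smul, Matrix.smul_mul, hS, hS, hS, Matrix.smul_mul,
      Matrix.mul_smul, weyl_mul_weyl, smul_smul, smul_smul, smul_smul] at h3
    exact smul_weyl_eq_iff (mul_ne_zero (mul_ne_zero (hθ v) (hθ w)) (chi_ne_zero _)) h3.symm
  have hform : ∀ v w, Phase.form (S v) (S w) = Phase.form v w := fun v w => by
    have h3 := (hmul v w).2
    have h4 := (hmul w v).2
    rw [form_swap (S v), form_swap v, add_comm w, mul_comm (θ w), mul_neg, mul_neg] at h4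
    -- The two orders of multiplication differ only in the signs of the cocycles. Eliminating `θ`
    -- leaves a character value equal to its inverse, with half the difference of the forms in the
    -- exponent.
    have h5 : chi ((2 : ZMod p)⁻¹ * Phase.form (S v) (S w) + -((2 : ZMod p)⁻¹ * Phase.form v w)) =
        chi (-((2 : ZMod p)⁻¹ * Phase.form (S v) (S w)) + (2 : ZMod p)⁻¹ * Phase.form v w) := by
      rw [chi_add, chi_add]
      refine mul_right_cancel₀ (mul_ne_zero (mul_ne_zero (hθ v) (hθ w)) (hθ (v + w))) ?_
      linear_combination chi (-((2 : ZMod p)⁻¹ * Phase.form v w)) * θ (v + w) * h3 -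
        chi ((2 : ZMod p)⁻¹ * Phase.form v w) * θ (v + w) * h4
    have h6 := ZMod.injective_stdAddChar h5
    have h7 := inv_two_mul_add_self (Phase.form (S v) (S w))
    have h8 := inv_two_mul_add_self (Phase.form v w)
    linear_combination h6 - h7 + h8
  have hθmul : ∀ v w, θ (v + w) = θ v * θ w := fun v w => by
    have h3 := (hmul v w).2
    rw [hform, mul_comm] at h3
    exact (mul_left_cancel₀ (chi_ne_zero _) h3).symm
  have hS0 : S 0 = 0 := by
    have := (hmul 0 0).1
    rwa [add_zero, add_eq_left] at this
  let S' : Phase (ZMod p) n →ₗ[ZMod p] Phase (ZMod p) n := AddMonoidHom.toZModLinearMap p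
    { toFun := S
      map_zero' := hS0
      map_add' := fun v w => (hmul v w).1.symm }
  have hinj : Function.Injective S' := by
    rw [← LinearMap.ker_eq_bot, LinearMap.ker_eq_bot']
    intro v hv
    refine eq_zero_of_form fun w => ?_
    rw [← hform]
    change Phase.form _ (S' v) = 0
    rw [hv, form_swap, form_zero_left, neg_zero]
  have hbij : Function.Bijective S' := Finite.injective_iff_bijective.1 hinj
  -- The character is transported along the inverse of `S`, so that `t` pairs with the image vector
  -- and can be added to `S' u` below.
  obtain ⟨t, ht⟩ : ∃ t : Phase (ZMod p) n, ∀ v, θ v = chi (Phase.form t (S v)) := by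
    let e : Phase (ZMod p) n ≃ₗ[ZMod p] Phase (ZMod p) n := LinearEquiv.ofBijective S' hbij
    let ψ : AddChar (Phase (ZMod p) n) ℂ :=
      { toFun := fun v => θ (e.symm v)
        map_zero_eq_one' := by
          rw [map_zero]
          have := hθmul 0 0
          rw [add_zero] at this
          exact mul_left_cancel₀ (hθ 0) (by rw [← this, mul_one])
        map_add_eq_mul' := fun v w => by rw [map_add, hθmul] }
    obtain ⟨t, ht⟩ := exists_chi_form ψ
    refine ⟨t, fun v => ?_⟩
    rw [← ht]
    change θ v = θ (e.symm (e v))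
    rw [LinearEquiv.symm_apply_apply]
  refine ⟨S', t, hform, hbij, fun u => ?_⟩
  have hp : (p : ℂ) ^ n ≠ 0 := pow_ne_zero _ (Nat.cast_ne_zero.2 (NeZero.ne p))
  -- Both sides are expanded in Weyl operators, with the right-hand sum reindexed by `S'`. The phase
  -- `θ v` shifts the frequency from `S' u` to `S' u + t`.
  have h5 : U * pointOp u * U.conjTranspose = pointOp (S' u + t) := by
    refine smul_right_injective _ hp ?_
    change (p : ℂ) ^ n • _ = (p : ℂ) ^ n • _
    rw [← Matrix.smul_mul, ← Matrix.mul_smul, ← sum_chi_form_smul_weyl, ← sum_chi_form_smul_weyl,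
      ← hbij.sum_comp fun v => chi (Phase.form (S' u + t) v) • weyl v, Matrix.mul_sum, Matrix.sum_mul]
    refine Finset.sum_congr rfl fun v _ => ?_
    rw [Matrix.mul_smul, Matrix.smul_mul, hS, smul_smul, ht, ← hform, ← chi_add, ← form_add_left]
    rfl
  rw [← h5, Matrix.mul_assoc _ U.conjTranspose, hUU, Matrix.mul_one]

end Weyl

/-! ### The generating gates -/

section Gates

variable {p : ℕ} [Fact p.Prime]

theorem dotProduct_eq_add_sum_erase {n : ℕ} (i : Fin n) (x w : Fin n → ZMod p) :
    x ⬝ᵥ w = x i * w i + ∑ k ∈ Finset.univ.erase i, x k * w k :=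
  (Finset.add_sum_erase _ _ (Finset.mem_univ i)).symm

/-- The functions `X` and `Z` give the coordinates of the image point on the active wire, where `hU`
is the entrywise intertwining relation. On the other wires both sides have the same support, and
there the two phases agree. -/
theorem onWire_intertwines {U : Matrix (ZMod p) (ZMod p) ℂ} {X Z : ZMod p → ZMod p → ZMod p}
    (hU : ∀ x z a b, U b (z + z - a) * chi (x * (z + z - a - a)) =
      chi (X x z * (b - (Z x z + Z x z - b))) * U (Z x z + Z x z - b) a)
    {n : ℕ} (i : Fin n) (v : Phase (ZMod p) n) :
    onWire i U * pointOp v = pointOp (Function.update v.1 i (X (v.1 i) (v.2 i)),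
      Function.update v.2 i (Z (v.1 i) (v.2 i))) * onWire i U := by
  ext b a
  rw [mul_pointOp_apply, pointOp_mul_apply]
  simp only [onWire, Matrix.of_apply, Pi.add_apply, Pi.sub_apply, Function.update_self]
  have h : (∀ k, k ≠ i → b k = v.2 k + v.2 k - a k) ↔ ∀ k, k ≠ i →
      Function.update v.2 i (Z (v.1 i) (v.2 i)) k + Function.update v.2 i (Z (v.1 i) (v.2 i)) k -
        b k = a k := by
    refine forall₂_congr fun k hk => ?_
    rw [Function.update_of_ne hk, sub_eq_iff_eq_add', eq_sub_iff_add_eq, eq_comm]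
  by_cases hb : ∀ k, k ≠ i → b k = v.2 k + v.2 k - a k
  · rw [if_pos hb, if_pos (h.1 hb), dotProduct_eq_add_sum_erase i, dotProduct_eq_add_sum_erase i,
      chi_add, chi_add]
    simp only [Pi.sub_apply, Pi.add_apply, Function.update_self]
    have hrest : ∑ k ∈ Finset.univ.erase i, v.1 k * (v.2 k + v.2 k - a k - a k) =
        ∑ k ∈ Finset.univ.erase i, Function.update v.1 i (X (v.1 i) (v.2 i)) k *
          (b k - (Function.update v.2 i (Z (v.1 i) (v.2 i)) k +
            Function.update v.2 i (Z (v.1 i) (v.2 i)) k - b k)) := by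
      refine Finset.sum_congr rfl fun k hk => ?_
      rw [Function.update_of_ne (Finset.ne_of_mem_erase hk),
        Function.update_of_ne (Finset.ne_of_mem_erase hk), hb k (Finset.ne_of_mem_erase hk)]
      ring
    rw [hrest, ← mul_assoc, hU, mul_right_comm]
  · rw [if_neg hb, if_neg fun h' => hb (h.2 h'), zero_mul, mul_zero]

theorem sum_star_onWire {U : Matrix (ZMod p) (ZMod p) ℂ} {n : ℕ} (i : Fin n) :
    ∑ y, star (onWire i U y 0) * onWire i U y 0 = ∑ t, star (U t 0) * U t 0 := by
  refine (Fintype.sum_of_injective (fun t => (Pi.single i t : Fin n → ZMod p))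
    (Pi.single_injective (M := fun _ => ZMod p) i) _ _ (fun y hy => ?_) fun t => ?_).symm
  · simp only [onWire, Matrix.of_apply]
    rw [if_neg, star_zero, zero_mul]
    intro h
    refine hy ⟨y i, funext fun k => ?_⟩
    by_cases hk : k = i
    · subst hk
      simp
    · rw [h k hk]
      simp [hk]
  · simp only [onWire, Matrix.of_apply, Pi.single_eq_same, Pi.zero_apply]
    have h : ∀ k, k ≠ i → (Pi.single i t : Fin n → ZMod p) k = 0 := fun k hk =>
      Pi.single_eq_of_ne hk _
    rw [if_pos h]

theorem boostOp_intertwines (x z a b : ZMod p) :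
    boostOp p b (z + z - a) * chi (x * (z + z - a - a)) =
      chi (x * (b - (z + 1 + (z + 1) - b))) * boostOp p (z + 1 + (z + 1) - b) a := by
  simp only [boostOp, Matrix.of_apply]
  by_cases h : b = z + z - a + 1
  · subst h
    rw [if_pos rfl, if_pos (by ring), one_mul, mul_one]
    congr 2
    ring
  · rw [if_neg h, if_neg, zero_mul, mul_zero]
    intro h'
    exact h (by linear_combination -h')

theorem fourierOp_apply (b a : ZMod p) :
    fourierOp p b a = (1 / (Real.sqrt (p : ℝ) : ℂ)) * chi (a * b) := by
  rw [fourierOp, Matrix.of_apply]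
  congr 1
  conv_rhs => rw [← ZMod.natCast_zmod_val a, ← ZMod.natCast_zmod_val b, ← Nat.cast_mul, chi_natCast]
  push_cast
  rfl

theorem fourierOp_intertwines (x z a b : ZMod p) :
    fourierOp p b (z + z - a) * chi (x * (z + z - a - a)) =
      chi (z * (b - (-x + -x - b))) * fourierOp p (-x + -x - b) a := by
  rw [fourierOp_apply, fourierOp_apply, mul_assoc, mul_left_comm (chi _), ← chi_add, ← chi_add]
  congr 2
  ring

/-- For odd `p` the number `a (a + p)` is even. The phase is thus a power of the `p`-th root of
unity, and its exponent is half of `a * a` modulo `p`. -/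
theorem phaseOp_eq [NeZero (2 : ZMod p)] :
    phaseOp p = Matrix.diagonal fun a => chi ((2 : ZMod p)⁻¹ * (a * a)) := by
  have h2 : (2 : ZMod p) ≠ 0 := NeZero.ne _
  have hp : (p : ℂ) ≠ 0 := Nat.cast_ne_zero.2 (NeZero.ne p)
  have hodd : Odd p := by
    refine (Fact.out : p.Prime).odd_of_ne_two ?_
    intro h
    apply h2
    exact_mod_cast (ZMod.natCast_eq_zero_iff 2 p).2 h.dvd
  rw [phaseOp]
  congr 1
  funext a
  obtain ⟨t, ht⟩ : Even (a.val * (a.val + p)) := by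
    rcases Nat.even_or_odd a.val with h | h
    · exact h.mul_right _
    · exact (h.add_odd hodd).mul_left _
  have h1 : (2 : ZMod p)⁻¹ * (a * a) = (t : ZMod p) := by
    have h3 := congrArg (Nat.cast : ℕ → ZMod p) ht
    push_cast at h3
    rw [ZMod.natCast_zmod_val, ZMod.natCast_self, add_zero] at h3
    rw [h3, inv_two_mul_add_self]
  rw [h1, chi_natCast]
  have h4 := congrArg (Nat.cast : ℕ → ℂ) ht
  push_cast at h4
  rw [h4]
  congr 1
  ring

theorem phaseOp_intertwines [NeZero (2 : ZMod p)] (x z a b : ZMod p) :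
    phaseOp p b (z + z - a) * chi (x * (z + z - a - a)) =
      chi ((x + z) * (b - (z + z - b))) * phaseOp p (z + z - b) a := by
  rw [phaseOp_eq, Matrix.diagonal_apply, Matrix.diagonal_apply]
  by_cases h : b = z + z - a
  · subst h
    have h2 : (2 : ZMod p) ≠ 0 := NeZero.ne _
    rw [if_pos rfl, if_pos (by ring), ← chi_add, ← chi_add]
    congr 1
    field_simp
    ring
  · rw [if_neg h, if_neg, zero_mul, mul_zero]
    intro h'
    exact h (by linear_combination -h')

theorem onWires_controlledBoostOp {n : ℕ} {i j : Fin n} (hij : i ≠ j) (y x : Fin n → ZMod p) :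
    onWires i j (controlledBoostOp p) y x = if y = x + Pi.single j (x i) then 1 else 0 := by
  simp only [onWires, controlledBoostOp, Matrix.of_apply, Prod.mk.injEq, ← ite_and]
  refine if_congr ?_ rfl rfl
  rw [add_single_eq_update, eq_update_iff, add_comm (x j)]
  constructor
  · rintro ⟨h1, h2, h3⟩
    refine ⟨fun k hk => ?_, h3⟩
    by_cases hki : k = i
    · rw [hki, h2]
    · exact h1 k hki hk
  · rintro ⟨h1, h2⟩
    exact ⟨fun k _ hk => h1 k hk, h1 i hij, h2⟩

/-- The gate permutes basis vectors by the linear map `a ↦ a + a_i e_j`. The `Z`-grading transforms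
by this map and the `X`-grading by its inverse transpose, which accounts for `x_i - x_j`. -/
theorem controlledBoostOp_intertwines {n : ℕ} {i j : Fin n} (hij : i ≠ j) (v : Phase (ZMod p) n) :
    onWires i j (controlledBoostOp p) * pointOp v =
      pointOp (Function.update v.1 i (v.1 i - v.1 j), Function.update v.2 j (v.2 j + v.2 i)) *
        onWires i j (controlledBoostOp p) := by
  ext b a
  rw [mul_pointOp_apply, pointOp_mul_apply, onWires_controlledBoostOp hij,
    onWires_controlledBoostOp hij]
  simp only [← add_single_eq_update, sub_eq_add_neg (v.1 i)]
  have hL : ∀ x y : ZMod p, (Pi.single j (x - y) : Fin n → ZMod p) =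
      Pi.single j x - Pi.single j y := fun x y => Pi.single_sub (f := fun _ => ZMod p) j x y
  have hL' : ∀ x y : ZMod p, (Pi.single j (x + y) : Fin n → ZMod p) =
      Pi.single j x + Pi.single j y := fun x y => Pi.single_add (f := fun _ => ZMod p) j x y
  by_cases h : b = v.2 + v.2 - a + Pi.single j ((v.2 + v.2 - a) i)
  · rw [if_pos h, if_pos, one_mul, mul_one]
    · congr 1
      have h1 : b - (v.2 + Pi.single j (v.2 i) + (v.2 + Pi.single j (v.2 i)) - b) =
          (v.2 + v.2 - a - a) + Pi.single j ((v.2 + v.2 - a - a) i) := by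
        rw [h]
        simp only [Pi.sub_apply, Pi.add_apply, hL, hL']
        abel
      rw [h1, add_dotProduct, dotProduct_add, dotProduct_add, dotProduct_single,
        single_dotProduct, single_dotProduct, Pi.single_eq_of_ne hij]
      ring
    · rw [h]
      simp only [Pi.sub_apply, Pi.add_apply, hL, hL']
      abel
  · rw [if_neg h, if_neg, zero_mul, mul_zero]
    intro h'
    apply h
    simp only [Pi.sub_apply, Pi.add_apply, hL, hL'] at h' ⊢
    rw [sub_eq_iff_eq_add'] at h'
    rw [← sub_eq_iff_eq_add.2 h']
    abel

namespace GatePair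

variable [NeZero (2 : ZMod p)] {n : ℕ} {g : Phase (ZMod p) n → Phase (ZMod p) n} {U : QMat p n n}

theorem intertwines (h : GatePair p g U) (v : Phase (ZMod p) n) :
    U * pointOp v = pointOp (g v) * U := by
  cases h with
  | boost i =>
    have := onWire_intertwines (X := fun x _ => x) (Z := fun _ z => z + 1)
      boostOp_intertwines i v
    rwa [Function.update_eq_self] at this
  | fourier i =>
    exact onWire_intertwines (X := fun _ z => z) (Z := fun x _ => -x) fourierOp_intertwines i v
  | phase i =>
    have := onWire_intertwines (X := fun x z => x + z) (Z := fun _ z => z)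
      phaseOp_intertwines i v
    rwa [Function.update_eq_self] at this
  | control i j hij => exact controlledBoostOp_intertwines hij v

theorem conjTranspose_mul_self (h : GatePair p g U) : U.conjTranspose * U = 1 := by
  refine conjTranspose_mul_self_of_intertwines h.intertwines ?_
  cases h with
  | boost i =>
    rw [sum_star_onWire]
    simp [boostOp]
  | fourier i =>
    rw [sum_star_onWire]
    have hp : (0 : ℝ) < p := Nat.cast_pos.2 (NeZero.pos p)
    have h1 : ((Real.sqrt p : ℝ) : ℂ) * (Real.sqrt p : ℝ) = p := by
      rw [← Complex.ofReal_mul, Real.mul_self_sqrt hp.le, Complex.ofReal_natCast]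
    have h2 : (p : ℂ) ≠ 0 := Nat.cast_ne_zero.2 (NeZero.ne p)
    simp only [fourierOp_apply, zero_mul, chi_zero, mul_one, Finset.sum_const, Finset.card_univ,
      ZMod.card, nsmul_eq_mul, one_div, star_inv₀, Complex.star_def, Complex.conj_ofReal]
    rw [← mul_inv, h1, mul_inv_cancel₀ h2]
  | phase i =>
    rw [sum_star_onWire, phaseOp_eq]
    simp [Matrix.diagonal_apply]
  | control i j hij =>
    simp [onWires_controlledBoostOp hij]

theorem isClifford (h : GatePair p g U) : IsClifford U :=
  isClifford_of_intertwines h.intertwines h.conjTranspose_mul_self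

theorem represents (h : GatePair p g U) : Represents U (relGraph g) :=
  represents_relGraph (mul_eq_one_comm.1 h.conjTranspose_mul_self) h.intertwines

end GatePair

end Gates

/-! ### Affine Lagrangian relations are cosets of Lagrangian relations -/

section Symplectic

variable {K : Type} [Field K]

theorem form_sub_left {n : ℕ} (u v w : Phase K n) :
    Phase.form (u - v) w = Phase.form u w - Phase.form v w := by
  rw [eq_sub_iff_add_eq, ← form_add_left, sub_add_cancel]

theorem form_smul_right {n : ℕ} (c : K) (v w : Phase K n) :
    Phase.form v (c • w) = c * Phase.form v w := by
  simp only [Phase.form, Prod.smul_fst, Prod.smul_snd, dotProduct_smul, smul_eq_mul]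
  ring

/-- The symplectic form as a linear functional of its second argument. -/
def formLin {n : ℕ} (v : Phase K n) : Phase K n →ₗ[K] K where
  toFun w := Phase.form v w
  map_add' := form_add_right v
  map_smul' c w := form_smul_right c v w

theorem exists_form_eq {n : ℕ} (f : Phase K n →ₗ[K] K) : ∃ t, ∀ v, f v = Phase.form t v := by
  refine ⟨(fun i => f (0, Pi.single i 1), fun i => -f (Pi.single i 1, 0)), fun v => ?_⟩
  have hv : v = ∑ i, v.1 i • ((Pi.single i 1, 0) : Phase K n) +
      ∑ i, v.2 i • ((0, Pi.single i 1) : Phase K n) := by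
    refine Prod.ext (funext fun j => ?_) (funext fun j => ?_)
    · simp [Prod.fst_sum, Finset.sum_apply, Pi.single_apply]
    · simp [Prod.snd_sum, Finset.sum_apply, Pi.single_apply]
  conv_lhs => rw [hv]
  rw [map_add, map_sum, map_sum]
  simp only [map_smul, smul_eq_mul, Phase.form, dotProduct, neg_mul, Finset.sum_neg_distrib,
    sub_neg_eq_add]
  rw [add_comm]
  simp only [mul_comm]

theorem form_eq_add_pull {a c : ℕ} (v w : Phase K (a + c)) :
    Phase.form v w = Phase.form (v.pull (Fin.castAdd c)) (w.pull (Fin.castAdd c)) +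
      Phase.form (v.pull (Fin.natAdd a)) (w.pull (Fin.natAdd a)) := by
  simp only [Phase.form, Phase.pull, dotProduct, Fin.sum_univ_add, Function.comp_apply]
  ring

/-- The composite of linear relations, as a subspace. -/
def compSubmodule {A B C : Type} [AddCommGroup A] [Module K A] [AddCommGroup B] [Module K B]
    [AddCommGroup C] [Module K C] (R : Submodule K (A × B)) (S : Submodule K (B × C)) :
    Submodule K (A × C) where
  carrier := relComp (R : Set (A × B)) (S : Set (B × C))
  add_mem' := fun ⟨u, h, k⟩ ⟨u', h', k'⟩ => ⟨u + u', R.add_mem h h', S.add_mem k k'⟩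
  zero_mem' := ⟨0, R.zero_mem, S.zero_mem⟩
  smul_mem' c _ := fun ⟨u, h, k⟩ => ⟨c • u, R.smul_mem c h, S.smul_mem c k⟩

/-- Isotropy is immediate. For maximality let `(v, w)` be orthogonal to the composite. The
functional `(r, s) ↦ [w, s.2] - [v, r.1]` on `R × S` vanishes where `r.2 = s.1`, so by
finite-dimensional duality it factors through `r.2 - s.1`. It is then given by pairing with a vector
`t`, which supplies the intermediate point. -/
theorem IsLagrangian.comp {a b c : ℕ} {R : Submodule K (Phase K a × Phase K b)}
    {S : Submodule K (Phase K b × Phase K c)} (hR : IsLagrangian R) (hS : IsLagrangian S) :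
    IsLagrangian (compSubmodule R S) := by
  rintro ⟨v, w⟩
  constructor
  · rintro ⟨u, h, k⟩ ⟨v', w'⟩ ⟨u', h', k'⟩
    have h1 := (hR _).1 h _ h'
    have h2 := (hS _).1 k _ k'
    simp only at h1 h2 ⊢
    linear_combination h1 + h2
  · intro H
    let P : Submodule K ((Phase K a × Phase K b) × (Phase K b × Phase K c)) := R.prod S
    let δ : P →ₗ[K] Phase K b := (LinearMap.snd K _ _ ∘ₗ LinearMap.fst K _ _ -
      LinearMap.fst K _ _ ∘ₗ LinearMap.snd K _ _) ∘ₗ P.subtype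
    let φ : P →ₗ[K] K := (formLin w ∘ₗ LinearMap.snd K _ _ ∘ₗ LinearMap.snd K _ _ -
      formLin v ∘ₗ LinearMap.fst K _ _ ∘ₗ LinearMap.fst K _ _) ∘ₗ P.subtype
    have hφ : φ ∈ LinearMap.range δ.dualMap := by
      rw [LinearMap.range_dualMap_eq_dualAnnihilator_ker, Submodule.mem_dualAnnihilator]
      rintro ⟨⟨⟨v', u⟩, ⟨u', w'⟩⟩, h, k⟩ h0
      have h0' : u = u' := sub_eq_zero.1 (LinearMap.mem_ker.1 h0)
      subst h0'
      exact H (v', w') ⟨u, h, k⟩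
    obtain ⟨f, hf⟩ := hφ
    obtain ⟨t, ht⟩ := exists_form_eq f
    have key : ∀ r ∈ R, ∀ s ∈ S, Phase.form t (r.2 - s.1) =
        Phase.form w s.2 - Phase.form v r.1 := fun r hr s hs => by
      rw [← ht]
      exact LinearMap.congr_fun hf ⟨(r, s), hr, hs⟩
    -- Setting `s = 0` or `r = 0` in `key` decouples the conditions. The sign of `t` comes from the
    -- opposite signs of source and target in the form.
    refine ⟨-t, (hR _).2 fun r hr => ?_, (hS _).2 fun s hs => ?_⟩
    · have := key r hr 0 S.zero_mem
      simp only [Prod.fst_zero, Prod.snd_zero, sub_zero] at this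
      rw [show Phase.form w 0 = 0 by rw [form_swap, form_zero_left, neg_zero]] at this
      rw [← zero_sub t, form_sub_left, form_zero_left, this]
      ring
    · have := key 0 R.zero_mem s hs
      simp only [Prod.fst_zero, Prod.snd_zero, zero_sub] at this
      rw [show Phase.form v 0 = 0 by rw [form_swap, form_zero_left, neg_zero],
        form_swap, ← zero_sub s.1, form_sub_left, form_zero_left, form_swap t] at this
      simp only
      rw [← zero_sub t, form_sub_left, form_zero_left]
      linear_combination -this

/-- The direct sum of linear relations, as a subspace. -/
def tensorSubmodule {a b c d : ℕ} (R : Submodule K (Phase K a × Phase K b))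
    (S : Submodule K (Phase K c × Phase K d)) :
    Submodule K (Phase K (a + c) × Phase K (b + d)) where
  carrier := relTensor (R : Set (Phase K a × Phase K b)) (S : Set (Phase K c × Phase K d))
  add_mem' := fun ⟨h, k⟩ ⟨h', k'⟩ => ⟨R.add_mem h h', S.add_mem k k'⟩
  zero_mem' := ⟨R.zero_mem, S.zero_mem⟩
  smul_mem' c _ := fun ⟨h, k⟩ => ⟨R.smul_mem c h, S.smul_mem c k⟩

theorem IsLagrangian.tensor {a b c d : ℕ} {R : Submodule K (Phase K a × Phase K b)}
    {S : Submodule K (Phase K c × Phase K d)} (hR : IsLagrangian R) (hS : IsLagrangian S) :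
    IsLagrangian (tensorSubmodule R S) := by
  rintro ⟨v, w⟩
  constructor
  · rintro ⟨h, k⟩ ⟨v', w'⟩ ⟨h', k'⟩
    have h1 := (hR _).1 h _ h'
    have h2 := (hS _).1 k _ k'
    simp only [form_eq_add_pull] at h1 h2 ⊢
    linear_combination h1 + h2
  · intro H
    have hz : ∀ {m : ℕ} (v : Phase K m), Phase.form v 0 = 0 := fun v => by
      rw [form_swap, form_zero_left, neg_zero]
    refine ⟨(hR _).2 fun r hr => ?_, (hS _).2 fun s hs => ?_⟩
    · have := H (r.1.append 0, r.2.append 0)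
        ⟨by simpa using hr, by simp [-Fin.natAdd_eq_addNat]; exact S.zero_mem⟩
      simpa only [form_eq_add_pull, Phase.append_pull_castAdd, Phase.append_pull_natAdd, hz,
        add_zero] using this
    · have := H (Phase.append 0 s.1, Phase.append 0 s.2)
        ⟨by simp; exact R.zero_mem, by simpa [-Fin.natAdd_eq_addNat] using hs⟩
      simpa only [form_eq_add_pull, Phase.append_pull_castAdd, Phase.append_pull_natAdd, hz,
        zero_add] using this

/-- If `(v, w)` is orthogonal to the graph, then `w - S v` pairs to zero with the image of `S`.
Surjectivity and nondegeneracy put `(v, w)` on the graph. -/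
theorem isLagrangian_graph {n m : ℕ} {S : Phase K n →ₗ[K] Phase K m} (hS : Function.Surjective S)
    (hf : ∀ v w, Phase.form (S v) (S w) = Phase.form v w) : IsLagrangian S.graph := by
  rintro ⟨v, w⟩
  rw [LinearMap.mem_graph_iff]
  constructor
  · rintro h ⟨v', w'⟩ h'
    rw [LinearMap.mem_graph_iff] at h'
    simp only at h h' ⊢
    rw [h, h', hf, sub_self]
  · intro H
    rw [← sub_eq_zero]
    refine eq_zero_of_form fun u => ?_
    obtain ⟨u, rfl⟩ := hS u
    have := H (u, S u) ((LinearMap.mem_graph_iff _ _).2 rfl)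
    rw [form_swap, form_sub_left, hf, neg_eq_zero]
    exact this

/-- A relation which is empty or a coset of a Lagrangian relation. -/
def IsAffineLagrangian {n m : ℕ} (R : Set (Phase K n × Phase K m)) : Prop :=
  ∀ a ∈ R, ∃ L : Submodule K (Phase K n × Phase K m), IsLagrangian L ∧ ∀ r, r ∈ R ↔ r - a ∈ L

namespace IsAffineLagrangian

theorem isTorsor {n m : ℕ} {R : Set (Phase K n × Phase K m)} (h : IsAffineLagrangian R) :
    IsTorsor R := by
  intro r hr s hs t ht
  obtain ⟨L, -, hL⟩ := h t ht
  rw [hL] at hr hs ⊢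
  rw [add_sub_cancel_right, ← sub_sub_sub_cancel_right r s t]
  exact L.sub_mem hr hs

theorem linear {n m : ℕ} {L : Submodule K (Phase K n × Phase K m)} (hL : IsLagrangian L) :
    IsAffineLagrangian (L : Set (Phase K n × Phase K m)) := fun _ ha =>
  ⟨L, hL, fun _ => (L.sub_mem_iff_left ha).symm⟩

theorem graph {n m : ℕ} {S : Phase K n →ₗ[K] Phase K m} (hS : Function.Surjective S)
    (hf : ∀ v w, Phase.form (S v) (S w) = Phase.form v w) (t : Phase K m) :
    IsAffineLagrangian (relGraph fun v => S v + t) := by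
  rintro ⟨v, w⟩ h
  refine ⟨S.graph, isLagrangian_graph hS hf, fun ⟨v', w'⟩ => ?_⟩
  obtain rfl : w = S v + t := h
  change w' = S v' + t ↔ (v', w') - (v, S v + t) ∈ S.graph
  rw [LinearMap.mem_graph_iff]
  change _ ↔ w' - (S v + t) = S (v' - v)
  rw [map_sub, ← add_sub_add_right_eq_sub (S v') (S v) t, sub_left_inj]

theorem perm {a b : ℕ} (e : Fin a ≃ Fin b) : IsAffineLagrangian (relPerm K e) := by
  let S : Phase K a →ₗ[K] Phase K b :=
    { toFun := fun v => v.pull e.symm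
      map_add' := fun _ _ => rfl
      map_smul' := fun _ _ => rfl }
  have h : relPerm K e = relGraph fun v => S v + 0 := by
    ext ⟨v, w⟩
    simp only [add_zero]
    exact (Phase.eq_pull_iff e v w).trans eq_comm
  rw [h]
  refine graph (fun w => ⟨w.pull e, ?_⟩) (fun v w => ?_) 0
  · change (w.pull e).pull e.symm = w
    rw [Phase.pull_pull, Equiv.self_comp_symm, Phase.pull_id]
  · change Phase.form (v.pull e.symm) (w.pull e.symm) = _
    simp only [Phase.form, Phase.pull, dotProduct, Function.comp_apply]
    rw [e.symm.sum_comp fun i => v.1 i * w.2 i, e.symm.sum_comp fun i => v.2 i * w.1 i]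

theorem comp {a b c : ℕ} {R : Set (Phase K a × Phase K b)} {S : Set (Phase K b × Phase K c)}
    (hR : IsAffineLagrangian R) (hS : IsAffineLagrangian S) :
    IsAffineLagrangian (relComp R S) := by
  rintro ⟨v, w⟩ ⟨u, h, k⟩
  obtain ⟨L, hL, hL'⟩ := hR _ h
  obtain ⟨M, hM, hM'⟩ := hS _ k
  refine ⟨compSubmodule L M, hL.comp hM, fun ⟨v', w'⟩ => ?_⟩
  constructor
  · rintro ⟨u', h', k'⟩
    exact ⟨u' - u, (hL' _).1 h', (hM' _).1 k'⟩
  · rintro ⟨u', h', k'⟩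
    refine ⟨u' + u, (hL' _).2 ?_, (hM' _).2 ?_⟩
    · rwa [Prod.mk_sub_mk, add_sub_cancel_right]
    · rwa [Prod.mk_sub_mk, add_sub_cancel_right]

theorem tensor {a b c d : ℕ} {R : Set (Phase K a × Phase K b)} {S : Set (Phase K c × Phase K d)}
    (hR : IsAffineLagrangian R) (hS : IsAffineLagrangian S) :
    IsAffineLagrangian (relTensor R S) := by
  rintro ⟨v, w⟩ ⟨h, k⟩
  obtain ⟨L, hL, hL'⟩ := hR _ h
  obtain ⟨M, hM, hM'⟩ := hS _ k
  exact ⟨tensorSubmodule L M, hL.tensor hM, fun ⟨v', w'⟩ =>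
    and_congr (hL' _) (hM' _)⟩

theorem of_generated {n m : ℕ} {R : (phaseRel K).Hom n m}
    (h : (phaseRel K).Generated (AffLagGen K) R) :
    IsAffineLagrangian (R : Set (Phase K n × Phase K m)) := by
  induction h with
  | of h =>
    cases h with
    | linear W hW => exact linear hW
    | shift u => exact graph (S := LinearMap.id) Function.surjective_id (fun _ _ => rfl) u
  | perm e => exact perm e
  | comp _ _ hf hg => exact comp hf hg
  | tensor _ _ hf hg => exact tensor hf hg

end IsAffineLagrangian

theorem generated_graph {n : ℕ} {S : Phase K n →ₗ[K] Phase K n} (hS : Function.Surjective S)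
    (hf : ∀ v w, Phase.form (S v) (S w) = Phase.form v w) (t : Phase K n) :
    (phaseRel K).Generated (AffLagGen K) (phaseGraph fun v => S v + t) := by
  have h1 : (phaseRel K).Generated (AffLagGen K) (a := n) (b := n)
      (S.graph : Set (Phase K n × Phase K n)) := .of (.linear _ (isLagrangian_graph hS hf))
  have h2 := h1.comp (.of (.shift t))
  have h3 : (phaseGraph fun v => S v + t) = (phaseRel K).comp (a := n) (b := n)
      (S.graph : Set (Phase K n × Phase K n))
      ({vw | vw.2 = vw.1 + t} : Set (Phase K n × Phase K n)) := by
    refine Set.ext fun ⟨v, w⟩ => ⟨fun h => ⟨S v, (LinearMap.mem_graph_iff _ _).2 rfl, h⟩, ?_⟩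
    rintro ⟨u, h, k⟩
    rw [SetLike.mem_coe, LinearMap.mem_graph_iff] at h
    change w = S v + t
    simp only at h
    rw [← h]
    exact k
  rw [h3]
  exact h2

end Symplectic

/-! ### The gates act transitively on affine Lagrangian subspaces -/

section Transitivity

variable {p : ℕ} [Fact p.Prime]

/-- The subsets of phase space which are obtained from `{z = 0}` by applying gates. -/
inductive GateReach {n : ℕ} : Set (Phase (ZMod p) n) → Prop
  | zero : GateReach {v | v.2 = 0}
  | gate {g : Phase (ZMod p) n → Phase (ZMod p) n} {U : QMat p n n} (h : GatePair p g U)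
      {A : Set (Phase (ZMod p) n)} (hA : GateReach A) : GateReach (g '' A)

theorem pointOp_injective [NeZero (2 : ZMod p)] (n : ℕ) :
    Function.Injective (pointOp : Phase (ZMod p) n → QMat p n n) := by
  intro u v h
  have hp : (p : ℂ) ^ n ≠ 0 := pow_ne_zero _ (Nat.cast_ne_zero.2 (NeZero.ne p))
  have h1 := trace_pointOp_mul_pointOp u v
  rw [h, trace_pointOp_mul_pointOp, if_pos rfl] at h1
  by_contra huv
  rw [if_neg huv] at h1
  exact hp h1

/-- Read off from the operators: `U` is invertible and distinct points have distinct point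
operators. -/
theorem GatePair.bijective [NeZero (2 : ZMod p)] {n : ℕ} {g : Phase (ZMod p) n → Phase (ZMod p) n}
    {U : QMat p n n} (h : GatePair p g U) : Function.Bijective g := by
  refine Finite.injective_iff_bijective.1 fun v w hvw => pointOp_injective n ?_
  have h1 := h.intertwines v
  rw [hvw, ← h.intertwines w] at h1
  have h2 := congrArg (fun M => U.conjTranspose * M) h1
  simpa only [← Matrix.mul_assoc, h.conjTranspose_mul_self, Matrix.one_mul] using h2

/-- A gate permutes a finite set, so its inverse is a positive power of it and inverse gates need
not be added to the generators. -/
theorem GateReach.of_image [NeZero (2 : ZMod p)] {n : ℕ}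
    {g : Phase (ZMod p) n → Phase (ZMod p) n} {U : QMat p n n} (h : GatePair p g U)
    {A : Set (Phase (ZMod p) n)} (hA : GateReach (g '' A)) : GateReach A := by
  let e : Equiv.Perm (Phase (ZMod p) n) := Equiv.ofBijective g h.bijective
  have h1 : ∀ k : ℕ, GateReach ((e ^ (k + 1) : Equiv.Perm _) '' A) := fun k => by
    induction k with
    | zero => rwa [zero_add, pow_one]
    | succ k ih =>
      have := GateReach.gate h ih
      rw [pow_succ', Equiv.Perm.coe_mul, Set.image_comp]
      exact this
  -- The exponent becomes the order of the permutation group, where the power of `e` is the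
  -- identity.
  have h2 := h1 (Nat.card (Equiv.Perm (Phase (ZMod p) n)) - 1)
  rwa [Nat.sub_add_cancel Nat.card_pos, pow_card_eq_one', Equiv.Perm.coe_one, Set.image_id] at h2

/-- A Lagrangian subspace of phase space. -/
def IsLagrangianSubspace {n : ℕ} (L : Submodule (ZMod p) (Phase (ZMod p) n)) : Prop :=
  ∀ v, v ∈ L ↔ ∀ w ∈ L, Phase.form v w = 0

/-- All cosets of `L` are reachable. -/
def CosetsReach {n : ℕ} (L : Submodule (ZMod p) (Phase (ZMod p) n)) : Prop :=
  ∀ a, GateReach {v | v - a ∈ L}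

/-- The linear map of a power of the phase gate. -/
def phaseMap {n : ℕ} (i : Fin n) (c : ZMod p) : Phase (ZMod p) n →ₗ[ZMod p] Phase (ZMod p) n where
  toFun v := (v.1 + Pi.single i (c * v.2 i), v.2)
  map_add' v w := by
    refine Prod.ext ?_ rfl
    simp only [Prod.fst_add, Prod.snd_add, Pi.add_apply, mul_add, Pi.single_add]
    abel
  map_smul' a v := by
    refine Prod.ext ?_ rfl
    simp only [Prod.smul_fst, Prod.smul_snd, Pi.smul_apply, smul_eq_mul, RingHom.id_apply,
      smul_add, ← Pi.single_smul]
    rw [mul_left_comm]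

/-- The linear map of the Fourier gate. -/
def fourierMap {n : ℕ} (i : Fin n) : Phase (ZMod p) n →ₗ[ZMod p] Phase (ZMod p) n where
  toFun v := (Function.update v.1 i (v.2 i), Function.update v.2 i (-v.1 i))
  map_add' v w := by
    refine Prod.ext ?_ ?_
    · exact Function.update_add v.1 w.1 i (v.2 i) (w.2 i)
    · rw [Prod.fst_add, Pi.add_apply, neg_add]
      exact Function.update_add v.2 w.2 i (-v.1 i) (-w.1 i)
  map_smul' a v := by
    refine Prod.ext ?_ ?_
    · exact Function.update_smul a v.1 i (v.2 i)
    · rw [Prod.smul_fst, Pi.smul_apply, ← smul_neg]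
      exact Function.update_smul a v.2 i (-v.1 i)

/-- The linear map of a power of the controlled boost gate. -/
def controlMap {n : ℕ} (i j : Fin n) (c : ZMod p) :
    Phase (ZMod p) n →ₗ[ZMod p] Phase (ZMod p) n where
  toFun v := (v.1 + Pi.single i (-(c * v.1 j)), v.2 + Pi.single j (c * v.2 i))
  map_add' v w := by
    refine Prod.ext ?_ ?_
    · simp only [Prod.fst_add, Pi.add_apply, mul_add, neg_add, Pi.single_add]
      abel
    · simp only [Prod.snd_add, Pi.add_apply, mul_add, Pi.single_add]
      abel
  map_smul' a v := by
    refine Prod.ext ?_ ?_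
    · simp only [Prod.smul_fst, Pi.smul_apply, smul_eq_mul, RingHom.id_apply,
        smul_add, ← Pi.single_smul]
      rw [mul_left_comm, mul_neg]
    · simp only [Prod.smul_snd, Pi.smul_apply, smul_eq_mul, RingHom.id_apply,
        smul_add, ← Pi.single_smul]
      rw [mul_left_comm]

/-- A linear map which preserves the symplectic form, and which can be undone by gates. -/
structure IsGateMap {n : ℕ} (S : Phase (ZMod p) n →ₗ[ZMod p] Phase (ZMod p) n) : Prop where
  form : ∀ v w, Phase.form (S v) (S w) = Phase.form v w
  reach : ∀ {A : Set (Phase (ZMod p) n)}, GateReach (S '' A) → GateReach A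

theorem IsGateMap.lagrangian {n : ℕ} {S : Phase (ZMod p) n →ₗ[ZMod p] Phase (ZMod p) n}
    (hS : IsGateMap S) {L : Submodule (ZMod p) (Phase (ZMod p) n)} (hL : IsLagrangianSubspace L) :
    IsLagrangianSubspace (L.map S) := by
  have hinj : Function.Injective S := by
    rw [← LinearMap.ker_eq_bot, LinearMap.ker_eq_bot']
    intro v hv
    refine eq_zero_of_form fun w => ?_
    rw [← hS.form, hv, form_swap, form_zero_left, neg_zero]
  intro v
  constructor
  · rintro ⟨l, hl, rfl⟩ _ ⟨l', hl', rfl⟩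
    rw [hS.form]
    exact (hL l).1 hl l' hl'
  · intro H
    obtain ⟨u, rfl⟩ := (Finite.injective_iff_bijective.1 hinj).2 v
    refine ⟨u, (hL u).2 fun l hl => ?_, rfl⟩
    rw [← hS.form]
    exact H _ ⟨l, hl, rfl⟩

theorem IsGateMap.cosetsReach {n : ℕ} {S : Phase (ZMod p) n →ₗ[ZMod p] Phase (ZMod p) n}
    (hS : IsGateMap S) {L : Submodule (ZMod p) (Phase (ZMod p) n)} (hL : CosetsReach (L.map S)) :
    CosetsReach L := by
  intro a
  refine hS.reach ?_
  convert hL (S a) using 1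
  ext w
  constructor
  · rintro ⟨v, hv, rfl⟩
    exact ⟨v - a, hv, map_sub S v a⟩
  · rintro ⟨l, hl, h⟩
    refine ⟨l + a, ?_, ?_⟩
    · change l + a - a ∈ L
      rwa [add_sub_cancel_right]
    · rw [map_add, h, sub_add_cancel]

/-! ### Elementary symplectic maps that gates can undo -/

variable [NeZero (2 : ZMod p)] {n : ℕ}

theorem isGateMap_fourierMap (i : Fin n) : IsGateMap (fourierMap (p := p) i) where
  form v w := by
    simp only [Phase.form, fourierMap, LinearMap.coe_mk, AddHom.coe_mk]
    have h : ∀ (x y : Fin n → ZMod p) (a b : ZMod p), Function.update x i a ⬝ᵥ Function.update y i b =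
        x ⬝ᵥ y - x i * y i + a * b := fun x y a b => by
      rw [dotProduct_eq_add_sum_erase i, dotProduct_eq_add_sum_erase i x, Function.update_self,
        Function.update_self]
      have : ∑ k ∈ Finset.univ.erase i, Function.update x i a k * Function.update y i b k =
          ∑ k ∈ Finset.univ.erase i, x k * y k := by
        refine Finset.sum_congr rfl fun k hk => ?_
        rw [Function.update_of_ne (Finset.ne_of_mem_erase hk),
          Function.update_of_ne (Finset.ne_of_mem_erase hk)]
      rw [this]
      ring
    rw [h, h]
    ring
  reach h := GateReach.of_image (.fourier i) h

theorem isGateMap_phaseMap (i : Fin n) (c : ZMod p) : IsGateMap (phaseMap i c) where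
  form v w := by
    simp only [Phase.form, phaseMap, LinearMap.coe_mk, AddHom.coe_mk, add_dotProduct,
      dotProduct_add, single_dotProduct, dotProduct_single]
    ring
  reach := by
    -- The parameter `c` counts how often the gate is applied, so the induction runs over its
    -- natural representative.
    rw [← ZMod.natCast_zmod_val c]
    induction c.val with
    | zero =>
      intro A h
      have h1 : (phaseMap i ((0 : ℕ) : ZMod p) : Phase (ZMod p) n → Phase (ZMod p) n) = id := by
        funext v
        simp [phaseMap]
      rwa [h1, Set.image_id] at h
    | succ k ih =>
      intro A h
      refine GateReach.of_image (.phase i) (ih ?_)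
      rw [← Set.image_comp]
      convert h using 2 with v
      simp only [Function.comp_apply, phaseMap, LinearMap.coe_mk, AddHom.coe_mk,
        ← add_single_eq_update, add_assoc, ← Pi.single_add]
      push_cast
      rw [add_mul, one_mul, add_comm (v.2 i)]

theorem isGateMap_controlMap {i j : Fin n} (hij : i ≠ j) (c : ZMod p) :
    IsGateMap (controlMap i j c) where
  form v w := by
    simp only [Phase.form, controlMap, LinearMap.coe_mk, AddHom.coe_mk, add_dotProduct,
      dotProduct_add, single_dotProduct, dotProduct_single, Pi.add_apply, Pi.single_eq_of_ne hij,
      Pi.single_eq_of_ne hij.symm]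
    ring
  reach := by
    rw [← ZMod.natCast_zmod_val c]
    induction c.val with
    | zero =>
      intro A h
      have h1 : (controlMap i j ((0 : ℕ) : ZMod p) : Phase (ZMod p) n → Phase (ZMod p) n) = id := by
        funext v
        simp [controlMap]
      rwa [h1, Set.image_id] at h
    | succ k ih =>
      intro A h
      refine GateReach.of_image (.control i j hij) (ih ?_)
      rw [← Set.image_comp]
      convert h using 2 with v
      simp only [Function.comp_apply, controlMap, LinearMap.coe_mk, AddHom.coe_mk,
        sub_eq_add_neg (v.1 i), ← add_single_eq_update, add_assoc, ← Pi.single_add, Pi.add_apply,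
        Pi.single_eq_of_ne hij, Pi.single_eq_of_ne hij.symm, add_zero]
      push_cast
      rw [add_mul, add_mul, one_mul, one_mul, add_comm (v.2 i), neg_add, add_comm (-v.1 j)]

/-! ### Symplectic Gaussian elimination -/

theorem cosetsReach_of_snd_eq_zero {L : Submodule (ZMod p) (Phase (ZMod p) n)}
    (hL : ∀ v, v ∈ L ↔ v.2 = 0) : CosetsReach L := by
  -- These are the translations that preserve reachability of the sets `z = d`. Those along `X` fix
  -- such sets and the unit ones along `Z` are boosts, so every translation occurs.
  let S : AddSubmonoid (Phase (ZMod p) n) :=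
    { carrier := {u | ∀ d : Fin n → ZMod p, GateReach {v : Phase (ZMod p) n | v.2 = d} →
        GateReach {v : Phase (ZMod p) n | v.2 = d + u.2}}
      add_mem' := fun {u w} hu hw d hd => by
        have := hw _ (hu d hd)
        rwa [add_assoc] at this
      zero_mem' := fun d hd => by
        rw [Prod.snd_zero, add_zero]
        exact hd }
  have hS : ∀ u, u ∈ S := by
    refine addSubmonoid_eq_top (fun i d hd => ?_) fun i d hd => ?_
    · change GateReach {v : Phase (ZMod p) n | v.2 = d + 0}
      rwa [add_zero]
    · convert GateReach.gate (.boost i) hd using 1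
      ext v
      simp only [← add_single_eq_update]
      constructor
      · intro h
        refine ⟨(v.1, d), rfl, Prod.ext rfl ?_⟩
        exact h.symm
      · rintro ⟨w, hw, rfl⟩
        obtain rfl : w.2 = d := hw
        rfl
  intro a
  have := hS a 0 .zero
  rw [zero_add] at this
  convert this using 1
  ext v
  change v - a ∈ L ↔ v.2 = a.2
  rw [hL, Prod.snd_sub, sub_eq_zero]

/-- Gates simplify `v` until the `X`-unit vector of wire `k` lies in the transformed subspace, after
which `ih` applies. The set `T'` holds the wires of `T` on which `v` may still be nonzero. The
`X`-unit vectors outside `insert k T` are fixed by all gates used. -/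
theorem cosetsReach_of_isLagrangianSubspace_aux {T : Finset (Fin n)} {k : Fin n} (hk : k ∉ T)
    (ih : ∀ L : Submodule (ZMod p) (Phase (ZMod p) n), IsLagrangianSubspace L →
      (∀ i, i ∉ T → (Pi.single i 1, 0) ∈ L) → CosetsReach L)
    (T' : Finset (Fin n)) (hT' : T' ⊆ T) :
    ∀ L : Submodule (ZMod p) (Phase (ZMod p) n), IsLagrangianSubspace L →
      (∀ i, i ∉ insert k T → (Pi.single i 1, 0) ∈ L) →
      ∀ v ∈ L, v.2 k ≠ 0 → (∀ j ∈ T, j ∉ T' → v.1 j = 0 ∧ v.2 j = 0) → CosetsReach L := by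
  induction T' using Finset.induction_on with
  | empty =>
    intro L hL hS v hv hvk h0
    -- This power of the phase gate cancels the `X`-coordinate of `v` at `k`. The Fourier gate then
    -- turns the remaining `Z`-coordinate into an `X`-coordinate.
    have h1 := isGateMap_phaseMap k (-v.1 k / v.2 k)
    have h2 := isGateMap_fourierMap (p := p) k
    refine h1.cosetsReach (h2.cosetsReach (ih _ (h2.lagrangian (h1.lagrangian hL)) fun i hi => ?_))
    have hmem : ∀ i, i ∉ insert k T →
        ((Pi.single i 1, 0) : Phase (ZMod p) n) ∈ (L.map (phaseMap k (-v.1 k / v.2 k))).map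
          (fourierMap k) := fun i hi => by
      have hik : k ≠ i := fun h => hi (h ▸ Finset.mem_insert_self k T)
      refine ⟨_, ⟨_, hS i hi, rfl⟩, ?_⟩
      simp [phaseMap, fourierMap, Pi.single_eq_of_ne hik, Function.update_eq_self_iff]
    by_cases hik : i = k
    · subst hik
      have hw : fourierMap i (phaseMap i (-v.1 i / v.2 i) v) ∈
        (L.map (phaseMap i (-v.1 i / v.2 i))).map (fourierMap i) := ⟨_, ⟨v, hv, rfl⟩, rfl⟩
      -- Outside `insert i T` the `Z`-coordinates of `v` vanish, since `v` is orthogonal to the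
      -- `X`-unit vectors there. The transformed `v` is therefore a combination of `X`-unit vectors,
      -- and all but the one at `i` are already known to lie in the subspace.
      have hz : v.2 i • ((Pi.single i 1, 0) : Phase (ZMod p) n) =
          fourierMap i (phaseMap i (-v.1 i / v.2 i) v) -
            ∑ j ∈ (insert i T)ᶜ, v.1 j • ((Pi.single j 1, 0) : Phase (ZMod p) n) := by
        rw [eq_sub_iff_add_eq]
        refine Prod.ext (funext fun l => ?_) (funext fun l => ?_)
        · simp only [fourierMap, phaseMap, LinearMap.coe_mk, AddHom.coe_mk, Prod.fst_add,
            Pi.add_apply, Prod.smul_fst, Pi.smul_apply, Prod.fst_sum, Finset.sum_apply,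
            smul_eq_mul, Pi.single_apply, mul_ite, mul_one, mul_zero, Finset.sum_ite_eq,
            Finset.mem_compl, Finset.mem_insert, Function.update_apply]
          by_cases hl : l = i
          · simp [hl]
          · by_cases hlT : l ∈ T
            · simp [hl, hlT, (h0 l hlT (Finset.notMem_empty l)).1]
            · simp [hl, hlT]
        · simp only [fourierMap, phaseMap, LinearMap.coe_mk, AddHom.coe_mk, Prod.snd_add,
            Pi.add_apply, Prod.smul_snd, smul_zero, Pi.zero_apply, Prod.snd_sum,
            Finset.sum_const_zero, add_zero, Function.update_apply, Pi.single_eq_same]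
          by_cases hl : l = i
          · rw [if_pos hl, div_mul_cancel₀ _ hvk, add_neg_cancel, neg_zero]
          · rw [if_neg hl]
            by_cases hlT : l ∈ T
            · exact (h0 l hlT (Finset.notMem_empty l)).2.symm
            · have h3 := (hL _).1 (hS l (by simp [hl, hlT])) v hv
              rw [form_single_fst] at h3
              exact h3.symm
      have h3 : v.2 i • ((Pi.single i 1, 0) : Phase (ZMod p) n) ∈
          (L.map (phaseMap i (-v.1 i / v.2 i))).map (fourierMap i) := by
        rw [hz]
        exact Submodule.sub_mem _ hw (Submodule.sum_mem _ fun j hj =>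
          Submodule.smul_mem _ _ (hmem j (Finset.mem_compl.1 hj)))
      exact (Submodule.smul_mem_iff _ hvk).1 h3
    · exact hmem i (by simp [hik, hi])
  | insert j T' hj ih' =>
    intro L hL hS v hv hvk h0
    have hjT : j ∈ T := hT' (Finset.mem_insert_self j T')
    have hkj : k ≠ j := fun h => hk (h ▸ hjT)
    -- Wire `j` is cleared in three moves. A control gate kills `z_j` by means of `z_k`, a Fourier
    -- gate exchanges the zero with `x_j`, and a second control gate kills the new `z_j`. The
    -- coordinate `z_k` never changes, while `x_k` may.
    have h1 := isGateMap_controlMap hkj (-v.2 j / v.2 k)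
    have h2 := isGateMap_fourierMap (p := p) j
    set w := fourierMap j (controlMap k j (-v.2 j / v.2 k) v) with hw
    have h3 := isGateMap_controlMap hkj (-w.2 j / w.2 k)
    have hwk : w.2 k = v.2 k := by
      simp [hw, fourierMap, controlMap, Function.update_of_ne hkj, Pi.single_eq_of_ne hkj]
    have hwj : w.1 j = 0 := by
      simp only [hw, fourierMap, controlMap, LinearMap.coe_mk, AddHom.coe_mk, Function.update_self,
        Pi.add_apply, Pi.single_eq_same]
      rw [div_mul_cancel₀ _ hvk, add_neg_cancel]
    refine h1.cosetsReach (h2.cosetsReach (h3.cosetsReach (ih'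
      (fun x hx => hT' (Finset.mem_insert_of_mem hx)) _
      (h3.lagrangian (h2.lagrangian (h1.lagrangian hL))) (fun i hi => ?_)
      (controlMap k j (-w.2 j / w.2 k) w) ⟨_, ⟨_, ⟨v, hv, rfl⟩, rfl⟩, rfl⟩ ?_ fun l hl hl' => ?_)))
    · have hik : k ≠ i := fun h => hi (h ▸ Finset.mem_insert_self k T)
      have hij : j ≠ i := fun h => hi (h ▸ Finset.mem_insert_of_mem hjT)
      refine ⟨_, ⟨_, ⟨_, hS i hi, rfl⟩, rfl⟩, ?_⟩
      simp [controlMap, fourierMap, Pi.single_eq_of_ne hij,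
        Function.update_eq_self_iff]
    · have : (controlMap k j (-w.2 j / w.2 k) w).2 k = w.2 k := by
        simp [controlMap, Pi.single_eq_of_ne hkj]
      rwa [this, hwk]
    · by_cases hlj : l = j
      · subst hlj
        constructor
        · simp [controlMap, hwj]
        · simp only [controlMap, LinearMap.coe_mk, AddHom.coe_mk, Pi.add_apply, Pi.single_eq_same]
          rw [div_mul_cancel₀ _ (by rwa [hwk]), add_neg_cancel]
      · have hlk : l ≠ k := fun h => hk (h ▸ hl)
        have h4 := h0 l hl (by simp [hlj, hl'])
        constructor
        · simp [controlMap, hw, fourierMap, Pi.single_eq_of_ne hlk, Function.update_of_ne hlj, h4.1]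
        · simp [controlMap, hw, fourierMap, Pi.single_eq_of_ne hlj, Function.update_of_ne hlj, h4.2]

/-- Outside `T` the `X`-unit vectors are known to lie in `L`. When `T` is empty, being Lagrangian
forces `L` to be `{z = 0}`. If the unit vector at `k` is missing, maximality of `L` yields a vector
of `L` with nonzero `Z`-coordinate at `k`, and the elimination starts from it. -/
theorem cosetsReach_of_isLagrangianSubspace {L : Submodule (ZMod p) (Phase (ZMod p) n)}
    (hL : IsLagrangianSubspace L) : CosetsReach L := by
  suffices h : ∀ (T : Finset (Fin n)) (L : Submodule (ZMod p) (Phase (ZMod p) n)),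
      IsLagrangianSubspace L → (∀ i, i ∉ T → (Pi.single i 1, 0) ∈ L) → CosetsReach L from
    h Finset.univ L hL fun i hi => absurd (Finset.mem_univ i) hi
  intro T
  induction T using Finset.induction_on with
  | empty =>
    intro L hL hS
    have h1 : ∀ v ∈ L, v.2 = 0 := fun v hv => funext fun i => by
      have := (hL _).1 (hS i (Finset.notMem_empty i)) v hv
      rwa [form_single_fst] at this
    refine cosetsReach_of_snd_eq_zero fun v => ⟨h1 v, fun hv => (hL v).2 fun w hw => ?_⟩
    rw [Phase.form, hv, h1 w hw, dotProduct_zero, zero_dotProduct, sub_zero]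
  | insert k T hk ih =>
    intro L hL hS
    by_cases hkL : ((Pi.single k 1, 0) : Phase (ZMod p) n) ∈ L
    · refine ih L hL fun i hi => ?_
      by_cases hik : i = k
      · rwa [hik]
      · exact hS i (by simp [hik, hi])
    · rw [hL] at hkL
      push Not at hkL
      obtain ⟨v, hv, hvk⟩ := hkL
      rw [form_single_fst] at hvk
      exact cosetsReach_of_isLagrangianSubspace_aux hk ih T subset_rfl L hL hS v hv hvk
        fun j hj hj' => absurd hj hj'

theorem IsAffineLagrangian.gateReach {R : Set (Phase (ZMod p) 0 × Phase (ZMod p) n)}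
    (hR : IsAffineLagrangian R) (hne : R.Nonempty) : GateReach {w | (0, w) ∈ R} := by
  obtain ⟨⟨v, a⟩, ha⟩ := hne
  obtain rfl : v = 0 := Phase.ext_fin_zero _ _
  obtain ⟨L, hL, hL'⟩ := hR _ ha
  have h : IsLagrangianSubspace (L.comap (LinearMap.inr (ZMod p) (Phase (ZMod p) 0) _)) := by
    intro w
    refine (hL (0, w)).trans ⟨fun h u hu => ?_, fun h u hu => ?_⟩
    · have := h _ hu
      rwa [form_zero_left, sub_zero] at this
    · rw [form_zero_left, sub_zero]
      refine h _ ?_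
      change (0, u.2) ∈ L
      convert hu
      exact Phase.ext_fin_zero _ _
  convert cosetsReach_of_isLagrangianSubspace h a using 1
  ext w
  refine (hL' (0, w)).trans ?_
  change _ ↔ (0, w - a) ∈ L
  rw [Prod.mk_sub_mk, sub_zero]

end Transitivity

/-! ### Stabilizer circuits represent affine Lagrangian relations -/

section Stabilizers

theorem isLagrangian_converse {K : Type} [Field K] {n m : ℕ}
    {L : Submodule K (Phase K n × Phase K m)} (hL : IsLagrangian L) :
    IsLagrangian (L.comap (LinearEquiv.prodComm K (Phase K m) (Phase K n)).toLinearMap) := by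
  rintro ⟨w, v⟩
  refine (hL (v, w)).trans ⟨fun h r hr => ?_, fun h r hr => ?_⟩
  · have := h _ hr
    exact (neg_sub _ _).symm.trans (neg_eq_zero.2 this)
  · have := h (r.2, r.1) hr
    exact (neg_sub _ _).symm.trans (neg_eq_zero.2 this)

/-- The relation `z = 0`, which is represented by the zero ket. -/
def zeroSubmodule (K : Type) [Field K] (n : ℕ) : Submodule K (Phase K 0 × Phase K n) where
  carrier := {vw | vw.2.2 = 0}
  add_mem' {v w} hv hw := by
    change v.2.2 + w.2.2 = 0
    rw [show v.2.2 = 0 from hv, show w.2.2 = 0 from hw, add_zero]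
  zero_mem' := rfl
  smul_mem' c v hv := by
    change c • v.2.2 = 0
    rw [show v.2.2 = 0 from hv, smul_zero]

theorem isLagrangian_zeroSubmodule (K : Type) [Field K] (n : ℕ) :
    IsLagrangian (zeroSubmodule K n) := by
  rintro ⟨v, w⟩
  have h0 : ∀ a b : Phase K 0, Phase.form a b = 0 := fun a b => by simp [Phase.form]
  simp only [h0, sub_zero]
  constructor
  · intro h u hu
    rw [Phase.form, show w.2 = 0 from h, show u.2.2 = 0 from hu, dotProduct_zero,
      zero_dotProduct, sub_zero]
  · intro h
    refine funext fun i => ?_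
    have := h (0, (Pi.single i 1, 0)) rfl
    rw [form_swap, form_single_fst, neg_eq_zero] at this
    exact this

variable {p : ℕ} [Fact p.Prime]

theorem capRel_eq (n : ℕ) : capRel (ZMod p) n = ((cupSpace (ZMod p) n).comap
    (LinearEquiv.prodComm (ZMod p) (Phase (ZMod p) (n + n)) (Phase (ZMod p) 0)).toLinearMap :
      Set (Phase (ZMod p) (n + n) × Phase (ZMod p) 0)) := rfl

theorem isAffineLagrangian_capRel (n : ℕ) : IsAffineLagrangian (capRel (ZMod p) n) := by
  rw [capRel_eq]
  exact .linear (isLagrangian_converse (isLagrangian_cupSpace (ZMod p) n))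

theorem IsClifford.exists_generated [NeZero (2 : ZMod p)] {n : ℕ} {U : QMat p n n}
    (hU : IsClifford U) : ∃ g : Phase (ZMod p) n → Phase (ZMod p) n,
      (phaseRel (ZMod p)).Generated (AffLagGen (ZMod p)) (phaseGraph g) ∧
      Represents U (relGraph g) := by
  obtain ⟨S, t, hform, hbij, h⟩ := hU.exists_intertwines
  exact ⟨_, generated_graph hbij.2 hform t,
    represents_relGraph (Matrix.mem_unitaryGroup_iff.1 hU.1) h⟩

/-- The gate is a Clifford operator, so it represents the graph of some affine symplectomorphism. A
matrix represents only one relation, so that graph is the graph of `g`, and no symplectic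
computation with `g` is needed. -/
theorem GatePair.generated [NeZero (2 : ZMod p)] {n : ℕ}
    {g : Phase (ZMod p) n → Phase (ZMod p) n} {U : QMat p n n} (h : GatePair p g U) :
    (phaseRel (ZMod p)).Generated (AffLagGen (ZMod p)) (phaseGraph g) := by
  obtain ⟨g', hg', hr⟩ := h.isClifford.exists_generated
  have : phaseGraph g = phaseGraph g' := h.represents.rel_unique hr
  rwa [this]

theorem GatePair.isAffineLagrangian [NeZero (2 : ZMod p)] {n : ℕ}
    {g : Phase (ZMod p) n → Phase (ZMod p) n} {U : QMat p n n} (h : GatePair p g U) :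
    IsAffineLagrangian (relGraph g) := IsAffineLagrangian.of_generated h.generated

/-- A set of vectors as a relation with source `0`. -/
def stateRel {n : ℕ} (A : Set (Phase (ZMod p) n)) : Set (Phase (ZMod p) 0 × Phase (ZMod p) n) :=
  {vw | vw.2 ∈ A}

theorem relComp_stateRel {n : ℕ} (A : Set (Phase (ZMod p) n))
    (g : Phase (ZMod p) n → Phase (ZMod p) n) :
    relComp (stateRel A) (relGraph g) = stateRel (g '' A) := by
  ext ⟨v, w⟩
  exact ⟨fun ⟨u, h, k⟩ => ⟨u, h, k.symm⟩, fun ⟨u, h, k⟩ => ⟨u, h, k.symm⟩⟩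

theorem stateRel_eq {n : ℕ} (R : Set (Phase (ZMod p) 0 × Phase (ZMod p) n)) :
    stateRel {w | (0, w) ∈ R} = R := by
  ext ⟨v, w⟩
  rw [Phase.ext_fin_zero v 0]
  rfl

theorem GateReach.generated [NeZero (2 : ZMod p)] {n : ℕ} {A : Set (Phase (ZMod p) n)}
    (hA : GateReach A) :
    (phaseRel (ZMod p)).Generated (AffLagGen (ZMod p)) (a := 0) (b := n) (stateRel A) := by
  induction hA with
  | zero => exact .of (.linear (zeroSubmodule (ZMod p) n) (isLagrangian_zeroSubmodule (ZMod p) n))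
  | gate h _ ih =>
    rw [← relComp_stateRel]
    exact ih.comp h.generated

/-! ### Stabilizer circuits: adjoints, zero matrices and represented relations -/

/-- The matrices which are stabilizer circuits, up to a scalar. -/
def IsStab {n m : ℕ} (h : (projMat p).Hom n m) : Prop := (projMat p).Generated (StabGen p) h

theorem conjTranspose_matPerm {a b : ℕ} (e : Fin a ≃ Fin b) :
    (matPerm e : QMat p a b).conjTranspose = matPerm e.symm := by
  ext y x
  simp only [Matrix.conjTranspose_apply, matPerm, Matrix.of_apply]
  have : y = x ∘ e ↔ x = y ∘ e.symm :=
    ⟨fun h => by rw [h, Function.comp_assoc, Equiv.self_comp_symm, Function.comp_id],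
      fun h => by rw [h, Function.comp_assoc, Equiv.symm_comp_self, Function.comp_id]⟩
  simp only [this]
  split_ifs <;> simp

/-- The adjoint of a matrix modulo scalars. -/
def projAdjoint {n m : ℕ} : (projMat p).Hom n m → (projMat p).Hom m n :=
  Quotient.map (sa := scalarSetoid p n m) (sb := scalarSetoid p m n) Matrix.conjTranspose (by
    rintro M _ ⟨c, hc, rfl⟩
    exact ⟨star c, star_ne_zero.2 hc, Matrix.conjTranspose_smul c M⟩)

theorem projAdjoint_toProj {n m : ℕ} (M : QMat p n m) :
    projAdjoint (toProj M) = toProj M.conjTranspose := rfl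

theorem IsClifford.conjTranspose {n : ℕ} {U : QMat p n n} (hU : IsClifford U) :
    IsClifford U.conjTranspose := by
  have h1 : U.conjTranspose * U = 1 := Matrix.mem_unitaryGroup_iff'.1 hU.1
  refine ⟨Matrix.mem_unitaryGroup_iff.2 ?_, ?_⟩
  · rw [Matrix.star_eq_conjTranspose, Matrix.conjTranspose_conjTranspose, h1]
  · conv_lhs => rw [← hU.2]
    rw [Set.image_image, Matrix.conjTranspose_conjTranspose]
    have h2 : ∀ P : QMat p n n, U.conjTranspose * (U * P * U.conjTranspose) * U = P := fun P => by
      rw [← Matrix.mul_assoc, ← Matrix.mul_assoc, h1, Matrix.one_mul, Matrix.mul_assoc, h1,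
        Matrix.mul_one]
    simp only [h2, Set.image_id']

theorem braZero_eq (n : ℕ) : braZero p n = (ketZero p n).conjTranspose := by
  ext y x
  simp [braZero, ketZero]

theorem IsStab.adjoint {n m : ℕ} {h : (projMat p).Hom n m} (hh : IsStab h) :
    IsStab (projAdjoint h) := by
  induction hh with
  | of h =>
    cases h with
    | clifford U hU => exact .of (.clifford _ hU.conjTranspose)
    | ket =>
      rw [projAdjoint_toProj, ← braZero_eq]
      exact .of .bra
    | bra =>
      rw [projAdjoint_toProj, braZero_eq, Matrix.conjTranspose_conjTranspose]
      exact .of .ket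
  | perm e =>
    have : projAdjoint ((projMat p).perm e) = (projMat p).perm e.symm :=
      congrArg toProj (conjTranspose_matPerm e)
    rw [this]
    exact .perm _
  | @comp a b c f g _ _ hf hg =>
    obtain ⟨M, rfl⟩ := exists_toProj f
    obtain ⟨N, rfl⟩ := exists_toProj g
    have : projAdjoint ((projMat p).comp (toProj M) (toProj N)) =
        (projMat p).comp (projAdjoint (toProj N)) (projAdjoint (toProj M)) :=
      congrArg toProj (Matrix.conjTranspose_mul N M)
    rw [this]
    exact hg.comp hf
  | @tensor a b c d f g _ _ hf hg =>
    obtain ⟨M, rfl⟩ := exists_toProj f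
    obtain ⟨N, rfl⟩ := exists_toProj g
    have : projAdjoint ((projMat p).tensor (toProj M) (toProj N)) =
        (projMat p).tensor (projAdjoint (toProj M)) (projAdjoint (toProj N)) :=
      congrArg toProj (conjTranspose_matTensor M N)
    rw [this]
    exact hf.tensor hg

theorem isStab_ketZero (n : ℕ) : IsStab (toProj (ketZero p n)) := by
  induction n with
  | zero =>
    have : ketZero p 0 = matPerm (Equiv.refl (Fin 0)) := by
      ext y x
      rw [matPerm_refl, Subsingleton.elim y x, Matrix.one_apply_eq]
      change (if y = 0 then (1 : ℂ) else 0) = 1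
      exact if_pos (Subsingleton.elim y 0)
    rw [this]
    exact .perm _
  | succ n ih =>
    have h1 := StrictProp.Generated.tensor ih (StrictProp.Generated.of StabGen.ket)
    have h2 : ketZero p (n + 1) = matTensor (ketZero p n) (ketZero p 1) := by
      ext y x
      simp only [ketZero, matTensor, Matrix.of_apply, mul_ite, mul_one, mul_zero, ← ite_and]
      exact if_congr (fun_split_iff.trans and_comm) rfl rfl
    rw [h2]
    exact h1

/-- The circuit that prepares `|0⟩`, boosts it and tests against `⟨0|` is the scalar zero. Placing
it between `⟨0|` on the inputs and `|0⟩` on the outputs gives every zero matrix. -/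
theorem isStab_zero [NeZero (2 : ZMod p)] (n m : ℕ) : IsStab (toProj (0 : QMat p n m)) := by
  have h1 : IsStab (toProj (matComp (ketZero p 1) (matComp (onWire 0 (boostOp p))
      (braZero p 1)))) :=
    .comp (isStab_ketZero 1) (.comp (.of (.clifford _ (GatePair.boost 0).isClifford)) (.of .bra))
  have h2 : matComp (ketZero p 1) (matComp (onWire 0 (boostOp p)) (braZero p 1)) = 0 := by
    ext y x
    simp only [matComp, Matrix.mul_apply, ketZero, braZero, onWire, boostOp]
    simp
    refine Finset.sum_eq_zero fun z _ => ?_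
    by_cases hz : z = 0
    · rw [hz, if_neg (by simp)]
    · rw [if_neg hz, ite_self]
  rw [h2] at h1
  have h3 : IsStab (toProj (braZero p n)) := by
    rw [braZero_eq]
    exact (isStab_ketZero n).adjoint
  have h4 : matComp (braZero p n) (matComp 0 (ketZero p m)) = 0 := by
    rw [matComp, matComp, Matrix.mul_zero, Matrix.zero_mul]
  rw [← h4]
  exact h3.comp (h1.comp (isStab_ketZero m))

/-- A class of matrices modulo scalars represents a relation. -/
def ClassRepresents {n m : ℕ} (h : (projMat p).Hom n m)
    (R : Set (Phase (ZMod p) n × Phase (ZMod p) m)) : Prop :=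
  ∃ M : QMat p n m, toProj M = h ∧ Represents M R

namespace ClassRepresents

variable [NeZero (2 : ZMod p)]

theorem unique {n m : ℕ} {h k : (projMat p).Hom n m}
    {R : Set (Phase (ZMod p) n × Phase (ZMod p) m)} (hh : ClassRepresents h R)
    (hk : ClassRepresents k R) : h = k := by
  obtain ⟨M, rfl, hM⟩ := hh
  obtain ⟨N, rfl, hN⟩ := hk
  exact hM.toProj_unique hN

theorem rel_unique {n m : ℕ} {h : (projMat p).Hom n m}
    {R S : Set (Phase (ZMod p) n × Phase (ZMod p) m)} (hR : ClassRepresents h R)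
    (hS : ClassRepresents h S) : R = S := by
  obtain ⟨M, rfl, hM⟩ := hR
  obtain ⟨N, hNM, hN⟩ := hS
  exact hM.rel_unique (hN.congr hNM)

theorem of_toProj {n m : ℕ} {M : QMat p n m} {R : Set (Phase (ZMod p) n × Phase (ZMod p) m)}
    (h : Represents M R) : ClassRepresents (toProj M) R := ⟨M, rfl, h⟩

theorem perm {a b : ℕ} (e : Fin a ≃ Fin b) :
    ClassRepresents ((projMat p).perm e) (relPerm (ZMod p) e) :=
  ⟨matPerm e, rfl, represents_matPerm e⟩

theorem comp {a b c : ℕ} {h : (projMat p).Hom a b} {k : (projMat p).Hom b c}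
    {R : Set (Phase (ZMod p) a × Phase (ZMod p) b)} {S : Set (Phase (ZMod p) b × Phase (ZMod p) c)}
    (hR : IsAffineLagrangian R) (hS : IsAffineLagrangian S) (hh : ClassRepresents h R)
    (hk : ClassRepresents k S) : ClassRepresents ((projMat p).comp h k) (relComp R S) := by
  obtain ⟨M, rfl, hM⟩ := hh
  obtain ⟨N, rfl, hN⟩ := hk
  exact ⟨matComp M N, rfl, hM.comp hR.isTorsor hS.isTorsor hN⟩

theorem tensor {a b c d : ℕ} {h : (projMat p).Hom a b} {k : (projMat p).Hom c d}
    {R : Set (Phase (ZMod p) a × Phase (ZMod p) b)} {S : Set (Phase (ZMod p) c × Phase (ZMod p) d)}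
    (hh : ClassRepresents h R) (hk : ClassRepresents k S) :
    ClassRepresents ((projMat p).tensor h k) (relTensor R S) := by
  obtain ⟨M, rfl, hM⟩ := hh
  obtain ⟨N, rfl, hN⟩ := hk
  exact ⟨matTensor M N, rfl, hM.tensor hN⟩

theorem adjoint {n m : ℕ} {h : (projMat p).Hom n m}
    {R : Set (Phase (ZMod p) n × Phase (ZMod p) m)} (hh : ClassRepresents h R) :
    ClassRepresents (projAdjoint h) {wv | (wv.2, wv.1) ∈ R} := by
  obtain ⟨M, rfl, hM⟩ := hh
  exact ⟨M.conjTranspose, rfl, hM.conjTranspose⟩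

end ClassRepresents

variable [NeZero (2 : ZMod p)]

theorem GateReach.exists_isStab {n : ℕ} {A : Set (Phase (ZMod p) n)} (hA : GateReach A) :
    ∃ h : (projMat p).Hom 0 n, IsStab h ∧ ClassRepresents h (stateRel A) := by
  induction hA with
  | zero => exact ⟨_, isStab_ketZero n, .of_toProj (represents_ketZero n)⟩
  | gate hg hA ih =>
    obtain ⟨h, h1, h2⟩ := ih
    refine ⟨_, h1.comp (.of (.clifford _ hg.isClifford)), ?_⟩
    rw [← relComp_stateRel]
    exact h2.comp (IsAffineLagrangian.of_generated hA.generated) hg.isAffineLagrangian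
      (.of_toProj hg.represents)

theorem exists_isStab_of_state {n : ℕ} {R : Set (Phase (ZMod p) 0 × Phase (ZMod p) n)}
    (hR : IsAffineLagrangian R) :
    ∃ h : (projMat p).Hom 0 n, IsStab h ∧ ClassRepresents h R := by
  rcases R.eq_empty_or_nonempty with rfl | hne
  · exact ⟨_, isStab_zero 0 n, .of_toProj (.zero 0 n)⟩
  · have := (hR.gateReach hne).exists_isStab
    rwa [stateRel_eq] at this

/-- The cup relation is a Lagrangian state, hence represented by a stabilizer state. The adjoint of
that state represents the converse relation, as the cap matrix does, so the two agree up to a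
scalar. -/
theorem isStab_capMat (n : ℕ) : IsStab (toProj (capMat p n)) := by
  obtain ⟨h, h1, h2⟩ := exists_isStab_of_state
    (IsAffineLagrangian.linear (isLagrangian_cupSpace (ZMod p) n))
  rw [(ClassRepresents.of_toProj (represents_capMat n)).unique h2.adjoint]
  exact h1.adjoint

/-- Representation respects composition, tensor products and wire permutations, so only generators
matter. The content lies in the Clifford case. -/
theorem IsStab.exists_generated {n m : ℕ} {h : (projMat p).Hom n m} (hh : IsStab h) :
    ∃ R : (phaseRel (ZMod p)).Hom n m, (phaseRel (ZMod p)).Generated (AffLagGen (ZMod p)) R ∧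
      ClassRepresents h R := by
  induction hh with
  | of h =>
    cases h with
    | clifford U hU =>
      obtain ⟨g, hg, hr⟩ := hU.exists_generated
      exact ⟨_, hg, .of_toProj hr⟩
    | ket =>
      exact ⟨_, .of (.linear (zeroSubmodule (ZMod p) 1) (isLagrangian_zeroSubmodule (ZMod p) 1)),
        .of_toProj (represents_ketZero 1)⟩
    | bra =>
      exact ⟨_, .of (.linear _ (isLagrangian_converse (isLagrangian_zeroSubmodule (ZMod p) 1))),
        .of_toProj (represents_braZero 1)⟩
  | perm e => exact ⟨_, .perm e, .perm e⟩
  | comp _ _ hf hg =>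
    obtain ⟨R, hR, hR'⟩ := hf
    obtain ⟨S, hS, hS'⟩ := hg
    exact ⟨_, hR.comp hS, hR'.comp (.of_generated hR) (.of_generated hS) hS'⟩
  | tensor _ _ hf hg =>
    obtain ⟨R, hR, hR'⟩ := hf
    obtain ⟨S, hS, hS'⟩ := hg
    exact ⟨_, hR.tensor hS, hR'.tensor hS'⟩

/-! ### Uncurrying -/

/-- The relation of `hMap` is the relation itself: the snake equation. -/
theorem relComp_curry_cap {a b : ℕ} (R : Set (Phase (ZMod p) a × Phase (ZMod p) b)) :
    relComp (relPerm (ZMod p) (rightWires a).symm)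
      (relComp (relTensor (relPerm (ZMod p) (Equiv.refl (Fin a)))
          (relComp (cupSpace (ZMod p) a : Set (Phase (ZMod p) 0 × Phase (ZMod p) (a + a)))
            (relTensor (relPerm (ZMod p) (Equiv.refl (Fin a))) R)))
        (relComp (relPerm (ZMod p) (assocWires a a b).symm)
          (relComp (relTensor (capRel (ZMod p) a) (relPerm (ZMod p) (Equiv.refl (Fin b))))
            (relPerm (ZMod p) (leftWires b))))) = R := by
  -- Cup and cap both relate `(x, z)` to `(-x, z)`. The sign occurs once in each and cancels along
  -- the snake.
  have hcup : ∀ (v : Phase (ZMod p) 0) (u : Phase (ZMod p) (a + a)),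
      (v, u) ∈ cupSpace (ZMod p) a ↔
        u.pull (Fin.natAdd a) = (-(u.1 ∘ Fin.castAdd a), u.2 ∘ Fin.castAdd a) := fun v u => by
    refine Iff.trans ?_ (Prod.ext_iff.trans (and_congr funext_iff funext_iff)).symm
    refine forall_and.trans (and_congr (forall_congr' fun i => ?_) (forall_congr' fun i => eq_comm))
    exact ⟨fun h => eq_neg_of_add_eq_zero_right (eq_neg_iff_add_eq_zero.1 h),
      fun h => eq_neg_of_add_eq_zero_left (by rw [add_comm]; exact eq_neg_iff_add_eq_zero.1 h)⟩
  ext ⟨v, w⟩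
  constructor
  · rintro ⟨u1, h1, u2, ⟨h2, u, hu, h3, h4⟩, u3, h5, u4, ⟨h6, h7⟩, h8⟩
    have h1' : v = u1.pull (rightWires a).symm := h1
    have h2' : u1.pull (Fin.castAdd 0) = u2.pull (Fin.castAdd (a + b)) := h2
    have h3' : u.pull (Fin.castAdd a) = (u2.pull (Fin.natAdd a)).pull (Fin.castAdd b) := h3
    have h5' : u2 = u3.pull (assocWires a a b).symm := h5
    have h7' : u3.pull (Fin.natAdd (a + a)) = u4.pull (Fin.natAdd 0) := h7
    have h8' : u4 = w.pull (leftWires b) := h8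
    have hu' := (hcup _ _).1 hu
    have h6' := (hcup _ _).1 h6
    have e1 : v = (u3.pull (Fin.castAdd b)).pull (Fin.castAdd a) := by
      rw [h1']
      exact h2'.trans (by rw [h5']; rfl)
    have e2 : u.pull (Fin.castAdd a) = (u3.pull (Fin.castAdd b)).pull (Fin.natAdd a) := by
      rw [h3', h5']
      rfl
    have e3 : (u2.pull (Fin.natAdd a)).pull (Fin.natAdd a) = w := by
      rw [h5', Phase.pull_pull, Phase.pull_pull, ← Function.comp_assoc,
        assocWires_symm_comp_natAdd, h7', h8',
        Phase.pull_pull, leftWires_comp_natAdd, Phase.pull_id]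
    have e4 : u.pull (Fin.natAdd a) = v := by
      rw [hu', e1]
      change (-(u.pull (Fin.castAdd a)).1, (u.pull (Fin.castAdd a)).2) = _
      rw [e2, h6', neg_neg]
      rfl
    rw [← e3, ← e4]
    exact h4
  · intro h
    -- The value carried by the middle strand of the snake, between the cup and the cap.
    let v' : Phase (ZMod p) a := (-v.1, v.2)
    have hv' : (0, v.append v') ∈ cupSpace (ZMod p) a := by
      rw [hcup, Phase.append_pull_natAdd]
      change v' = (-((v.append v').pull (Fin.castAdd a)).1, ((v.append v').pull (Fin.castAdd a)).2)
      rw [Phase.append_pull_castAdd]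
    have hv'' : (0, v'.append v) ∈ cupSpace (ZMod p) a := by
      rw [hcup, Phase.append_pull_natAdd]
      change v = (-((v'.append v).pull (Fin.castAdd a)).1, ((v'.append v).pull (Fin.castAdd a)).2)
      rw [Phase.append_pull_castAdd, neg_neg]
    let u3 : Phase (ZMod p) (a + a + b) := (v.append v').append w
    refine ⟨v.pull (rightWires a), rfl, u3.pull (assocWires a a b).symm,
      ⟨?_, v'.append v, ?_, ?_, ?_⟩, u3, rfl, w.pull (leftWires b), ⟨?_, ?_⟩, rfl⟩
    · change v = (u3.pull (Fin.castAdd b)).pull (Fin.castAdd a)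
      rw [Phase.append_pull_castAdd, Phase.append_pull_castAdd]
    · exact hv''
    · change (v'.append v).pull (Fin.castAdd a) = (u3.pull (Fin.castAdd b)).pull (Fin.natAdd a)
      rw [Phase.append_pull_castAdd, Phase.append_pull_castAdd, Phase.append_pull_natAdd]
    · change ((v'.append v).pull (Fin.natAdd a), ((u3.pull (assocWires a a b).symm).pull
        (Fin.natAdd a)).pull (Fin.natAdd a)) ∈ R
      rw [Phase.append_pull_natAdd, Phase.pull_pull, Phase.pull_pull, ← Function.comp_assoc,
        assocWires_symm_comp_natAdd,
        Phase.append_pull_natAdd]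
      exact h
    · change (_, u3.pull (Fin.castAdd b)) ∈ cupSpace (ZMod p) a
      rw [Phase.append_pull_castAdd]
      exact hv'
    · change u3.pull (Fin.natAdd (a + a)) = (w.pull (leftWires b)).pull (Fin.natAdd 0)
      rw [Phase.append_pull_natAdd, Phase.pull_pull, leftWires_comp_natAdd, Phase.pull_id]

theorem AffLagRel.isAffineLagrangian {n m : AffLagRel (ZMod p)} (f : n ⟶ m) :
    IsAffineLagrangian (f.1 : Set (Phase (ZMod p) n.wires × Phase (ZMod p) m.wires)) :=
  .of_generated f.2

/-- The state map takes every affine Lagrangian state to the stabilizer state representing it. -/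
def RepresentsStates (G : StateMap p) : Prop :=
  ∀ (n : ℕ) (A : 𝟙_ (AffLagRel (ZMod p)) ⟶ ⟨n⟩),
    ClassRepresents (n := 0) (m := n) (G n A).1 A.1

namespace RepresentsStates

variable {G : StateMap p}

/-- Each factor in the definition of `hMap` represents a known affine Lagrangian relation, so the
composite represents the relational composite. The snake equation identifies the latter with `f`. -/
theorem classRepresents_hMap (hG : RepresentsStates G) {n m : AffLagRel (ZMod p)} (f : n ⟶ m) :
    ClassRepresents (n := n.wires) (m := m.wires) (hMap G f) f.1 := by
  have hf := AffLagRel.isAffineLagrangian f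
  have hψ := hG _ (curry f)
  have a1 := IsAffineLagrangian.perm (K := ZMod p) (rightWires n.wires).symm
  have a2 := IsAffineLagrangian.perm (K := ZMod p) (Equiv.refl (Fin n.wires))
  have a3 := IsAffineLagrangian.perm (K := ZMod p) (assocWires n.wires n.wires m.wires).symm
  have a4 := IsAffineLagrangian.perm (K := ZMod p) (Equiv.refl (Fin m.wires))
  have a5 := IsAffineLagrangian.perm (K := ZMod p) (leftWires m.wires)
  have a6 := isAffineLagrangian_capRel (p := p) n.wires
  have a7 : IsAffineLagrangian (relComp (cupSpace (ZMod p) n.wires : Set (Phase (ZMod p) 0 × _))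
      (relTensor (relPerm (ZMod p) (Equiv.refl (Fin n.wires))) f.1)) :=
    (IsAffineLagrangian.linear (isLagrangian_cupSpace (ZMod p) n.wires)).comp (a2.tensor hf)
  have b1 := (ClassRepresents.perm (p := p) (rightWires n.wires).symm).comp a1
    ((a2.tensor a7).comp (a3.comp ((a6.tensor a4).comp a5)))
    (((ClassRepresents.perm (Equiv.refl (Fin n.wires))).tensor hψ).comp (a2.tensor a7)
      (a3.comp ((a6.tensor a4).comp a5))
      ((ClassRepresents.perm (assocWires n.wires n.wires m.wires).symm).comp a3
        ((a6.tensor a4).comp a5)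
        (((ClassRepresents.of_toProj (represents_capMat n.wires)).tensor
          (.perm (Equiv.refl (Fin m.wires)))).comp (a6.tensor a4) a5 (.perm (leftWires m.wires)))))
  have b2 := relComp_curry_cap (p := p) (a := n.wires) (b := m.wires) f.1
  rw [b2] at b1
  exact b1

theorem isStab_hMap {n m : AffLagRel (ZMod p)} (f : n ⟶ m) :
    IsStab (n := n.wires) (m := m.wires) (hMap G f) :=
  .comp (.perm _) (.comp (.tensor (.perm _) (G _ (curry f)).2) (.comp (.perm _)
    (.comp (.tensor (isStab_capMat _) (.perm _)) (.perm _))))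

/-- In each functor law both sides represent the same relation, hence agree up to a scalar. -/
theorem definesFunctor (hG : RepresentsStates G) : DefinesFunctor G where
  mem f := isStab_hMap f
  map_id n := (hG.classRepresents_hMap (𝟙 n)).unique (.perm (Equiv.refl (Fin n.wires)))
  map_comp f g := (hG.classRepresents_hMap (f ≫ g)).unique
    ((hG.classRepresents_hMap f).comp (AffLagRel.isAffineLagrangian f)
      (AffLagRel.isAffineLagrangian g) (hG.classRepresents_hMap g))

end RepresentsStates

end Stabilizers

/-! ### The state map -/

section Main

variable {p : ℕ} [Fact p.Prime] [NeZero (2 : ZMod p)]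

theorem exists_representsStates : ∃ G : StateMap p, RepresentsStates G := by
  have h := fun (n : ℕ) (A : 𝟙_ (AffLagRel (ZMod p)) ⟶ ⟨n⟩) =>
    exists_isStab_of_state (AffLagRel.isAffineLagrangian A)
  choose G hG hG' using h
  exact ⟨fun n A => ⟨G n A, hG n A⟩, hG'⟩

namespace RepresentsStates

variable {G : StateMap p}

theorem isGross (hG : RepresentsStates G) : IsGross G where
  empty n A h := by
    have := hG n A
    rw [h] at this
    exact this.unique (.of_toProj (.zero 0 n))
  zero n A h := by
    have := hG n A
    rw [h] at this
    exact this.unique (.of_toProj (represents_ketZero n))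
  gate n A B g U hg h := by
    have := hG n B
    rw [h] at this
    exact this.unique ((hG n A).comp (AffLagRel.isAffineLagrangian A) hg.isAffineLagrangian
      (.of_toProj hg.represents))

/-- Injectivity holds because a class determines the relation it represents. Surjectivity holds
because a stabilizer state represents some generated relation, and that relation determines the
class. -/
theorem bijective (hG : RepresentsStates G) (n : ℕ) : Function.Bijective (G n) := by
  constructor
  · intro A B h
    have := hG n A
    rw [h] at this
    exact Subtype.ext (this.rel_unique (hG n B))
  · intro h
    obtain ⟨R, hR, hR'⟩ := IsStab.exists_generated h.2
    exact ⟨⟨R, hR⟩, Subtype.ext ((hG n ⟨R, hR⟩).unique hR')⟩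

theorem isEquivalence (hG : RepresentsStates G) :
    (hFunctor G hG.definesFunctor).IsEquivalence where
  faithful := ⟨fun {n m f g} h => by
    have h1 := hG.classRepresents_hMap f
    rw [show hMap G f = hMap G g from congrArg Subtype.val h] at h1
    exact Subtype.ext (h1.rel_unique (hG.classRepresents_hMap g))⟩
  full := ⟨fun {n m} h => by
    obtain ⟨R, hR, hR'⟩ := IsStab.exists_generated h.2
    let f : n ⟶ m := ⟨R, hR⟩
    exact ⟨f, Subtype.ext ((hG.classRepresents_hMap f).unique hR')⟩⟩
  essSurj := ⟨fun n => ⟨⟨n.wires⟩, ⟨Iso.refl _⟩⟩⟩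

/-! ### The strict monoidal structure of the functor -/

theorem hMap_perm (hG : RepresentsStates G) {n m : AffLagRel (ZMod p)}
    (e : Fin n.wires ≃ Fin m.wires) :
    (hFunctor G hG.definesFunctor).map ((affLagRel (ZMod p)).permIso e).hom =
      (stab p).perm e :=
  Subtype.ext ((hG.classRepresents_hMap ((affLagRel (ZMod p)).permIso e).hom).unique (.perm e))

theorem hMap_tensor (hG : RepresentsStates G) {a b c d : AffLagRel (ZMod p)} (f : a ⟶ b)
    (g : c ⟶ d) :
    (hFunctor G hG.definesFunctor).map (f ⊗ₘ g) = (stab p).tensor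
      ((hFunctor G hG.definesFunctor).map f) ((hFunctor G hG.definesFunctor).map g) :=
  Subtype.ext ((hG.classRepresents_hMap (f ⊗ₘ g)).unique
    ((hG.classRepresents_hMap f).tensor (hG.classRepresents_hMap g)))

/-- The functor given by the uncurrying of a state map, with identities as structure morphisms. -/
def coreMonoidal (hG : RepresentsStates G) : (hFunctor G hG.definesFunctor).CoreMonoidal where
  -- With identity structure maps, naturality amounts to preservation of tensor products. The
  -- coherence axioms amount to preservation of the wire permutations that serve as associators and
  -- unitors.
  εIso := Iso.refl (𝟙_ (Stab p))
  μIso m n := Iso.refl ((hFunctor G hG.definesFunctor).obj m ⊗ (hFunctor G hG.definesFunctor).obj n)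
  μIso_hom_natural_left {a b} f c := by
    refine (Category.comp_id _).trans (Eq.trans ?_ (Category.id_comp _).symm)
    exact ((hG.hMap_tensor f (𝟙 c)).trans (congrArg ((stab p).tensor _) (CategoryTheory.Functor.map_id _ c))).symm
  μIso_hom_natural_right {a b} c f := by
    refine (Category.comp_id _).trans (Eq.trans ?_ (Category.id_comp _).symm)
    exact ((hG.hMap_tensor (𝟙 c) f).trans
      (congrArg (fun k => (stab p).tensor k _) (CategoryTheory.Functor.map_id _ c))).symm
  associativity a b c := by
    refine Eq.trans (congrArg₂ _ (id_whiskerRight _ _) ((Category.id_comp _).trans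
      (hG.hMap_perm (assocWires a.wires b.wires c.wires)))) ((Category.id_comp _).trans ?_)
    refine Eq.trans ?_ (congrArg₂ _ rfl ((Category.comp_id _).trans (whiskerLeft_id _ _))).symm
    exact (Category.comp_id (α_ ((hFunctor G hG.definesFunctor).obj a)
      ((hFunctor G hG.definesFunctor).obj b) ((hFunctor G hG.definesFunctor).obj c)).hom).symm
  left_unitality a := by
    refine Eq.trans ?_ (congrArg₂ _ (id_whiskerRight _ _) ((Category.id_comp _).trans
      (hG.hMap_perm (leftWires a.wires)))).symm
    exact (Category.id_comp (λ_ _).hom).symm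
  right_unitality a := by
    refine Eq.trans ?_ (congrArg₂ _ (whiskerLeft_id _ _) ((Category.id_comp _).trans
      (hG.hMap_perm (rightWires a.wires)))).symm
    exact (Category.id_comp (ρ_ _).hom).symm

end RepresentsStates

/-- The equations fix the values at the empty state and at `{z = 0}` and propagate along gates.
Every nonempty affine Lagrangian state is reached by gates from `{z = 0}`, so nothing is left free.
-/
theorem IsGross.eq {G G' : StateMap p} (hG : IsGross G) (hG' : IsGross G') : G' = G := by
  funext n A
  refine Subtype.ext ?_
  rcases (A.1 : Set (Phase (ZMod p) 0 × Phase (ZMod p) n)).eq_empty_or_nonempty with he | hne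
  · rw [hG.empty n A he, hG'.empty n A he]
  · have key : ∀ {S : Set (Phase (ZMod p) n)}, GateReach S →
        ∀ B : 𝟙_ (AffLagRel (ZMod p)) ⟶ ⟨n⟩, B.1 = stateRel S → (G' n B).1 = (G n B).1 := by
      intro S hS
      induction hS with
      | zero =>
        intro B hB
        rw [hG.zero n B hB, hG'.zero n B hB]
      | gate hg hS ih =>
        intro B hB
        have hB' := hB.trans (relComp_stateRel _ _).symm
        -- The gate equation applies to morphisms only, so the intermediate reachable set must
        -- itself be a generated relation.
        rw [hG.gate n ⟨_, hS.generated⟩ B _ _ hg hB', hG'.gate n ⟨_, hS.generated⟩ B _ _ hg hB',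
          ih ⟨_, hS.generated⟩ rfl]
    exact key ((AffLagRel.isAffineLagrangian A).gateReach hne) A (stateRel_eq _).symm

end Main

theorem theorem3 (p : ℕ) [Fact p.Prime] (hp : p ≠ 2) :
    ∃ G : StateMap p,
      IsGross G ∧ (∀ G' : StateMap p, IsGross G' → G' = G) ∧
      (∀ n : ℕ, Function.Bijective (G n)) ∧
      ∃ h : DefinesFunctor G,
        (hFunctor G h).IsEquivalence ∧
        ∃ B : (hFunctor G h).Braided,
          Functor.LaxMonoidal.ε (hFunctor G h) = 𝟙 (𝟙_ (Stab p)) ∧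
          ∀ m n : AffLagRel (ZMod p),
            Functor.LaxMonoidal.μ (hFunctor G h) m n =
              𝟙 ((hFunctor G h).obj m ⊗ (hFunctor G h).obj n) := by
  have : NeZero (2 : ZMod p) := ⟨fun h => hp <| by
    have : ((2 : ℕ) : ZMod p) = 0 := by exact_mod_cast h
    exact (Nat.prime_dvd_prime_iff_eq Fact.out Nat.prime_two).1 ((ZMod.natCast_eq_zero_iff 2 p).1 this)⟩
  obtain ⟨G, hG⟩ := exists_representsStates (p := p)
  refine ⟨G, hG.isGross, fun G' hG' => hG.isGross.eq hG', hG.bijective, hG.definesFunctor,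
    hG.isEquivalence, ?_⟩
  let _ := hG.coreMonoidal.toMonoidal
  -- The structure maps are identities, so compatibility with the braiding reduces to preservation
  -- of the wire permutation that swaps two blocks.
  refine ⟨{ braided := fun a b => ?_ }, rfl, fun m n => rfl⟩
  refine ((Category.id_comp _).trans (hG.hMap_perm (swapWires a.wires b.wires))).trans ?_
  exact (Category.comp_id (β_ ((hFunctor G hG.definesFunctor).obj a)
    ((hFunctor G hG.definesFunctor).obj b)).hom).symm
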